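/- **Setting.** Let $M$ be a smooth connected manifold (finite-dimensional, Hausdorff, second countable, without boundary) and let $\mathfrak g$ be a Lie algebroid over $M$: a smooth vector bundle of finite rank with a smooth bundle map $\#:\mathfrak g\to TM$ (the anchor) and a Lie bracket on $\Gamma(\mathfrak g)$ such that $[X,fY]=f[X,Y]+(\#X\,f)\,Y$ and $\#[X,Y]=[\#X,\#Y]$. No transitivity is assumed. Let $\nabla$ be a smooth linear connection on $\mathfrak g$, and for $X\in\Gamma(\mathfrak g)$ and a vector field $W$ put $$\bar\nabla_X W=\#\nabla_W X+[\#X,W].$$ Suppose that $\nabla$ is flat and that $\nabla$ is a *Cartan connection*, i.e. that for all $X,Y\in\Gamma(\mathfrak g)$ and all vector fields $W$ $$\nabla_W[X,Y]-[\nabla_WX,Y]-[X,\nabla_WY]+\nabla_{\bar\nabla_XW}Y-\nabla_{\bar\nabla_YW}X=0 .$$ (Equivalently, the splitting $\mathfrak g\to J^1\mathfrak g$ defined by $\nabla$ is a morphism of Lie algebroids.) A *geodesic* of $\nabla$ is a smooth path $t\mapsto X_t\in\mathfrak g$, defined on a nondegenerate interval of $\mathbb R$, whose footprint $m_t\in M$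 satisfies $\#X_t=\dot m_t$ and $\nabla_{\dot m_t}X_t=0$ for all $t$. The connection $\nabla$ is *complete* if every geodesic extends to a geodesic defined for all $t\in\mathbb R$. Let $p:\tilde M\to M$ be the universal covering, $\Gamma$ its group of covering transformations, and $\mathfrak g_0$ the finite-dimensional vector space of sections of $p^*\mathfrak g$ that are parallel for the pullback of $\nabla$. It is a Lie algebra for the bracket which is locally the bracket of sections of $\mathfrak g$. The *monodromy representation* $\mu:\Gamma\to\mathrm{Aut}(\mathfrak g_0)$ is given by $(\mu_\phi\xi)(\tilde m)=\phi\cdot\xi(\phi^{-1}\tilde m)$, where $\phi\,\cdot$ maps the fibre of $p^*\mathfrak g$ over $\phi^{-1}\tilde m$ to that over $\tilde m$ by identifying both with the fibre of $\mathfrak g$ over $p(\tilde m)$. A Riemannian metric $\sigma$ on $M$ is *$\mathfrak g$-invariant* if $\#X(\sigma(W,W'))=\sigma(\bar\nabla_XW,W')+\sigma(W,\bar\nabla_XW')$ for all $X\in\Gamma(\mathfrak g)$ and all vector fields $W,W'$. **Proposition 6.2.** Assume that one of the following conditions holds: 1. $M$ is compact and the image $\mu(\Gamma)\subset\mathrm{Aut}(\mathfrak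 g_0)$ of the monodromy representation has compact closure in $\mathrm{Aut}(\mathfrak g_0)$; or 2. $M$ admits a $\mathfrak g$-invariant Riemannian metric $\sigma$, and the distance of this metric makes $M$ into a complete metric space (which is automatically true if $M$ is compact). Then $\nabla$ is complete. -/

import Mathlib

open Bundle Set Filter Topology
open scoped Manifold ContDiff

set_option linter.unusedSectionVars false

noncomputable section

namespace CartanAlgebroid

variable {E : Type*} [NormedAddCommGroup E] [NormedSpace ℝ E] [FiniteDimensional ℝ E]
  {M : Type*} [TopologicalSpace M] [ChartedSpace E M] [IsManifold 𝓘(ℝ, E) ∞ M]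
  {F : Type*} [NormedAddCommGroup F] [NormedSpace ℝ F]
  {V : M → Type*} [TopologicalSpace (TotalSpace F V)]
  [∀ x, AddCommGroup (V x)] [∀ x, Module ℝ (V x)] [∀ x, TopologicalSpace (V x)]
  [∀ x, IsTopologicalAddGroup (V x)] [∀ x, ContinuousSMul ℝ (V x)]
  [FiberBundle F V] [VectorBundle ℝ F V] [ContMDiffVectorBundle ∞ F V 𝓘(ℝ, E)]

/-! ### Smooth sections -/

/-- The product `f X` of a smooth function and a smooth section. -/
def fsmul (f : C^∞⟮𝓘(ℝ, E), M; 𝓘(ℝ, ℝ), ℝ⟯) (X : Cₛ^∞⟮𝓘(ℝ, E); F, V⟯) :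
    Cₛ^∞⟮𝓘(ℝ, E); F, V⟯ where
  toFun x := f x • X x
  contMDiff_toFun := f.contMDiff.smul_section X.contMDiff

/-- The smooth section `∇_W X`, for a smooth linear connection `∇`, a smooth vector field `W` and
a smooth section `X`. -/
def covSection (cov : CovariantDerivative 𝓘(ℝ, E) F V)
    [hc : CovariantDerivative.ContMDiffCovariantDerivative cov ∞]
    (W : Cₛ^∞⟮𝓘(ℝ, E); E, (TangentSpace 𝓘(ℝ, E) : M → Type _)⟯) (X : Cₛ^∞⟮𝓘(ℝ, E); F, V⟯) :
    Cₛ^∞⟮𝓘(ℝ, E); F, V⟯ where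
  toFun x := cov X x (W x)
  contMDiff_toFun := by
    have h := hc.contMDiff.contMDiff (σ := X) (by simpa using X.contMDiff.contMDiffOn)
    exact ContMDiff.clm_bundle_apply (contMDiffOn_univ.mp h) W.contMDiff

/-! ### Lie algebroids -/

variable (E F V) in
/-- A Lie algebroid structure on the smooth vector bundle `V` over `M`: a smooth bundle map
`# : V → TM` (the anchor) and a Lie bracket on the space of smooth sections, subject to the
Leibniz rule, such that the anchor is compatible with the brackets. -/
structure LieAlgebroid where
  /-- The anchor. -/
  anchor : ∀ x : M, V x →L[ℝ] TangentSpace 𝓘(ℝ, E) x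
  contMDiff_anchor : ContMDiff 𝓘(ℝ, E) (𝓘(ℝ, E).prod 𝓘(ℝ, F →L[ℝ] E)) ∞
    (fun x ↦ TotalSpace.mk' (F →L[ℝ] E) (E := fun x : M ↦ V x →L[ℝ] TangentSpace 𝓘(ℝ, E) x)
      x (anchor x))
  /-- The Lie bracket of smooth sections. -/
  bracket : Cₛ^∞⟮𝓘(ℝ, E); F, V⟯ →ₗ[ℝ] Cₛ^∞⟮𝓘(ℝ, E); F, V⟯ →ₗ[ℝ] Cₛ^∞⟮𝓘(ℝ, E); F, V⟯
  bracket_self : ∀ X, bracket X X = 0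
  jacobi : ∀ X Y Z, bracket X (bracket Y Z) = bracket (bracket X Y) Z + bracket Y (bracket X Z)
  leibniz : ∀ (X : Cₛ^∞⟮𝓘(ℝ, E); F, V⟯) (f : C^∞⟮𝓘(ℝ, E), M; 𝓘(ℝ, ℝ), ℝ⟯)
    (Y : Cₛ^∞⟮𝓘(ℝ, E); F, V⟯) (x : M),
    bracket X (fsmul f Y) x =
      f x • bracket X Y x + mvfderiv 𝓘(ℝ, E) f x (anchor x (X x)) • Y x
  anchor_bracket : ∀ (X Y : Cₛ^∞⟮𝓘(ℝ, E); F, V⟯) (x : M),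
    anchor x (bracket X Y x) =
      VectorField.mlieBracket 𝓘(ℝ, E) (fun y ↦ anchor y (X y)) (fun y ↦ anchor y (Y y)) x

namespace LieAlgebroid

variable (A : LieAlgebroid E F V) (cov : CovariantDerivative 𝓘(ℝ, E) F V)

/-- The value at `x` of `∇̄_X W = # ∇_W X + [# X, W]`, where `∇̄` is the connection of the Lie
algebroid on `TM` that is associated with the linear connection `∇`. -/
def assocConn (X : Cₛ^∞⟮𝓘(ℝ, E); F, V⟯)
    (W : Cₛ^∞⟮𝓘(ℝ, E); E, (TangentSpace 𝓘(ℝ, E) : M → Type _)⟯) (x : M) :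
    TangentSpace 𝓘(ℝ, E) x :=
  A.anchor x (cov X x (W x)) +
    VectorField.mlieBracket 𝓘(ℝ, E) (fun y ↦ A.anchor y (X y)) (fun y ↦ W y) x

/-- The value at `x` of the cocurvature of `∇`,
`∇_W [X, Y] - [∇_W X, Y] - [X, ∇_W Y] + ∇_{∇̄_X W} Y - ∇_{∇̄_Y W} X`. -/
def cocurvature [CovariantDerivative.ContMDiffCovariantDerivative cov ∞]
    (X Y : Cₛ^∞⟮𝓘(ℝ, E); F, V⟯)
    (W : Cₛ^∞⟮𝓘(ℝ, E); E, (TangentSpace 𝓘(ℝ, E) : M → Type _)⟯) (x : M) : V x :=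
  cov (A.bracket X Y) x (W x) - A.bracket (covSection cov W X) Y x
    - A.bracket X (covSection cov W Y) x
    + cov Y x (A.assocConn cov X W x) - cov X x (A.assocConn cov Y W x)

/-- A linear connection on a Lie algebroid is a Cartan connection if its cocurvature vanishes.
In terms of the splitting `Γ(J¹V) = J¹ Γ(V) ⊕ Γ(T*M ⊗ V)` of one-jets, the cocurvature is
`s [X, Y] - [s X, s Y]` for the splitting `s X = J¹ X + ∇ X` of `J¹ V → V` defined by `∇`,
so this says that `s` is a morphism of Lie algebroids. -/
def IsCartan [CovariantDerivative.ContMDiffCovariantDerivative cov ∞] : Prop :=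
  ∀ X Y W x, A.cocurvature cov X Y W x = 0

end LieAlgebroid

/-- A linear connection is flat if its curvature vanishes:
`∇_W ∇_W' X - ∇_W' ∇_W X - ∇_[W, W'] X = 0`. -/
def IsFlat (cov : CovariantDerivative 𝓘(ℝ, E) F V)
    [CovariantDerivative.ContMDiffCovariantDerivative cov ∞] : Prop :=
  ∀ (W W' : Cₛ^∞⟮𝓘(ℝ, E); E, (TangentSpace 𝓘(ℝ, E) : M → Type _)⟯)
    (X : Cₛ^∞⟮𝓘(ℝ, E); F, V⟯) (x : M),
    cov (covSection cov W' X) x (W x) - cov (covSection cov W X) x (W' x)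
      - cov X x (VectorField.mlieBracket 𝓘(ℝ, E) (fun y ↦ W y) (fun y ↦ W' y) x) = 0

/-! ### Geodesics and completeness -/

/-- The velocity at time `t` of the footprint of a path `X` in `V` defined on `J`. -/
def velocityWithin (J : Set ℝ) (X : ℝ → TotalSpace F V) (t : ℝ) :
    TangentSpace 𝓘(ℝ, E) (X t).proj :=
  mfderivWithin 𝓘(ℝ, ℝ) 𝓘(ℝ, E) (fun s ↦ (X s).proj) J t (1 : ℝ)

/-- The covariant derivative `∇_{ṁ} X` at time `t` of a path `X` in `V` over the path `m` in `M`,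
defined on `J`. If `u s` represents `X s` in a local trivialization at `m t` (so `u s` has
values in the model fibre `F`), it is the vector represented by `u' t` plus the derivative in
direction `ṁ t` of the local section which is constantly `u t` in the trivialization. -/
def covDerivAlongWithin (cov : CovariantDerivative 𝓘(ℝ, E) F V) (J : Set ℝ)
    (X : ℝ → TotalSpace F V) (t : ℝ) : V (X t).proj :=
  (trivializationAt F V (X t).proj).symm (X t).proj
      (derivWithin (fun s ↦ (trivializationAt F V (X t).proj (X s)).2) J t)
    + cov (FiberBundle.extend F (X t).2) (X t).proj (velocityWithin J X t)

/-- `X` restricts to a smooth path on `J` with `# X = ṁ` (`m` being the footprint of `X`)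
and `∇_{ṁ} X = 0`, i.e. to a geodesic of `∇`. -/
structure IsGeodesicOn (A : LieAlgebroid E F V) (cov : CovariantDerivative 𝓘(ℝ, E) F V)
    (J : Set ℝ) (X : ℝ → TotalSpace F V) : Prop where
  contMDiffOn : ContMDiffOn 𝓘(ℝ, ℝ) (𝓘(ℝ, E).prod 𝓘(ℝ, F)) ∞ X J
  anchor_eq : ∀ t ∈ J, A.anchor (X t).proj (X t).2 = velocityWithin J X t
  parallel : ∀ t ∈ J, covDerivAlongWithin cov J X t = 0

/-- `∇` is complete: every geodesic, defined on some (nondegenerate) interval `J`, extends to a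
geodesic defined for all times. -/
def IsGeodesicallyComplete (A : LieAlgebroid E F V) (cov : CovariantDerivative 𝓘(ℝ, E) F V) :
    Prop :=
  ∀ (J : Set ℝ) (X : ℝ → TotalSpace F V), J.OrdConnected → J.Nontrivial →
    IsGeodesicOn A cov J X → ∃ Y : ℝ → TotalSpace F V, IsGeodesicOn A cov univ Y ∧ EqOn Y X J

/-! ### Invariant Riemannian metrics -/

/-- The Riemannian metric `σ` is invariant under the Lie algebroid: `∇̄_X σ = 0` for all sections
`X`, for the representation on `S² T*M` induced by the representation `∇̄` on `TM`. -/
def IsInvariantMetric (A : LieAlgebroid E F V) (cov : CovariantDerivative 𝓘(ℝ, E) F V)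
    (σ : ContMDiffRiemannianMetric 𝓘(ℝ, E) ∞ E (TangentSpace 𝓘(ℝ, E) : M → Type _)) : Prop :=
  ∀ (X : Cₛ^∞⟮𝓘(ℝ, E); F, V⟯)
    (W W' : Cₛ^∞⟮𝓘(ℝ, E); E, (TangentSpace 𝓘(ℝ, E) : M → Type _)⟯) (x : M),
    mvfderiv 𝓘(ℝ, E) (fun y ↦ σ.inner y (W y) (W' y)) x (A.anchor x (X x))
      - σ.inner x (A.assocConn cov X W x) (W' x)
      - σ.inner x (W x) (A.assocConn cov X W' x) = 0

/-- `M` is a complete metric space for the distance (infimum of lengths of paths) of the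
Riemannian metric `σ`. -/
def IsCompleteMetric [T2Space M]
    (σ : ContMDiffRiemannianMetric 𝓘(ℝ, E) ∞ E (TangentSpace 𝓘(ℝ, E) : M → Type _)) : Prop :=
  haveI : LocallyCompactSpace M := Manifold.locallyCompact_of_finiteDimensional 𝓘(ℝ, E)
  letI : RiemannianBundle (fun x : M ↦ TangentSpace 𝓘(ℝ, E) x) :=
    ⟨σ.toContinuousRiemannianMetric.toRiemannianMetric⟩
  letI : EMetricSpace M := EMetricSpace.ofRiemannianMetric 𝓘(ℝ, E) M
  CompleteSpace M

/-! ### Locality of the bracket -/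

namespace LieAlgebroid

theorem bracket_congr_right [T2Space M] (A : LieAlgebroid E F V)
    {X Y Y' : Cₛ^∞⟮𝓘(ℝ, E); F, V⟯} {x : M}
    (h : ∀ᶠ y in 𝓝 x, Y y = Y' y) : A.bracket X Y x = A.bracket X Y' x := by
  obtain ⟨b, -, hb⟩ := (SmoothBumpFunction.nhds_basis_tsupport (I := 𝓘(ℝ, E)) x).mem_iff.1 h
  let f : C^∞⟮𝓘(ℝ, E), M; 𝓘(ℝ, ℝ), ℝ⟯ := ⟨b, b.contMDiff⟩
  have key : fsmul f Y = fsmul f Y' := by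
    ext y
    change b y • Y y = b y • Y' y
    by_cases hy : y ∈ tsupport b
    · rw [hb hy]
    · rw [image_eq_zero_of_notMem_tsupport hy, zero_smul, zero_smul]
  have h1 := A.leibniz X f Y x
  have h2 := A.leibniz X f Y' x
  rw [key, h2, h.self_of_nhds] at h1
  have hfx : f x = 1 := b.eq_one
  rw [hfx, one_smul, one_smul] at h1
  exact (add_right_cancel h1).symm

theorem bracket_swap (A : LieAlgebroid E F V) (X Y : Cₛ^∞⟮𝓘(ℝ, E); F, V⟯) :
    A.bracket X Y = - A.bracket Y X := by
  have h := A.bracket_self (X + Y)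
  simp only [map_add, LinearMap.add_apply, A.bracket_self, zero_add, add_zero] at h
  rw [add_comm] at h
  exact eq_neg_of_add_eq_zero_left h

theorem bracket_congr [T2Space M] (A : LieAlgebroid E F V)
    {X X' Y Y' : Cₛ^∞⟮𝓘(ℝ, E); F, V⟯} {x : M}
    (hX : ∀ᶠ y in 𝓝 x, X y = X' y) (hY : ∀ᶠ y in 𝓝 x, Y y = Y' y) :
    A.bracket X Y x = A.bracket X' Y' x := by
  rw [A.bracket_congr_right hY, A.bracket_swap X, A.bracket_swap X']
  change - A.bracket Y' X x = - A.bracket Y' X' x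
  rw [A.bracket_congr_right hX]

end LieAlgebroid

/-- A tangent vector extends to a smooth vector field. -/
theorem exists_vectorField [T2Space M] {x : M} (w : TangentSpace 𝓘(ℝ, E) x) :
    ∃ W : Cₛ^∞⟮𝓘(ℝ, E); E, (TangentSpace 𝓘(ℝ, E) : M → Type _)⟯, W x = w := by
  obtain ⟨s, hs, hsm⟩ := FiberBundle.exists_contMDiffOn_extend (k := ∞) 𝓘(ℝ, E) E w
  obtain ⟨u, hus, hu, hxu⟩ := mem_nhds_iff.1 hs
  obtain ⟨b, -, hb⟩ := (SmoothBumpFunction.nhds_basis_tsupport (I := 𝓘(ℝ, E)) x).mem_iff.1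
    (hu.mem_nhds hxu)
  refine ⟨⟨_, ContMDiffOn.smul_section_of_tsupport b.contMDiff.contMDiffOn hu hb
    (hsm.mono hus)⟩, ?_⟩
  change b x • FiberBundle.extend E w x = w
  rw [b.eq_one, one_smul, FiberBundle.extend_apply_self]

/-! ### Parallel sections over a covering space -/

section Parallel

variable {M' : Type*} [TopologicalSpace M']

/-- The vector space of sections of the pullback `p^* V` along a covering `p : M' → M` that are
parallel for the pullback of the connection `∇`. As `p` is a local diffeomorphism, a section `ξ`
of `p^* V` is smooth and parallel iff near every point it is the pullback of a smooth section
of `V` that is `∇`-parallel near the image point (and the germ of a smooth section of `V` is the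
germ of a global one). -/
def parallelSections (cov : CovariantDerivative 𝓘(ℝ, E) F V) (p : M' → M) :
    Submodule ℝ (∀ x : M', V (p x)) where
  carrier := {ξ | ∀ x, ∃ S : Cₛ^∞⟮𝓘(ℝ, E); F, V⟯, ∀ᶠ y in 𝓝 x, ξ y = S (p y) ∧ cov S (p y) = 0}
  zero_mem' := fun x ↦ ⟨0, Eventually.of_forall fun y ↦
    ⟨rfl, by rw [ContMDiffSection.coe_zero, cov.zero]; rfl⟩⟩
  add_mem' := by
    intro ξ η hξ hη x
    obtain ⟨S, hS⟩ := hξ x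
    obtain ⟨T, hT⟩ := hη x
    refine ⟨S + T, ?_⟩
    filter_upwards [hS, hT] with y h1 h2
    refine ⟨by rw [Pi.add_apply, h1.1, h2.1]; rfl, ?_⟩
    rw [ContMDiffSection.coe_add, cov.isCovariantDerivativeOnUniv.add S.mdifferentiableAt
      T.mdifferentiableAt, h1.2, h2.2, add_zero]
  smul_mem' := by
    intro c ξ hξ x
    obtain ⟨S, hS⟩ := hξ x
    refine ⟨c • S, ?_⟩
    filter_upwards [hS] with y h1
    refine ⟨by rw [Pi.smul_apply, h1.1]; rfl, ?_⟩
    rw [ContMDiffSection.coe_smul, cov.isCovariantDerivativeOnUniv.smul_const c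
      S.mdifferentiableAt, h1.2, smul_zero]

/-- The smooth section `S` of `V` represents the section `ξ` of `p^* V` near `x`. -/
def IsGerm {p : M' → M} (ξ : ∀ x : M', V (p x)) (x : M') (S : Cₛ^∞⟮𝓘(ℝ, E); F, V⟯) : Prop :=
  ∀ᶠ y in 𝓝 x, ξ y = S (p y)

/-- A smooth section of `V` representing a parallel section of `p^* V` near a point. -/
def germ {cov : CovariantDerivative 𝓘(ℝ, E) F V} {p : M' → M} (ξ : parallelSections cov p)
    (x : M') : Cₛ^∞⟮𝓘(ℝ, E); F, V⟯ :=
  Classical.choose (ξ.2 x)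

theorem germ_spec {cov : CovariantDerivative 𝓘(ℝ, E) F V} {p : M' → M}
    (ξ : parallelSections cov p) (x : M') :
    ∀ᶠ y in 𝓝 x, ξ.1 y = germ ξ x (p y) ∧ cov (germ ξ x) (p y) = 0 :=
  Classical.choose_spec (ξ.2 x)

theorem isGerm_germ {cov : CovariantDerivative 𝓘(ℝ, E) F V} {p : M' → M}
    (ξ : parallelSections cov p) (x : M') : IsGerm ξ.1 x (germ ξ x) :=
  (germ_spec ξ x).mono fun _ h ↦ h.1

theorem IsGerm.eventuallyEq {p : M' → M} (hp : IsCoveringMap p) {ξ : ∀ x : M', V (p x)} {x : M'}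
    {S T : Cₛ^∞⟮𝓘(ℝ, E); F, V⟯} (hS : IsGerm ξ x S) (hT : IsGerm ξ x T) :
    ∀ᶠ y in 𝓝 (p x), S y = T y := by
  have h : ∀ᶠ y in 𝓝 x, S (p y) = T (p y) := by
    filter_upwards [hS, hT] with y h1 h2
    rw [← h1, h2]
  rw [← hp.isLocalHomeomorph.map_nhds_eq x]
  exact h

/-- The bracket of parallel sections of `p^* V` is computed by the bracket of sections of `V`
that represent them locally. -/
def parallelBracket (A : LieAlgebroid E F V) {cov : CovariantDerivative 𝓘(ℝ, E) F V} {p : M' → M}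
    (ξ η : parallelSections cov p) (x : M') : V (p x) :=
  A.bracket (germ ξ x) (germ η x) (p x)

theorem parallelBracket_eq [T2Space M] (A : LieAlgebroid E F V)
    {cov : CovariantDerivative 𝓘(ℝ, E) F V} {p : M' → M} (hp : IsCoveringMap p)
    (ξ η : parallelSections cov p) {x : M'} {S T : Cₛ^∞⟮𝓘(ℝ, E); F, V⟯}
    (hS : IsGerm ξ.1 x S) (hT : IsGerm η.1 x T) :
    parallelBracket A ξ η x = A.bracket S T (p x) :=
  A.bracket_congr ((isGerm_germ ξ x).eventuallyEq hp hS) ((isGerm_germ η x).eventuallyEq hp hT)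

theorem isGerm_parallelBracket [T2Space M] (A : LieAlgebroid E F V)
    {cov : CovariantDerivative 𝓘(ℝ, E) F V} {p : M' → M} (hp : IsCoveringMap p)
    (ξ η : parallelSections cov p) {x : M'} {S T : Cₛ^∞⟮𝓘(ℝ, E); F, V⟯}
    (hS : IsGerm ξ.1 x S) (hT : IsGerm η.1 x T) :
    IsGerm (parallelBracket A ξ η) x (A.bracket S T) := by
  filter_upwards [hS.eventually_nhds, hT.eventually_nhds] with y h1 h2
  exact parallelBracket_eq A hp ξ η h1 h2

theorem LieAlgebroid.IsCartan.bracket_parallel [T2Space M] {A : LieAlgebroid E F V}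
    {cov : CovariantDerivative 𝓘(ℝ, E) F V}
    [CovariantDerivative.ContMDiffCovariantDerivative cov ∞] (hC : A.IsCartan cov)
    {S T : Cₛ^∞⟮𝓘(ℝ, E); F, V⟯} {x : M} (hS : ∀ᶠ y in 𝓝 x, cov S y = 0)
    (hT : ∀ᶠ y in 𝓝 x, cov T y = 0) : cov (A.bracket S T) x = 0 := by
  ext w
  obtain ⟨W, rfl⟩ := exists_vectorField w
  have h := hC S T W x
  have hS' : ∀ᶠ y in 𝓝 x, covSection cov W S y = (0 : Cₛ^∞⟮𝓘(ℝ, E); F, V⟯) y := by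
    filter_upwards [hS] with y hy
    change cov S y (W y) = 0
    rw [hy]; rfl
  have hT' : ∀ᶠ y in 𝓝 x, covSection cov W T y = (0 : Cₛ^∞⟮𝓘(ℝ, E); F, V⟯) y := by
    filter_upwards [hT] with y hy
    change cov T y (W y) = 0
    rw [hy]; rfl
  have e1 : A.bracket (covSection cov W S) T x = 0 := by
    rw [A.bracket_congr hS' (Eventually.of_forall fun _ ↦ rfl), map_zero]; rfl
  have e2 : A.bracket S (covSection cov W T) x = 0 := by
    rw [A.bracket_congr_right hT', map_zero]; rfl
  rw [LieAlgebroid.cocurvature, e1, e2, hS.self_of_nhds, hT.self_of_nhds] at h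
  simpa using h

theorem parallelBracket_mem [T2Space M] {A : LieAlgebroid E F V}
    {cov : CovariantDerivative 𝓘(ℝ, E) F V}
    [CovariantDerivative.ContMDiffCovariantDerivative cov ∞] (hC : A.IsCartan cov)
    {p : M' → M} (hp : IsCoveringMap p) (ξ η : parallelSections cov p) :
    parallelBracket A ξ η ∈ parallelSections cov p := by
  intro x
  refine ⟨A.bracket (germ ξ x) (germ η x), ?_⟩
  have h1 : ∀ᶠ y in 𝓝 (p x), cov (germ ξ x) y = 0 := by
    rw [← hp.isLocalHomeomorph.map_nhds_eq x]
    exact (germ_spec ξ x).mono fun _ h ↦ h.2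
  have h2 : ∀ᶠ y in 𝓝 (p x), cov (germ η x) y = 0 := by
    rw [← hp.isLocalHomeomorph.map_nhds_eq x]
    exact (germ_spec η x).mono fun _ h ↦ h.2
  have h3 : ∀ᶠ y in 𝓝 (p x), cov (A.bracket (germ ξ x) (germ η x)) y = 0 := by
    filter_upwards [h1.eventually_nhds, h2.eventually_nhds] with y a b
    exact hC.bracket_parallel a b
  filter_upwards [isGerm_parallelBracket A hp ξ η (isGerm_germ ξ x) (isGerm_germ η x),
    hp.continuous.continuousAt.eventually h3] with y a b
  exact ⟨a, b⟩

/-- The Lie algebra `𝔤₀` of parallel sections of the pullback `p^* V`, for a Cartan connection on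
a Lie algebroid `V` and a covering map `p`. -/
def ParallelAlgebra {A : LieAlgebroid E F V} {cov : CovariantDerivative 𝓘(ℝ, E) F V}
    [CovariantDerivative.ContMDiffCovariantDerivative cov ∞] (_hC : A.IsCartan cov)
    {p : M' → M} (_hp : IsCoveringMap p) : Type _ :=
  parallelSections cov p

namespace ParallelAlgebra

variable {A : LieAlgebroid E F V} {cov : CovariantDerivative 𝓘(ℝ, E) F V}
  [CovariantDerivative.ContMDiffCovariantDerivative cov ∞] (hC : A.IsCartan cov)
  {p : M' → M} (hp : IsCoveringMap p)

instance : AddCommGroup (ParallelAlgebra hC hp) :=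
  inferInstanceAs (AddCommGroup (parallelSections cov p))

instance : Module ℝ (ParallelAlgebra hC hp) :=
  inferInstanceAs (Module ℝ (parallelSections cov p))

variable {hC hp}

@[ext]
theorem ext {ξ η : ParallelAlgebra hC hp} (h : ∀ x, ξ.1 x = η.1 x) : ξ = η :=
  Subtype.ext (funext h)

variable [T2Space M]

instance : Bracket (ParallelAlgebra hC hp) (ParallelAlgebra hC hp) :=
  ⟨fun ξ η ↦ ⟨parallelBracket A ξ η, parallelBracket_mem hC hp ξ η⟩⟩

/-- The bracket of `𝔤₀` is locally the bracket of sections of `V`. -/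
theorem bracket_apply (ξ η : ParallelAlgebra hC hp) {x : M'} {S T : Cₛ^∞⟮𝓘(ℝ, E); F, V⟯}
    (hS : IsGerm ξ.1 x S) (hT : IsGerm η.1 x T) : ⁅ξ, η⁆.1 x = A.bracket S T (p x) :=
  parallelBracket_eq A hp ξ η hS hT

theorem isGerm_add {ξ η : ParallelAlgebra hC hp} {x : M'} {S T : Cₛ^∞⟮𝓘(ℝ, E); F, V⟯}
    (hS : IsGerm ξ.1 x S) (hT : IsGerm η.1 x T) : IsGerm (ξ + η).1 x (S + T) := by
  filter_upwards [hS, hT] with y h1 h2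
  change ξ.1 y + η.1 y = S (p y) + T (p y)
  rw [h1, h2]

theorem isGerm_smul (c : ℝ) {ξ : ParallelAlgebra hC hp} {x : M'} {S : Cₛ^∞⟮𝓘(ℝ, E); F, V⟯}
    (hS : IsGerm ξ.1 x S) : IsGerm (c • ξ).1 x (c • S) := by
  filter_upwards [hS] with y h1
  change c • ξ.1 y = c • S (p y)
  rw [h1]

theorem isGerm_bracket {ξ η : ParallelAlgebra hC hp} {x : M'} {S T : Cₛ^∞⟮𝓘(ℝ, E); F, V⟯}
    (hS : IsGerm ξ.1 x S) (hT : IsGerm η.1 x T) : IsGerm ⁅ξ, η⁆.1 x (A.bracket S T) :=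
  isGerm_parallelBracket A hp ξ η hS hT

instance : LieRing (ParallelAlgebra hC hp) where
  add_lie ξ η ζ := by
    ext x
    have h1 := isGerm_germ ξ x
    have h2 := isGerm_germ η x
    have h3 := isGerm_germ ζ x
    change _ = ⁅ξ, ζ⁆.1 x + ⁅η, ζ⁆.1 x
    rw [bracket_apply _ _ (isGerm_add h1 h2) h3, bracket_apply _ _ h1 h3, bracket_apply _ _ h2 h3,
      map_add]
    rfl
  lie_add ξ η ζ := by
    ext x
    have h1 := isGerm_germ ξ x
    have h2 := isGerm_germ η x
    have h3 := isGerm_germ ζ x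
    change _ = ⁅ξ, η⁆.1 x + ⁅ξ, ζ⁆.1 x
    rw [bracket_apply _ _ h1 (isGerm_add h2 h3), bracket_apply _ _ h1 h2, bracket_apply _ _ h1 h3,
      map_add]
    rfl
  lie_self ξ := by
    ext x
    have h1 := isGerm_germ ξ x
    rw [bracket_apply _ _ h1 h1, A.bracket_self]
    rfl
  leibniz_lie ξ η ζ := by
    ext x
    have h1 := isGerm_germ ξ x
    have h2 := isGerm_germ η x
    have h3 := isGerm_germ ζ x
    change _ = ⁅⁅ξ, η⁆, ζ⁆.1 x + ⁅η, ⁅ξ, ζ⁆⁆.1 x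
    rw [bracket_apply _ _ h1 (isGerm_bracket h2 h3), bracket_apply _ _ (isGerm_bracket h1 h2) h3,
      bracket_apply _ _ h2 (isGerm_bracket h1 h3), A.jacobi]
    rfl

instance : LieAlgebra ℝ (ParallelAlgebra hC hp) where
  lie_smul c ξ η := by
    ext x
    have h1 := isGerm_germ ξ x
    have h2 := isGerm_germ η x
    change _ = c • ⁅ξ, η⁆.1 x
    rw [bracket_apply _ _ h1 (isGerm_smul c h2), bracket_apply _ _ h1 h2, map_smul]
    rfl

end ParallelAlgebra

/-! ### Monodromy -/

/-- The automorphism group of a real Lie algebra. -/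
def lieAut (L : Type*) [LieRing L] [LieAlgebra ℝ L] : Subgroup (L ≃ₗ[ℝ] L) where
  carrier := {a | ∀ ξ η : L, a ⁅ξ, η⁆ = ⁅a ξ, a η⁆}
  one_mem' _ _ := rfl
  mul_mem' {a b} ha hb ξ η := by
    change a (b ⁅ξ, η⁆) = ⁅a (b ξ), a (b η)⁆
    rw [hb, ha]
  inv_mem' {a} ha ξ η := by
    change a.symm ⁅ξ, η⁆ = ⁅a.symm ξ, a.symm η⁆
    rw [LinearEquiv.symm_apply_eq, ha, a.apply_symm_apply, a.apply_symm_apply]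

/-- The topology of the automorphism group of a finite-dimensional real Lie algebra `L`, as a
subset of the finite-dimensional real vector space `End L` with its canonical topology. -/
abbrev lieAutTopology (L : Type*) [LieRing L] [LieAlgebra ℝ L] : TopologicalSpace (lieAut L) :=
  TopologicalSpace.induced (fun a ↦ (a.1 : Module.End ℝ L)) (moduleTopology ℝ (Module.End ℝ L))

/-- The group of covering transformations of `p : M' → M`. -/
def deckGroup (p : M' → M) : Subgroup (M' ≃ₜ M') where
  carrier := {φ | ∀ x, p (φ x) = p x}
  one_mem' _ := rfl
  mul_mem' {φ ψ} hφ hψ x := by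
    change p (φ (ψ x)) = p x
    rw [hφ, hψ]
  inv_mem' {φ} hφ x := by
    change p (φ.symm x) = p x
    rw [← hφ (φ.symm x), φ.apply_symm_apply]

/-- Equal points have the same fibre. -/
def fibreCast (V : M → Type*) {x y : M} (h : x = y) (v : V x) : V y :=
  h ▸ v

theorem fibreCast_section (S : ∀ x, V x) {x y : M} (h : x = y) :
    fibreCast V h (S x) = S y := by
  subst h; rfl

theorem fibreCast_add {x y : M} (h : x = y) (v w : V x) :
    fibreCast V h (v + w) = fibreCast V h v + fibreCast V h w := by
  subst h; rfl

theorem fibreCast_smul {x y : M} (h : x = y) (c : ℝ) (v : V x) :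
    fibreCast V h (c • v) = c • fibreCast V h v := by
  subst h; rfl

theorem fibreCast_fibreCast {x y z : M} (h : x = y) (h' : y = z) (v : V x) :
    fibreCast V h' (fibreCast V h v) = fibreCast V (h.trans h') v := by
  subst h; rfl

/-- A covering transformation `φ` acts on `p^* V` by moving `v` over `x` to the vector over `φ x`
with the same image in `V`; this is the induced action `ξ ↦ φ · (ξ ∘ φ⁻¹)` on sections. -/
def deckAct {p : M' → M} (φ : deckGroup p) (ξ : ∀ x : M', V (p x)) (x : M') : V (p x) :=
  fibreCast V ((φ⁻¹).2 x) (ξ (φ⁻¹.1 x))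

theorem tendsto_deck {p : M' → M} (φ : deckGroup p) (x : M') :
    Tendsto (fun y ↦ φ⁻¹.1 y) (𝓝 x) (𝓝 (φ⁻¹.1 x)) :=
  φ⁻¹.1.continuous.continuousAt

theorem IsGerm.deckAct {p : M' → M} (φ : deckGroup p) {ξ : ∀ x : M', V (p x)} {x : M'}
    {S : Cₛ^∞⟮𝓘(ℝ, E); F, V⟯} (hS : IsGerm ξ (φ⁻¹.1 x) S) : IsGerm (deckAct φ ξ) x S := by
  filter_upwards [(tendsto_deck φ x).eventually hS] with y hy
  rw [CartanAlgebroid.deckAct, hy, fibreCast_section]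

theorem deckAct_mem {cov : CovariantDerivative 𝓘(ℝ, E) F V} {p : M' → M} (φ : deckGroup p)
    (ξ : parallelSections cov p) : deckAct φ ξ.1 ∈ parallelSections cov p := by
  intro x
  refine ⟨germ ξ (φ⁻¹.1 x), ?_⟩
  filter_upwards [(isGerm_germ ξ (φ⁻¹.1 x)).deckAct φ,
    (tendsto_deck φ x).eventually (germ_spec ξ (φ⁻¹.1 x))] with y h1 h2
  refine ⟨h1, ?_⟩
  rw [← (φ⁻¹).2 y]
  exact h2.2

theorem deckAct_one {p : M' → M} (ξ : ∀ x : M', V (p x)) : deckAct (1 : deckGroup p) ξ = ξ :=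
  rfl

theorem deckAct_mul {p : M' → M} (φ ψ : deckGroup p) (ξ : ∀ x : M', V (p x)) :
    deckAct (φ * ψ) ξ = deckAct φ (deckAct ψ ξ) := by
  funext x
  rw [deckAct, deckAct, deckAct, fibreCast_fibreCast]
  rfl

section

variable [T2Space M] {A : LieAlgebroid E F V} {cov : CovariantDerivative 𝓘(ℝ, E) F V}
  [CovariantDerivative.ContMDiffCovariantDerivative cov ∞] (hC : A.IsCartan cov)
  {p : M' → M} (hp : IsCoveringMap p)

/-- The action of a covering transformation on `𝔤₀`, as a linear map. -/
def monodromyLinear (φ : deckGroup p) :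
    ParallelAlgebra hC hp ≃ₗ[ℝ] ParallelAlgebra hC hp where
  toFun ξ := ⟨deckAct φ ξ.1, deckAct_mem φ ξ⟩
  invFun ξ := ⟨deckAct φ⁻¹ ξ.1, deckAct_mem φ⁻¹ ξ⟩
  map_add' ξ η := Subtype.ext (funext fun _ ↦ fibreCast_add _ _ _)
  map_smul' c ξ := Subtype.ext (funext fun _ ↦ fibreCast_smul _ _ _)
  left_inv ξ := Subtype.ext (by
    change deckAct φ⁻¹ (deckAct φ ξ.1) = ξ.1
    rw [← deckAct_mul, inv_mul_cancel, deckAct_one])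
  right_inv ξ := Subtype.ext (by
    change deckAct φ (deckAct φ⁻¹ ξ.1) = ξ.1
    rw [← deckAct_mul, mul_inv_cancel, deckAct_one])

/-- The monodromy representation of the group of covering transformations on the Lie algebra
`𝔤₀` of parallel sections, by Lie algebra automorphisms. -/
def monodromy : deckGroup p →* lieAut (ParallelAlgebra hC hp) where
  toFun φ := ⟨monodromyLinear hC hp φ, fun ξ η ↦ by
    ext x
    have h1 := isGerm_germ ξ (φ⁻¹.1 x)
    have h2 := isGerm_germ η (φ⁻¹.1 x)
    rw [ParallelAlgebra.bracket_apply (monodromyLinear hC hp φ ξ) (monodromyLinear hC hp φ η)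
      (h1.deckAct φ) (h2.deckAct φ)]
    exact ((ParallelAlgebra.isGerm_bracket h1 h2).deckAct φ).self_of_nhds⟩
  map_one' := Subtype.ext (LinearEquiv.ext fun ξ ↦ Subtype.ext (deckAct_one ξ.1))
  map_mul' φ ψ := Subtype.ext (LinearEquiv.ext fun ξ ↦ Subtype.ext (deckAct_mul φ ψ ξ.1))

/-- The image of the monodromy representation has compact closure in `Aut 𝔤₀`. -/
def HasCompactMonodromyClosure : Prop :=
  letI : TopologicalSpace (lieAut (ParallelAlgebra hC hp)) := lieAutTopology _
  IsCompact (closure (range (monodromy hC hp)))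

end

end Parallel

end CartanAlgebroid
end

open Bundle Set Filter Topology
open scoped Manifold ContDiff

set_option linter.unusedSectionVars false

noncomputable section

/-! Flatness provides a frame of parallel sections near every point (`exists_flatFrame`). In such a
frame a geodesic has constant coordinates, so near each time it is `S ∘ m` with `S` parallel and `m`
an integral curve of the vector field `# S`. Geodesics are thus solutions of ordinary differential
equations depending smoothly on parameters: they are unique, and they exist for a time that is
locally uniform in the initial vector. Hence a geodesic on a bounded open interval continues past an
end as soon as it has a cluster point there in the total space of the bundle, and completeness
reduces to finding such cluster points (`isGeodesicallyComplete_of_mapClusterPt`). Each of the two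
conditions supplies them.

Invariant metric: if `S` is parallel, then `∇̄_S (# S) = # ∇_{# S} S + [# S, # S] = 0`, so
invariance makes `σ(# S, # S)` constant along integral curves of `# S`. The footprint of a geodesic
has constant speed, hence is Lipschitz, and converges at a finite end by completeness of `M`. In a
parallel frame around the limit the coordinates of the geodesic are constant, so the geodesic itself
converges.

Compact monodromy: over the simply connected covering the germ of a geodesic extends to one global
parallel section `ξ`, and the whole geodesic consists of values of `ξ` along a lift of its footprint
(`IsGeodesicAt.exists_parallel_section`). Covering transformations are transitive on fibres, so the
values of `ξ` above a small set `N` are the values, on a single sheet above `N`, of the translates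
`μ_φ ξ`. Compact closure of the monodromy confines these translates, hence these values, to a
compact set, and finitely many `N` cover the compact `M`. The geodesic stays in a compact set and
therefore has cluster points at both ends. -/

namespace CartanAlgebroid

/-! ### Linear differential systems with zero curvature -/

section LinearSystems

/-- Grönwall's inequality with the rate `1 / 2` relaxed to `1`: the bound is `ε (e ^ t - 1)`, and `e
≤ 3` yields the factor `2`. All estimates for the radial equations below come from it. -/
theorem norm_le_of_norm_deriv_le_add {G : Type*} [NormedAddCommGroup G] [NormedSpace ℝ G]
    {D D' : ℝ → G} {ε : ℝ} (hD : ∀ t ∈ Icc (0 : ℝ) 1, HasDerivWithinAt D (D' t) (Icc 0 1) t)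
    (h0 : D 0 = 0) (hb : ∀ t ∈ Icc (0 : ℝ) 1, ‖D' t‖ ≤ 1 / 2 * ‖D t‖ + ε) :
    ∀ t ∈ Icc (0 : ℝ) 1, ‖D t‖ ≤ 2 * ε := by
  intro t ht
  have hε : 0 ≤ ε := by
    have := hb 0 ⟨le_rfl, zero_le_one⟩
    rw [h0, norm_zero, mul_zero, zero_add] at this
    exact (norm_nonneg _).trans this
  have h := norm_le_gronwallBound_of_norm_deriv_right_le (f := D) (f' := D') (δ := 0) (K := 1)
    (ε := ε) (a := 0) (b := 1) (fun t ht ↦ (hD t ht).continuousWithinAt)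
    (fun t ht ↦ (hD t ⟨ht.1, ht.2.le⟩).mono_of_mem_nhdsWithin
      (Icc_mem_nhdsGE_of_mem ht)) (by simp [h0])
    (fun t ht ↦ (hb t ⟨ht.1, ht.2.le⟩).trans (by nlinarith [norm_nonneg (D t)])) t ht
  rw [gronwallBound_of_K_ne_0 one_ne_zero] at h
  have h1 : Real.exp (1 * (t - 0)) ≤ 3 := by
    calc Real.exp (1 * (t - 0)) ≤ Real.exp 1 := Real.exp_le_exp.2 (by linarith [ht.2])
      _ ≤ 3 := Real.exp_one_lt_three.le
  nlinarith

theorem _root_.ContinuousAt.exists_eventually_norm_le {X Y : Type*} [TopologicalSpace X]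
    [NormedAddCommGroup Y] {g : X → Y} {x : X} (hg : ContinuousAt g x) :
    ∃ C, ∀ᶠ z in 𝓝 x, ‖g z‖ ≤ C :=
  ⟨‖g x‖ + 1, (hg.norm.eventually_lt_const (lt_add_one _)).mono fun _ h ↦ h.le⟩

variable {E G : Type*} [NormedAddCommGroup E] [NormedSpace ℝ E] [NormedAddCommGroup G]
  [NormedSpace ℝ G] [CompleteSpace G]

/-- Solutions on the unit interval of a linear equation with small coefficients. -/
theorem exists_linear_ode_solution {B : ℝ → G →L[ℝ] G} (hB : ContinuousOn B (Icc 0 1))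
    (hb : ∀ t ∈ Icc (0 : ℝ) 1, ‖B t‖ ≤ 1 / 2) (u : G) :
    ∃ s : ℝ → G, s 0 = u ∧ (∀ t ∈ Icc (0 : ℝ) 1, HasDerivWithinAt s (-(B t (s t))) (Icc 0 1) t) ∧
      ∀ t ∈ Icc (0 : ℝ) 1, ‖s t‖ ≤ 2 * ‖u‖ := by
  -- On the ball of radius `‖u‖` around `u` the field has norm at most `1 / 2 * (2 * ‖u‖) = ‖u‖`, so
  -- a solution cannot leave the ball within unit time.
  have hpl : IsPicardLindelof (fun t x ↦ -(B t x)) (tmin := 0) (tmax := 1)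
      ⟨0, by simp⟩ u ‖u‖₊ 0 ‖u‖₊ 1 := by
    refine ⟨fun t ht ↦ ?_, fun x _ ↦ (hB.clm_apply continuousOn_const).neg, fun t ht x hx ↦ ?_,
      by simp⟩
    · refine LipschitzOnWith.of_dist_le_mul fun x _ y _ ↦ ?_
      rw [dist_neg_neg, dist_eq_norm, dist_eq_norm, ← map_sub]
      refine ((B t).le_opNorm _).trans ?_
      gcongr
      exact (hb t ht).trans (by norm_num)
    · rw [norm_neg]
      have hx' : ‖x‖ ≤ 2 * ‖u‖ := by
        have h1 : ‖x - u‖ ≤ ‖u‖ := by simpa [dist_eq_norm] using hx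
        have := norm_le_norm_sub_add x u
        linarith
      refine ((B t).le_opNorm _).trans ?_
      change ‖B t‖ * ‖x‖ ≤ ‖u‖
      nlinarith [hb t ht, norm_nonneg (B t), norm_nonneg x]
  obtain ⟨s, hs0, hs⟩ := hpl.exists_eq_forall_mem_Icc_hasDerivWithinAt₀
  refine ⟨s, hs0, hs, fun t ht ↦ ?_⟩
  -- From `‖s‖ ≤ ‖s - u‖ + ‖u‖`, Grönwall applied to `s - u` gives `‖s - u‖ ≤ ‖u‖`.
  have h := norm_le_of_norm_deriv_le_add (D := fun t ↦ s t - u) (ε := 1 / 2 * ‖u‖)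
    (fun t ht ↦ (hs t ht).sub_const u) (by simp only [sub_eq_zero]; exact hs0) (fun t ht ↦ by
      rw [norm_neg]
      refine ((B t).le_opNorm _).trans ?_
      have := norm_le_norm_sub_add (s t) u
      nlinarith [hb t ht, norm_nonneg (B t), norm_nonneg (s t)]) t ht
  have := norm_le_norm_sub_add (s t) u
  linarith

variable {R : Type*} [NormedRing R] [NormedAlgebra ℝ R] [CompleteSpace R]

set_option synthInstance.maxHeartbeats 400000 in
set_option maxHeartbeats 1000000 in
-- This is the Frobenius theorem for `df = -Γ f`. The equation is integrated along the rays from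
-- `z₀`, and `f z` is the value at time `1` on the ray through `z`. That `f` solves the equation in
-- all directions follows by comparing the solutions on the rays with directions `x` and `x + h`: by
-- zero curvature, the error `s (x + h) t - s x t + t Γ(h) s x t` satisfies a linear equation up to
-- terms of order `‖h‖ ^ 2`, so by Grönwall it is itself of that order. No differentiable dependence
-- on parameters is needed. Values in an algebra `R` allow a whole frame to be found at once, with
-- `R = End F`.
theorem exists_parallel_of_flat {Γ : E → E →L[ℝ] R} {z₀ : E} (hΓ : ContDiffAt ℝ 2 Γ z₀)
    (hflat : ∀ᶠ z in 𝓝 z₀, ∀ w w', fderiv ℝ (fun z ↦ Γ z w') z w - fderiv ℝ (fun z ↦ Γ z w) z w'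
      + Γ z w * Γ z w' - Γ z w' * Γ z w = 0) :
    ∃ r > 0, ∀ u : R, ∃ f : E → R, f z₀ = u ∧
      ∀ z ∈ Metric.ball z₀ r,
        HasFDerivAt f (-((ContinuousLinearMap.mul ℝ R).flip (f z) ∘L Γ z)) z := by
  have hd : ContDiffAt ℝ 1 (fderiv ℝ Γ) z₀ := hΓ.fderiv_right (m := 1) le_rfl
  obtain ⟨K, N, hN, hK⟩ := hd.exists_lipschitzOnWith
  obtain ⟨C, hC⟩ : ∃ C, ∀ᶠ z in 𝓝 z₀, ‖Γ z‖ ≤ C :=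
    hΓ.continuousAt.exists_eventually_norm_le
  obtain ⟨C', hC'⟩ : ∃ C, ∀ᶠ z in 𝓝 z₀, ‖fderiv ℝ Γ z‖ ≤ C :=
    hd.continuousAt.exists_eventually_norm_le
  have hdiff : ∀ᶠ z in 𝓝 z₀, DifferentiableAt ℝ Γ z := by
    filter_upwards [hΓ.eventually (by simp)] with z hz using hz.differentiableAt (by norm_num)
  obtain ⟨ρ, hρ, hball⟩ := Metric.eventually_nhds_iff_ball.1
    ((hflat.and hdiff).and ((hC.and hC').and hN))
  have hC0 : 0 ≤ C := (norm_nonneg _).trans (hball z₀ (Metric.mem_ball_self hρ)).2.1.1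
  have hC'0 : 0 ≤ C' := (ContinuousLinearMap.opNorm_nonneg _).trans (hball z₀ (Metric.mem_ball_self hρ)).2.1.2
  -- `C * r ≤ 1 / 2` makes the coefficients on the rays small enough for the linear equation on the
  -- unit interval; `r ≤ 1` lets factors `‖x‖` be dropped.
  obtain ⟨r, hr, hrρ, hr1, hCr⟩ : ∃ r > 0, r ≤ ρ ∧ r ≤ 1 ∧ C * r ≤ 1 / 2 := by
    refine ⟨min ρ (min 1 (1 / (2 * (C + 1)))), by positivity, min_le_left _ _,
      (min_le_right _ _).trans (min_le_left _ _), ?_⟩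
    calc C * min ρ (min 1 (1 / (2 * (C + 1)))) ≤ (C + 1) * (1 / (2 * (C + 1))) := by
          gcongr
          · linarith
          · exact (min_le_right _ _).trans (min_le_right _ _)
      _ = 1 / 2 := by field_simp
  refine ⟨r, hr, fun u ↦ ?_⟩
  have hmem : ∀ x : E, ‖x‖ < r → ∀ t ∈ Icc (0 : ℝ) 1, z₀ + t • x ∈ Metric.ball z₀ ρ := by
    intro x hx t ht
    rw [Metric.mem_ball, dist_eq_norm, add_sub_cancel_left, norm_smul, Real.norm_eq_abs,
      abs_of_nonneg ht.1]
    nlinarith [ht.2, norm_nonneg x, ht.1]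
  have hsmall : ∀ x : E, ‖x‖ < r → ∀ t ∈ Icc (0 : ℝ) 1, ‖Γ (z₀ + t • x) x‖ ≤ 1 / 2 := by
    intro x hx t ht
    refine (ContinuousLinearMap.le_opNorm _ _).trans ?_
    have := (hball _ (hmem x hx t ht)).2.1.1
    nlinarith [norm_nonneg x, norm_nonneg (Γ (z₀ + t • x))]
  have hline : ∀ (x : E) (t : ℝ), HasDerivWithinAt (fun t : ℝ ↦ z₀ + t • x) x (Icc 0 1) t := by
    intro x t
    simpa using ((hasDerivWithinAt_id t (Icc 0 1)).smul_const x).const_add z₀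
  have hex : ∀ x : E, ‖x‖ < r → ∃ s : ℝ → R, s 0 = u ∧
      (∀ t ∈ Icc (0 : ℝ) 1, HasDerivWithinAt s (-(Γ (z₀ + t • x) x * s t)) (Icc 0 1) t) ∧
      ∀ t ∈ Icc (0 : ℝ) 1, ‖s t‖ ≤ 2 * ‖u‖ := by
    intro x hx
    refine exists_linear_ode_solution (B := fun t ↦ ContinuousLinearMap.mul ℝ R (Γ (z₀ + t • x) x))
      (fun t ht ↦ ?_) (fun t ht ↦ (ContinuousLinearMap.opNorm_mul_apply_le ℝ R _).trans
        (hsmall x hx t ht)) u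
    have h1 := (hball _ (hmem x hx t ht)).1.2.continuousAt
    exact (ContinuousLinearMap.mul ℝ R).continuous.continuousAt.comp_continuousWithinAt
      ((ContinuousAt.comp_continuousWithinAt (f := fun t : ℝ ↦ z₀ + t • x) h1
      (hline x t).continuousWithinAt).clm_apply continuousWithinAt_const)
  choose! s hs0 hs hsb using hex
  refine ⟨fun z ↦ s (z - z₀) 1, ?_, fun z hz ↦ ?_⟩
  -- On the degenerate ray `x = 0` the solution is constant.
  · have h := norm_le_of_norm_deriv_le_add (D := fun t ↦ s 0 t - u) (ε := 0)
      (fun t ht ↦ (hs 0 (by simpa using hr) t ht).sub_const u)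
      (by simp only [sub_eq_zero]; exact hs0 0 (by simpa using hr)) (fun t ht ↦ by
        simp) 1 ⟨zero_le_one, le_rfl⟩
    rw [mul_zero, norm_le_zero_iff, sub_eq_zero] at h
    simpa using h
  -- the estimate at `z = z₀ + x`
  set x := z - z₀ with hx
  have hxr : ‖x‖ < r := by simpa [dist_eq_norm] using hz
  have hzx : z₀ + x = z := by simp [hx]
  have key : ∀ h : E, ‖x + h‖ < r →
      ‖s (x + h) 1 - s x 1 + Γ z h * s x 1‖ ≤
        2 * (((C' + K) * (2 * ‖u‖) + (C + C') * (2 * ((C + C') * (2 * ‖u‖)))) * ‖h‖ ^ 2) := by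
    intro h hh
    have hlip : ∀ t ∈ Icc (0 : ℝ) 1, ‖Γ (z₀ + t • (x + h)) - Γ (z₀ + t • x)‖ ≤ C' * ‖h‖ := by
      intro t ht
      have := (convex_ball z₀ ρ).norm_image_sub_le_of_norm_fderiv_le (𝕜 := ℝ) (f := Γ) (C := C')
        (fun y hy ↦ (hball y hy).1.2) (fun y hy ↦ (hball y hy).2.1.2)
        (hmem x hxr t ht) (hmem (x + h) hh t ht)
      refine this.trans ?_
      gcongr
      rw [add_sub_add_left_eq_sub, ← smul_sub, add_sub_cancel_left, norm_smul, Real.norm_eq_abs,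
        abs_of_nonneg ht.1]
      nlinarith [ht.2, norm_nonneg h]
    have htay : ∀ t ∈ Icc (0 : ℝ) 1, ‖Γ (z₀ + t • (x + h)) - Γ (z₀ + t • x)
        - t • fderiv ℝ Γ (z₀ + t • x) h‖ ≤ K * ‖h‖ ^ 2 := by
      intro t ht
      have hth : ‖t • h‖ ≤ ‖h‖ := by
        rw [norm_smul, Real.norm_eq_abs, abs_of_nonneg ht.1]
        nlinarith [ht.2, norm_nonneg h]
      -- Intersecting with the ball of radius `‖t • h‖` bounds the variation of the derivative by `K
      -- * ‖h‖`, whence a second order Taylor estimate.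
      have hcv : Convex ℝ (Metric.ball z₀ ρ ∩ Metric.closedBall (z₀ + t • x) ‖t • h‖) :=
        (convex_ball _ _).inter (convex_closedBall _ _)
      have := hcv.norm_image_sub_le_of_norm_fderiv_le' (𝕜 := ℝ) (f := Γ) (C := K * ‖h‖)
        (φ := fderiv ℝ Γ (z₀ + t • x)) (x := z₀ + t • x) (y := z₀ + t • (x + h))
        (fun y hy ↦ (hball y hy.1).1.2) (fun y hy ↦ by
          refine (hK.norm_sub_le (hball y hy.1).2.2 (hball _ (hmem x hxr t ht)).2.2).trans ?_
          gcongr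
          have := hy.2
          rw [Metric.mem_closedBall, dist_eq_norm] at this
          exact this.trans hth)
        ⟨hmem x hxr t ht, Metric.mem_closedBall_self (norm_nonneg _)⟩
        ⟨hmem (x + h) hh t ht, by
          rw [Metric.mem_closedBall, dist_eq_norm, add_sub_add_left_eq_sub, ← smul_sub,
            add_sub_cancel_left]⟩
      rw [add_sub_add_left_eq_sub, ← smul_sub, add_sub_cancel_left, map_smul] at this
      refine this.trans ?_
      calc K * ‖h‖ * ‖t • h‖ ≤ K * ‖h‖ * ‖h‖ := by gcongr
        _ = K * ‖h‖ ^ 2 := by ring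
    have hcdiff : ∀ t ∈ Icc (0 : ℝ) 1,
        ‖Γ (z₀ + t • (x + h)) (x + h) - Γ (z₀ + t • x) x‖ ≤ (C + C') * ‖h‖ := by
      intro t ht
      have e : Γ (z₀ + t • (x + h)) (x + h) - Γ (z₀ + t • x) x =
          Γ (z₀ + t • (x + h)) h + (Γ (z₀ + t • (x + h)) - Γ (z₀ + t • x)) x := by
        rw [map_add, sub_apply]; abel
      rw [e]
      refine (norm_add_le _ _).trans ?_
      have h1 := ContinuousLinearMap.le_opNorm (Γ (z₀ + t • (x + h))) h
      have h2 := ContinuousLinearMap.le_opNorm (Γ (z₀ + t • (x + h)) - Γ (z₀ + t • x)) x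
      have h3 := (hball _ (hmem (x + h) hh t ht)).2.1.1
      have h4 := hlip t ht
      have h5 : ‖Γ (z₀ + t • (x + h)) - Γ (z₀ + t • x)‖ * ‖x‖ ≤ C' * ‖h‖ * 1 := by
        gcongr
        linarith
      have h6 : ‖Γ (z₀ + t • (x + h))‖ * ‖h‖ ≤ C * ‖h‖ := by gcongr
      linarith
    -- First order estimate: the solutions on the two rays differ by `O(‖h‖)`.
    have hD := norm_le_of_norm_deriv_le_add (D := fun t ↦ s (x + h) t - s x t)
      (ε := (C + C') * (2 * ‖u‖) * ‖h‖)
      (fun t ht ↦ (hs _ hh t ht).sub (hs _ hxr t ht)) (by simp [hs0 _ hh, hs0 _ hxr])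
      (fun t ht ↦ by
        have e : -(Γ (z₀ + t • (x + h)) (x + h) * s (x + h) t) - -(Γ (z₀ + t • x) x * s x t) =
            -(Γ (z₀ + t • (x + h)) (x + h) * (s (x + h) t - s x t)) -
            (Γ (z₀ + t • (x + h)) (x + h) - Γ (z₀ + t • x) x) * s x t := by
          rw [mul_sub, sub_mul]; abel
        rw [e]
        refine (norm_sub_le _ _).trans ?_
        rw [norm_neg]
        have h1 := norm_mul_le (Γ (z₀ + t • (x + h)) (x + h))
          (s (x + h) t - s x t)
        have h2 := norm_mul_le
          (Γ (z₀ + t • (x + h)) (x + h) - Γ (z₀ + t • x) x) (s x t)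
        have h3 : ‖Γ (z₀ + t • (x + h)) (x + h)‖ * ‖s (x + h) t - s x t‖ ≤
            1 / 2 * ‖s (x + h) t - s x t‖ := by
          gcongr; exact hsmall _ hh t ht
        have h4 : ‖Γ (z₀ + t • (x + h)) (x + h) - Γ (z₀ + t • x) x‖ * ‖s x t‖ ≤
            (C + C') * ‖h‖ * (2 * ‖u‖) := by
          gcongr
          · exact hcdiff t ht
          · exact hsb _ hxr t ht
        nlinarith)
    have hder : ∀ t ∈ Icc (0 : ℝ) 1, HasDerivWithinAt
        (fun t ↦ s (x + h) t - s x t + t • (Γ (z₀ + t • x) h * s x t))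
        ((-(Γ (z₀ + t • (x + h)) (x + h) * s (x + h) t) - -(Γ (z₀ + t • x) x * s x t)) +
          (t • (fderiv ℝ Γ (z₀ + t • x) x h * s x t
            + Γ (z₀ + t • x) h * -(Γ (z₀ + t • x) x * s x t)) +
            (1 : ℝ) • (Γ (z₀ + t • x) h * s x t))) (Icc 0 1) t := by
      intro t ht
      refine ((hs _ hh t ht).sub (hs _ hxr t ht)).add ?_
      refine HasDerivWithinAt.smul (hasDerivWithinAt_id t _) ?_
      have h1 : HasDerivWithinAt (fun t : ℝ ↦ Γ (z₀ + t • x))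
          (fderiv ℝ Γ (z₀ + t • x) x) (Icc 0 1) t :=
        (hball _ (hmem x hxr t ht)).1.2.hasFDerivAt.comp_hasDerivWithinAt t (hline x t)
      exact (by simpa using h1.clm_apply (hasDerivWithinAt_const t _ h) :
        HasDerivWithinAt (fun t : ℝ ↦ Γ (z₀ + t • x) h) (fderiv ℝ Γ (z₀ + t • x) x h)
          (Icc 0 1) t).mul (hs _ hxr t ht)
    have hfin := norm_le_of_norm_deriv_le_add
      (ε := ((C' + K) * (2 * ‖u‖) + (C + C') * (2 * ((C + C') * (2 * ‖u‖)))) * ‖h‖ ^ 2)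
      hder (by simp [hs0 _ hh, hs0 _ hxr]) (fun t ht ↦ by
        have hfl := (hball _ (hmem x hxr t ht)).1.1 x h
        have hfd : ∀ a b, fderiv ℝ (fun z ↦ Γ z b) (z₀ + t • x) a = fderiv ℝ Γ (z₀ + t • x) a b :=
          fun a b ↦ by
            rw [fderiv_clm_apply (hball _ (hmem x hxr t ht)).1.2 (by fun_prop)]
            simp
        rw [hfd, hfd] at hfl
        -- Zero curvature exchanges the derivative of `Γ(h)` along the ray for the derivative of
        -- `Γ(x)` in direction `h`, the quantity that occurs when the two rays are compared.
        have hfl' : fderiv ℝ Γ (z₀ + t • x) x h * s x t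
            + Γ (z₀ + t • x) h * -(Γ (z₀ + t • x) x * s x t) =
            fderiv ℝ Γ (z₀ + t • x) h x * s x t
            - Γ (z₀ + t • x) x * (Γ (z₀ + t • x) h * s x t) := by
          rw [← sub_eq_zero, ← zero_mul (s x t), ← hfl]; noncomm_ring
        rw [hfl', one_smul]
        set c := Γ (z₀ + t • x) x with hc
        set c' := Γ (z₀ + t • (x + h)) (x + h) with hc'
        -- `l` is the part of `c' - c` of first order in `h`.
        set l := Γ (z₀ + t • x) h + t • fderiv ℝ Γ (z₀ + t • x) h x with hl
        -- The derivative of the error is `-c` times the error, minus a second order remainder,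
        -- minus a product of two first order quantities.
        have e : (-(c' * s (x + h) t) - -(c * s x t)) +
            (t • (fderiv ℝ Γ (z₀ + t • x) h x * s x t - c * (Γ (z₀ + t • x) h * s x t))
              + Γ (z₀ + t • x) h * s x t) =
            -(c * (s (x + h) t - s x t + t • (Γ (z₀ + t • x) h * s x t)))
            - (c' - c - l) * s (x + h) t - l * (s (x + h) t - s x t) := by
          simp only [hl, mul_sub, mul_add, sub_mul, add_mul, smul_sub, smul_mul_assoc,
            mul_smul_comm]
          abel
        rw [e]
        have h1 : ‖c * (s (x + h) t - s x t + t • (Γ (z₀ + t • x) h * s x t))‖ ≤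
            1 / 2 * ‖s (x + h) t - s x t + t • (Γ (z₀ + t • x) h * s x t)‖ := by
          refine (norm_mul_le _ _).trans ?_
          gcongr
          exact hsmall x hxr t ht
        have h2 : ‖c' - c - l‖ ≤ (C' + K) * ‖h‖ ^ 2 := by
          have e2 : c' - c - l = (Γ (z₀ + t • (x + h)) - Γ (z₀ + t • x)) h +
              (Γ (z₀ + t • (x + h)) - Γ (z₀ + t • x) - t • fderiv ℝ Γ (z₀ + t • x) h) x := by
            simp only [hc, hc', hl, map_add, sub_apply,
              smul_apply]
            abel
          rw [e2]
          refine (norm_add_le _ _).trans ?_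
          have a1 := ContinuousLinearMap.le_opNorm (Γ (z₀ + t • (x + h)) - Γ (z₀ + t • x)) h
          have a2 := ContinuousLinearMap.le_opNorm
            (Γ (z₀ + t • (x + h)) - Γ (z₀ + t • x) - t • fderiv ℝ Γ (z₀ + t • x) h) x
          have a3 : ‖Γ (z₀ + t • (x + h)) - Γ (z₀ + t • x)‖ * ‖h‖ ≤ C' * ‖h‖ * ‖h‖ := by
            gcongr; exact hlip t ht
          have a4 : ‖Γ (z₀ + t • (x + h)) - Γ (z₀ + t • x) - t • fderiv ℝ Γ (z₀ + t • x) h‖ * ‖x‖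
              ≤ K * ‖h‖ ^ 2 * 1 := by
            gcongr
            · exact htay t ht
            · linarith
          nlinarith
        have h3 : ‖l‖ ≤ (C + C') * ‖h‖ := by
          refine (norm_add_le _ _).trans ?_
          have b1 := ContinuousLinearMap.le_opNorm (Γ (z₀ + t • x)) h
          have b2 : ‖Γ (z₀ + t • x)‖ * ‖h‖ ≤ C * ‖h‖ := by
            gcongr; exact (hball _ (hmem x hxr t ht)).2.1.1
          have b3 : ‖t • fderiv ℝ Γ (z₀ + t • x) h x‖ ≤ C' * ‖h‖ := by
            rw [norm_smul, Real.norm_eq_abs, abs_of_nonneg ht.1]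
            calc t * ‖fderiv ℝ Γ (z₀ + t • x) h x‖ ≤ 1 * (‖fderiv ℝ Γ (z₀ + t • x)‖ * ‖h‖ * ‖x‖) :=
                  by
                    gcongr
                    · exact ht.2
                    · exact ContinuousLinearMap.le_opNorm₂ _ _ _
              _ ≤ 1 * (C' * ‖h‖ * 1) := by
                  gcongr
                  · exact (hball _ (hmem x hxr t ht)).2.1.2
                  · linarith
              _ = C' * ‖h‖ := by ring
          linarith
        have h4 : ‖(c' - c - l) * s (x + h) t‖ ≤ (C' + K) * ‖h‖ ^ 2 * (2 * ‖u‖) := by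
          refine (norm_mul_le _ _).trans ?_
          gcongr
          exact hsb _ hh t ht
        have h5 : ‖l * (s (x + h) t - s x t)‖ ≤
            (C + C') * ‖h‖ * (2 * ((C + C') * (2 * ‖u‖) * ‖h‖)) := by
          refine (norm_mul_le _ _).trans ?_
          gcongr
          exact hD t ht
        refine (norm_sub_le _ _).trans ((add_le_add_left (norm_sub_le _ _) _).trans ?_)
        rw [norm_neg]
        nlinarith) 1 ⟨zero_le_one, le_rfl⟩
    simpa [hzx] using hfin
  have hO : (fun h : E ↦ s (x + h) 1 - s x 1 + Γ z h * s x 1) =o[𝓝 0] fun h ↦ h := by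
    refine Asymptotics.IsBigO.trans_isLittleO (g := fun h : E ↦ ‖h‖ ^ 2) ?_
      (Asymptotics.isLittleO_norm_pow_id one_lt_two)
    refine Asymptotics.IsBigO.of_bound
      (2 * ((C' + K) * (2 * ‖u‖) + (C + C') * (2 * ((C + C') * (2 * ‖u‖))))) ?_
    have hc : ContinuousAt (fun h : E ↦ ‖x + h‖) 0 := by fun_prop
    filter_upwards [hc.eventually_lt_const (by simpa using hxr)] with h hh
    refine (key h hh).trans (le_of_eq ?_)
    rw [norm_pow, norm_norm]; ring
  rw [hasFDerivAt_iff_isLittleO_nhds_zero]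
  refine hO.congr_left fun h ↦ ?_
  have : z + h - z₀ = x + h := by rw [hx]; abel
  simp only [this, ← hx, neg_apply, ContinuousLinearMap.comp_apply,
    ContinuousLinearMap.flip_apply, ContinuousLinearMap.mul_apply', sub_neg_eq_add]

/-- Bootstrapping: the equation expresses the derivative of `f` through `f` and the smooth `Γ`, so
each order of differentiability gives the next. -/
theorem contDiffOn_of_parallel {Γ : E → E →L[ℝ] R} {U : Set E} (hU : IsOpen U)
    (hΓ : ContDiffOn ℝ ∞ Γ U) {f : E → R}
    (hf : ∀ z ∈ U, HasFDerivAt f (-((ContinuousLinearMap.mul ℝ R).flip (f z) ∘L Γ z)) z) :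
    ContDiffOn ℝ ∞ f U := by
  rw [contDiffOn_infty]
  intro n
  induction n with
  | zero => exact contDiffOn_zero.2 fun z hz ↦ (hf z hz).continuousAt.continuousWithinAt
  | succ n ih =>
    push_cast
    rw [contDiffOn_succ_iff_fderiv_of_isOpen hU]
    refine ⟨fun z hz ↦ (hf z hz).differentiableAt.differentiableWithinAt, by simp, ?_⟩
    refine ContDiffOn.congr (f := fun z ↦ -((ContinuousLinearMap.mul ℝ R).flip (f z) ∘L Γ z)) ?_ fun z hz ↦ (hf z hz).fderiv
    have h1 : ContDiffOn ℝ n (fun z ↦ (ContinuousLinearMap.mul ℝ R).flip (f z)) U :=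
      (ContinuousLinearMap.mul ℝ R).flip.contDiff.comp_contDiffOn ih
    exact (h1.clm_comp (hΓ.of_le (by exact_mod_cast le_top))).neg

end LinearSystems

/-! ### Local flows with uniform existence time -/

section Flows

variable {Z : Type*} [NormedAddCommGroup Z] [NormedSpace ℝ Z] [CompleteSpace Z]

/-- The Picard–Lindelöf flow is jointly continuous in the initial value and time, so it stays in `S`
near `(z₀, 0)`; a product neighbourhood gives one `ε` for all nearby initial values. -/
theorem exists_uniform_flow {f : Z → Z} {z₀ : Z} (hf : ContDiffAt ℝ 1 f z₀) {S : Set Z}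
    (hS : S ∈ 𝓝 z₀) : ∃ ε > (0 : ℝ), ∀ᶠ z in 𝓝 z₀, ∃ α : ℝ → Z, α 0 = z ∧
      ∀ t ∈ Ioo (-ε) ε, HasDerivAt α (f (α t)) t ∧ α t ∈ S := by
  obtain ⟨ε, hε, a, r, L, K, hr, hpl⟩ := IsPicardLindelof.of_contDiffAt_one hf
  obtain ⟨α, hα, hc⟩ := (hpl 0).exists_forall_mem_closedBall_eq_hasDerivWithinAt_continuousOn
  have hmem : Metric.closedBall z₀ (r : ℝ) ×ˢ Icc (0 - ε) (0 + ε) ∈ 𝓝 (z₀, (0 : ℝ)) :=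
    prod_mem_nhds (Metric.closedBall_mem_nhds _ hr) (Icc_mem_nhds (by linarith) (by linarith))
  have h0 : α (z₀, 0) = z₀ := (hα z₀ (Metric.mem_closedBall_self r.2)).1
  have hev : ∀ᶠ q in 𝓝 (z₀, (0 : ℝ)), α q ∈ S :=
    (hc.continuousAt hmem).eventually_mem (by rwa [h0])
  rw [nhds_prod_eq, eventually_prod_iff] at hev
  obtain ⟨p, hp, q, hq, hpq⟩ := hev
  obtain ⟨δ, hδ, hqδ⟩ := Metric.eventually_nhds_iff.1 hq
  refine ⟨min ε δ, lt_min hε hδ, ?_⟩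
  filter_upwards [hp, Metric.closedBall_mem_nhds z₀ (NNReal.coe_pos.2 hr)] with z hz hzr
  refine ⟨fun t ↦ α (z, t), (hα z hzr).1, fun t ht ↦ ⟨?_, ?_⟩⟩
  · have h1 : -ε < t := by linarith [ht.1, min_le_left ε δ]
    have h2 : t < ε := by linarith [ht.2, min_le_left ε δ]
    exact ((hα z hzr).2 t ⟨by linarith, by linarith⟩).hasDerivAt
      (Icc_mem_nhds (by linarith) (by linarith))
  · refine hpq hz (hqδ ?_)
    rw [Real.dist_eq, sub_zero, abs_lt]
    exact ⟨by linarith [ht.1, min_le_right ε δ], by linarith [ht.2, min_le_right ε δ]⟩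

/-- Local flows of a family of vector fields, uniformly in the parameter. -/
theorem exists_uniform_flow_param {Q E : Type*} [NormedAddCommGroup Q] [NormedSpace ℝ Q]
    [CompleteSpace Q] [NormedAddCommGroup E] [NormedSpace ℝ E] [CompleteSpace E]
    {w : Q → E → E} {q₀ : Q} {z₀ : E} (hw : ContDiffAt ℝ 1 (fun p : Q × E ↦ w p.1 p.2) (q₀, z₀))
    {S : Set E} (hS : S ∈ 𝓝 z₀) : ∃ ε > (0 : ℝ), ∀ᶠ p in 𝓝 (q₀, z₀), ∃ γ : ℝ → E, γ 0 = p.2 ∧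
      ∀ t ∈ Ioo (-ε) ε, HasDerivAt γ (w p.1 (γ t)) t ∧ γ t ∈ S := by
  -- The parameter becomes a component of the state with zero velocity.
  obtain ⟨ε, hε, h⟩ := exists_uniform_flow (f := fun p : Q × E ↦ ((0 : Q), w p.1 p.2))
    (contDiffAt_const.prodMk hw) (S := univ ×ˢ S) (prod_mem_nhds univ_mem hS)
  refine ⟨ε, hε, h.mono ?_⟩
  rintro ⟨q, z⟩ ⟨α, hα0, hα⟩
  have hconst : ∀ t ∈ Ioo (-ε) ε, (α t).1 = q := by
    intro t ht
    have hd : ∀ t ∈ Ioo (-ε) ε, HasDerivAt (fun t ↦ (α t).1) 0 t := fun t ht ↦ (hα t ht).1.fst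
    have := isOpen_Ioo.is_const_of_deriv_eq_zero isPreconnected_Ioo
      (fun t ht ↦ (hd t ht).differentiableAt.differentiableWithinAt)
      (fun t ht ↦ (hd t ht).deriv) ht (⟨by linarith, hε⟩ : (0 : ℝ) ∈ Ioo (-ε) ε)
    simpa [hα0] using this
  refine ⟨fun t ↦ (α t).2, by simp [hα0], fun t ht ↦ ⟨?_, (hα t ht).2.2⟩⟩
  have := HasFDerivAt.comp_hasDerivAt t hasFDerivAt_snd (hα t ht).1
  simpa [hconst t ht] using! this

/-- The bootstrapping argument again, now with `γ' = f ∘ γ`. -/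
theorem contDiffAt_of_ode {E : Type*} [NormedAddCommGroup E] [NormedSpace ℝ E]
    {f : E → E} {γ : ℝ → E} {t₀ : ℝ} {U : Set E} (hU : IsOpen U) (ht : γ t₀ ∈ U)
    (hf : ContDiffOn ℝ ∞ f U) (hγ : ∀ᶠ t in 𝓝 t₀, HasDerivAt γ (f (γ t)) t) :
    ContDiffAt ℝ ∞ γ t₀ := by
  have hev : ∀ᶠ t in 𝓝 t₀, HasDerivAt γ (f (γ t)) t ∧ γ t ∈ U :=
    hγ.and (hγ.self_of_nhds.continuousAt.eventually_mem (hU.mem_nhds ht))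
  obtain ⟨ε, hε, hb⟩ := Metric.eventually_nhds_iff_ball.1 hev
  have key : ∀ n : ℕ, ContDiffOn ℝ n γ (Metric.ball t₀ ε) := by
    intro n
    induction n with
    | zero => exact contDiffOn_zero.2 fun z hz ↦ (hb z hz).1.continuousAt.continuousWithinAt
    | succ n ih =>
      push_cast
      rw [contDiffOn_succ_iff_deriv_of_isOpen Metric.isOpen_ball]
      refine ⟨fun z hz ↦ (hb z hz).1.differentiableAt.differentiableWithinAt, by simp, ?_⟩
      refine ContDiffOn.congr (f := fun t ↦ f (γ t)) ?_ fun z hz ↦ (hb z hz).1.deriv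
      exact (hf.of_le (by exact_mod_cast le_top)).comp ih fun t ht ↦ (hb t ht).2
  exact (contDiffOn_infty.2 key).contDiffAt (Metric.ball_mem_nhds _ hε)

end Flows

/-! ### Local extension of sections and the Leibniz rule -/

section FlatFrames

variable {E : Type*} [NormedAddCommGroup E] [NormedSpace ℝ E] [FiniteDimensional ℝ E]
  {M : Type*} [TopologicalSpace M] [ChartedSpace E M] [IsManifold 𝓘(ℝ, E) ∞ M]
  {F : Type*} [NormedAddCommGroup F] [NormedSpace ℝ F]
  {V : M → Type*} [TopologicalSpace (TotalSpace F V)]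
  [∀ x, AddCommGroup (V x)] [∀ x, Module ℝ (V x)] [∀ x, TopologicalSpace (V x)]
  [∀ x, IsTopologicalAddGroup (V x)] [∀ x, ContinuousSMul ℝ (V x)]
  [FiberBundle F V] [VectorBundle ℝ F V] [ContMDiffVectorBundle ∞ F V 𝓘(ℝ, E)]

/-- Evaluation of smooth sections at a point, as a linear map. -/
def evalSection (x : M) : Cₛ^∞⟮𝓘(ℝ, E); F, V⟯ →ₗ[ℝ] V x where
  toFun S := S x
  map_add' _ _ := rfl
  map_smul' _ _ := rfl

@[simp]
theorem evalSection_apply (x : M) (S : Cₛ^∞⟮𝓘(ℝ, E); F, V⟯) : evalSection x S = S x := rfl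

/-- The covariant derivative of smooth sections at a point, as a linear map. -/
def covLinear (cov : CovariantDerivative 𝓘(ℝ, E) F V) (x : M) :
    Cₛ^∞⟮𝓘(ℝ, E); F, V⟯ →ₗ[ℝ] TangentSpace 𝓘(ℝ, E) x →L[ℝ] V x where
  toFun S := cov S x
  map_add' S T := by
    rw [ContMDiffSection.coe_add,
      cov.isCovariantDerivativeOnUniv.add S.mdifferentiableAt T.mdifferentiableAt]
  map_smul' c S := by
    rw [ContMDiffSection.coe_smul,
      cov.isCovariantDerivativeOnUniv.smul_const c S.mdifferentiableAt]
    rfl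

@[simp]
theorem covLinear_apply (cov : CovariantDerivative 𝓘(ℝ, E) F V) (x : M)
    (S : Cₛ^∞⟮𝓘(ℝ, E); F, V⟯) : covLinear cov x S = cov S x := rfl

/-- A section that is smooth near a point agrees near that point with a global smooth section. -/
theorem exists_section_eventuallyEq [T2Space M] (s : ∀ x, V x) {x₀ : M}
    (hs : ∀ᶠ y in 𝓝 x₀,
      ContMDiffAt 𝓘(ℝ, E) (𝓘(ℝ, E).prod 𝓘(ℝ, F)) ∞ (fun y ↦ TotalSpace.mk' F y (s y)) y) :
    ∃ S : Cₛ^∞⟮𝓘(ℝ, E); F, V⟯, ∀ᶠ y in 𝓝 x₀, S y = s y := by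
  obtain ⟨u, hus, hu, hxu⟩ := mem_nhds_iff.1 hs
  obtain ⟨b, -, hb⟩ := (SmoothBumpFunction.nhds_basis_tsupport (I := 𝓘(ℝ, E)) x₀).mem_iff.1
    (hu.mem_nhds hxu)
  refine ⟨⟨_, ContMDiffOn.smul_section_of_tsupport b.contMDiff.contMDiffOn hu hb
    (fun y hy ↦ (hus hy).contMDiffWithinAt)⟩, ?_⟩
  filter_upwards [b.eventuallyEq_one] with y hy
  change b y • s y = s y
  rw [hy]
  exact one_smul _ _

/-- A linear family of sections that are smooth near a point agrees near that point with
a linear family of global smooth sections. -/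
theorem exists_linear_sections [T2Space M] {F₀ : Type*} [NormedAddCommGroup F₀] [NormedSpace ℝ F₀]
    [FiniteDimensional ℝ F₀] (s : ∀ x, F₀ →ₗ[ℝ] V x) {x₀ : M}
    (hs : ∀ u, ∀ᶠ y in 𝓝 x₀,
      ContMDiffAt 𝓘(ℝ, E) (𝓘(ℝ, E).prod 𝓘(ℝ, F)) ∞ (fun y ↦ TotalSpace.mk' F y (s y u)) y) :
    ∃ S : F₀ →ₗ[ℝ] Cₛ^∞⟮𝓘(ℝ, E); F, V⟯, ∀ᶠ y in 𝓝 x₀, ∀ u, S u y = s y u := by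
  let b := Module.finBasis ℝ F₀
  choose S hS using fun i ↦ exists_section_eventuallyEq (fun y ↦ s y (b i)) (hs (b i))
  refine ⟨b.constr ℝ S, ?_⟩
  filter_upwards [eventually_all.2 hS] with y hy u
  have h : evalSection y ∘ₗ b.constr ℝ S = s y := by
    refine b.ext fun i ↦ ?_
    rw [LinearMap.comp_apply, b.constr_basis, evalSection_apply, hy]
  exact congr($h u)

variable (cov : CovariantDerivative 𝓘(ℝ, E) F V)

theorem cov_congr {S T : ∀ x, V x} {x : M}
    (hS : MDifferentiableAt 𝓘(ℝ, E) (𝓘(ℝ, E).prod 𝓘(ℝ, F)) (fun y ↦ TotalSpace.mk' F y (S y)) x)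
    (hT : MDifferentiableAt 𝓘(ℝ, E) (𝓘(ℝ, E).prod 𝓘(ℝ, F)) (fun y ↦ TotalSpace.mk' F y (T y)) x)
    (h : ∀ᶠ y in 𝓝 x, S y = T y) : cov S x = cov T x :=
  cov.isCovariantDerivativeOnUniv.congr_of_eventuallyEq hS hT univ_mem h

/-- The Leibniz rule for the covariant derivative of a linear combination of sections. -/
theorem cov_sum_smul {ι : Type*} (t : Finset ι) {S : ι → ∀ x, V x} {a : ι → M → ℝ} {x : M}
    (hS : ∀ i, MDifferentiableAt 𝓘(ℝ, E) (𝓘(ℝ, E).prod 𝓘(ℝ, F))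
      (fun y ↦ TotalSpace.mk' F y (S i y)) x)
    (ha : ∀ i, MDifferentiableAt 𝓘(ℝ, E) 𝓘(ℝ, ℝ) (a i) x) :
    MDifferentiableAt 𝓘(ℝ, E) (𝓘(ℝ, E).prod 𝓘(ℝ, F))
      (fun y ↦ TotalSpace.mk' F y ((∑ i ∈ t, a i • S i) y)) x ∧
    cov (∑ i ∈ t, a i • S i) x =
      ∑ i ∈ t, (a i x • cov (S i) x + (mvfderiv 𝓘(ℝ, E) (a i) x).smulRight (S i x)) := by
  classical
  induction t using Finset.induction_on with
  | empty =>
    simp only [Finset.sum_empty]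
    exact ⟨mdifferentiableAt_zeroSection .., cov.isCovariantDerivativeOnUniv.zero⟩
  | insert i t hi ih =>
    have h1 := (ha i).smul_section (hS i)
    simp only [Finset.sum_insert hi]
    refine ⟨mdifferentiableAt_add_section h1 ih.1, ?_⟩
    rw [cov.isCovariantDerivativeOnUniv.add h1 ih.1, ih.2,
      cov.isCovariantDerivativeOnUniv.leibniz (hS i) (ha i)]

/-- If a section is a linear combination, with differentiable coefficients, of smooth sections
depending linearly on a parameter, its covariant derivative is computed by the Leibniz rule. -/
theorem cov_linear_family {F₀ : Type*} [NormedAddCommGroup F₀] [NormedSpace ℝ F₀]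
    [FiniteDimensional ℝ F₀] (S : F₀ →ₗ[ℝ] Cₛ^∞⟮𝓘(ℝ, E); F, V⟯) {a : M → F₀} {x : M}
    (ha : MDifferentiableAt 𝓘(ℝ, E) 𝓘(ℝ, F₀) a x) {T : ∀ x, V x}
    (hT : MDifferentiableAt 𝓘(ℝ, E) (𝓘(ℝ, E).prod 𝓘(ℝ, F)) (fun y ↦ TotalSpace.mk' F y (T y)) x)
    (h : ∀ᶠ y in 𝓝 x, T y = S (a y) y) (w : TangentSpace 𝓘(ℝ, E) x) :
    cov T x w = cov (S (a x)) x w + S (mvfderiv 𝓘(ℝ, E) a x w) x := by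
  let b := Module.finBasis ℝ F₀
  let c : Fin (Module.finrank ℝ F₀) → F₀ →L[ℝ] ℝ := fun i ↦ (b.coord i).toContinuousLinearMap
  have hc : ∀ i, HasMFDerivAt 𝓘(ℝ, E) 𝓘(ℝ, ℝ) (fun y ↦ c i (a y)) x
      ((c i).comp (mfderiv 𝓘(ℝ, E) 𝓘(ℝ, F₀) a x)) := fun i ↦
    (c i).hasMFDerivAt.comp x ha.hasMFDerivAt
  have hsum : ∀ (u : F₀), u = ∑ i, c i u • b i := fun u ↦ (b.sum_repr u).symm
  -- Expanding in a basis of the parameter space reduces the claim to finite combinations with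
  -- scalar coefficients.
  have key := cov_sum_smul cov Finset.univ (S := fun i ↦ (S (b i) : ∀ x, V x))
    (a := fun i y ↦ c i (a y)) (x := x) (fun i ↦ (S (b i)).mdifferentiableAt)
    (fun i ↦ (hc i).mdifferentiableAt)
  have e : ∀ u y, S u y = ∑ i, c i u • S (b i) y := by
    intro u y
    conv_lhs => rw [hsum u]
    change evalSection y (S _) = _
    simp
  rw [cov_congr cov hT key.1 ?_, key.2]
  · have e1 : cov (S (a x)) x = ∑ i, c i (a x) • cov (S (b i)) x := by
      conv_lhs => rw [hsum (a x)]
      change covLinear cov x (S _) = _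
      simp
    rw [e1, e (mvfderiv 𝓘(ℝ, E) a x w) x, Finset.sum_add_distrib, add_apply]
    congr 1
    rw [sum_apply]
    refine Finset.sum_congr rfl fun i _ ↦ ?_
    rw [ContinuousLinearMap.smulRight_apply]
    congr 1
    change mfderiv 𝓘(ℝ, E) 𝓘(ℝ, ℝ) (fun y ↦ c i (a y)) x w = _
    rw [(hc i).mfderiv]
    rfl
  · filter_upwards [h] with y hy
    rw [hy, e]
    simp

end FlatFrames

/-! ### Commuting coordinate vector fields -/

section Coordinates

variable {E : Type*} [NormedAddCommGroup E] [NormedSpace ℝ E] [FiniteDimensional ℝ E]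
  {M : Type*} [TopologicalSpace M] [ChartedSpace E M] [IsManifold 𝓘(ℝ, E) ∞ M]
  {F : Type*} [NormedAddCommGroup F] [NormedSpace ℝ F]
  {V : M → Type*} [TopologicalSpace (TotalSpace F V)]
  [∀ x, AddCommGroup (V x)] [∀ x, Module ℝ (V x)] [∀ x, TopologicalSpace (V x)]
  [∀ x, IsTopologicalAddGroup (V x)] [∀ x, ContinuousSMul ℝ (V x)]
  [FiberBundle F V] [VectorBundle ℝ F V] [ContMDiffVectorBundle ∞ F V 𝓘(ℝ, E)]

/-- Near a point there are commuting global vector fields that represent the constant vector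
fields of a chart. -/
theorem exists_coordinate_fields [T2Space M] (x₀ : M) :
    ∃ W : E →ₗ[ℝ] Cₛ^∞⟮𝓘(ℝ, E); E, (TangentSpace 𝓘(ℝ, E) : M → Type _)⟯, ∀ᶠ y in 𝓝 x₀,
      (∀ w, mfderiv 𝓘(ℝ, E) 𝓘(ℝ, E) (extChartAt 𝓘(ℝ, E) x₀) y (W w y) = w) ∧
      (∀ w : TangentSpace 𝓘(ℝ, E) y, ∃ u, W u y = w) ∧
      ∀ w w', VectorField.mlieBracket 𝓘(ℝ, E) (fun z ↦ W w z) (fun z ↦ W w' z) y = 0 := by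
  have : CompleteSpace E := FiniteDimensional.complete ℝ E
  have : IsManifold 𝓘(ℝ, E) (minSmoothness ℝ 2) M :=
    IsManifold.of_le (n := ∞) (by rw [minSmoothness_of_isRCLikeNormedField]; exact ENat.LEInfty.out)
  let k : ∀ (w : E) (z : E), TangentSpace 𝓘(ℝ, E) z := fun w _ ↦ w
  -- The fields are chart pullbacks of constant fields. Pullback respects Lie brackets, and constant
  -- fields commute.
  let s : ∀ y : M, E →ₗ[ℝ] TangentSpace 𝓘(ℝ, E) y := fun y ↦
    { toFun := fun w ↦
        VectorField.mpullback 𝓘(ℝ, E) 𝓘(ℝ, E) (extChartAt 𝓘(ℝ, E) x₀) (k w) y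
      map_add' := fun v w ↦ map_add
        (mfderiv 𝓘(ℝ, E) 𝓘(ℝ, E) (extChartAt 𝓘(ℝ, E) x₀) y).inverse _ _
      map_smul' := fun c w ↦ map_smul
        (mfderiv 𝓘(ℝ, E) 𝓘(ℝ, E) (extChartAt 𝓘(ℝ, E) x₀) y).inverse _ _ }
  have hsrc : ∀ᶠ y in 𝓝 x₀, y ∈ (extChartAt 𝓘(ℝ, E) x₀).source :=
    extChartAt_source_mem_nhds x₀
  have hconst : ∀ (w : E) (z : E), ContMDiffAt 𝓘(ℝ, E) 𝓘(ℝ, E).tangent ∞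
      (fun y : E ↦ (⟨y, k w y⟩ : TangentBundle 𝓘(ℝ, E) E)) z := by
    intro w z
    rw [contMDiffAt_vectorSpace_iff_contDiffAt]
    exact contDiffAt_const
  obtain ⟨W, hW⟩ := exists_linear_sections (E := E) (F := E) s (x₀ := x₀) (fun w ↦ by
    filter_upwards [hsrc] with y hy
    exact ContMDiffAt.mpullback_vectorField_preimage (m := ∞) (n := ∞) (hconst w _)
      (contMDiffAt_extChartAt' (I := 𝓘(ℝ, E)) (x := x₀) (by simpa using hy))
      (isInvertible_mfderiv_extChartAt hy) le_rfl)
  refine ⟨W, ?_⟩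
  filter_upwards [hsrc, hW.eventually_nhds] with y hy hWy
  have hinv := isInvertible_mfderiv_extChartAt hy
  refine ⟨fun w ↦ ?_, fun w ↦ ?_, fun w w' ↦ ?_⟩
  · rw [hWy.self_of_nhds]
    exact hinv.self_apply_inverse w
  · refine ⟨mfderiv 𝓘(ℝ, E) 𝓘(ℝ, E) (extChartAt 𝓘(ℝ, E) x₀) y w, ?_⟩
    exact (hWy.self_of_nhds _).trans (hinv.inverse_apply_self w)
  · have h1 : ∀ w, (fun z ↦ W w z) =ᶠ[𝓝 y]
        VectorField.mpullback 𝓘(ℝ, E) 𝓘(ℝ, E) (extChartAt 𝓘(ℝ, E) x₀) (k w) := by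
      intro w
      filter_upwards [hWy] with z hz
      exact hz w
    rw [(h1 w).mlieBracket_vectorField_eq (h1 w'), ← VectorField.mpullback_mlieBracket
      (n := ∞) ((hconst w _).mdifferentiableAt (by simp)) ((hconst w' _).mdifferentiableAt (by simp))
      (contMDiffAt_extChartAt' (I := 𝓘(ℝ, E)) (x := x₀) (by simpa using hy))
      (by rw [minSmoothness_of_isRCLikeNormedField]; exact ENat.LEInfty.out)]
    rw [VectorField.mpullback_apply, ← VectorField.mlieBracketWithin_univ,
      VectorField.mlieBracketWithin_eq_lieBracketWithin]
    have : VectorField.lieBracketWithin ℝ (k w) (k w') univ = 0 := by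
      funext z
      simp [VectorField.lieBracketWithin, k]
    rw [this]
    exact map_zero _

end Coordinates

/-! ### Parallel frames of a flat connection -/

section FlatFrame

variable {E : Type*} [NormedAddCommGroup E] [NormedSpace ℝ E] [FiniteDimensional ℝ E]
  {M : Type*} [TopologicalSpace M] [ChartedSpace E M] [IsManifold 𝓘(ℝ, E) ∞ M]
  {F : Type*} [NormedAddCommGroup F] [NormedSpace ℝ F]
  {V : M → Type*} [TopologicalSpace (TotalSpace F V)]
  [∀ x, AddCommGroup (V x)] [∀ x, Module ℝ (V x)] [∀ x, TopologicalSpace (V x)]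
  [∀ x, IsTopologicalAddGroup (V x)] [∀ x, ContinuousSMul ℝ (V x)]
  [FiberBundle F V] [VectorBundle ℝ F V] [ContMDiffVectorBundle ∞ F V 𝓘(ℝ, E)]

/-- A frame of sections that are parallel over an open set, indexed by the model fibre, with the
coordinates of vectors in this frame. -/
structure FlatFrame (cov : CovariantDerivative 𝓘(ℝ, E) F V) where
  /-- The open set over which the sections form a parallel frame. -/
  dom : Set M
  isOpen_dom : IsOpen dom
  /-- The sections of the frame. -/
  sec : F →ₗ[ℝ] Cₛ^∞⟮𝓘(ℝ, E); F, V⟯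
  /-- The coordinates of vectors in the frame. -/
  coord : TotalSpace F V → F
  contMDiffAt_coord : ∀ v : TotalSpace F V, v.proj ∈ dom →
    ContMDiffAt (𝓘(ℝ, E).prod 𝓘(ℝ, F)) 𝓘(ℝ, F) ∞ coord v
  cov_sec : ∀ y ∈ dom, ∀ u, cov (sec u) y = 0
  coord_sec : ∀ y ∈ dom, ∀ u, coord ⟨y, sec u y⟩ = u
  sec_coord : ∀ v : TotalSpace F V, v.proj ∈ dom → sec (coord v) v.proj = v.2

variable [FiniteDimensional ℝ F] (cov : CovariantDerivative 𝓘(ℝ, E) F V)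
  [CovariantDerivative.ContMDiffCovariantDerivative cov ∞]

/-- The connection form in a trivialization: its value on tangent vectors and on vectors of
the model fibre given by linear families of sections. -/
def connectionForm (e : Trivialization F (π F V)) [e.IsLinear ℝ]
    (S : F →ₗ[ℝ] Cₛ^∞⟮𝓘(ℝ, E); F, V⟯)
    (W : E →ₗ[ℝ] Cₛ^∞⟮𝓘(ℝ, E); E, (TangentSpace 𝓘(ℝ, E) : M → Type _)⟯) (y : M) :
    E →L[ℝ] F →L[ℝ] F :=
  LinearMap.toContinuousLinearMap
    { toFun := fun w ↦ LinearMap.toContinuousLinearMap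
        { toFun := fun u ↦ e.continuousLinearMapAt ℝ y (covLinear cov y (S u) (W w y))
          map_add' := fun u v ↦ by simp only [map_add, add_apply]
          map_smul' := fun c u ↦ by simp only [map_smul, RingHom.id_apply, smul_apply] }
      map_add' := fun v w ↦ by
        ext u
        change e.continuousLinearMapAt ℝ y (covLinear cov y (S u) (evalSection y (W (v + w)))) =
          e.continuousLinearMapAt ℝ y (covLinear cov y (S u) (evalSection y (W v))) +
          e.continuousLinearMapAt ℝ y (covLinear cov y (S u) (evalSection y (W w)))
        simp only [map_add]
      map_smul' := fun c w ↦ by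
        ext u
        change e.continuousLinearMapAt ℝ y (covLinear cov y (S u) (evalSection y (W (c • w)))) =
          c • e.continuousLinearMapAt ℝ y (covLinear cov y (S u) (evalSection y (W w)))
        simp only [map_smul] }

theorem connectionForm_apply (e : Trivialization F (π F V)) [e.IsLinear ℝ]
    (S : F →ₗ[ℝ] Cₛ^∞⟮𝓘(ℝ, E); F, V⟯)
    (W : E →ₗ[ℝ] Cₛ^∞⟮𝓘(ℝ, E); E, (TangentSpace 𝓘(ℝ, E) : M → Type _)⟯) (y : M) (w : E) (u : F) :
    connectionForm cov e S W y w u = e.continuousLinearMapAt ℝ y (cov (S u) y (W w y)) := rfl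

theorem contDiffOn_connectionForm (e : Trivialization F (π F V)) [MemTrivializationAtlas e]
    (S : F →ₗ[ℝ] Cₛ^∞⟮𝓘(ℝ, E); F, V⟯)
    (W : E →ₗ[ℝ] Cₛ^∞⟮𝓘(ℝ, E); E, (TangentSpace 𝓘(ℝ, E) : M → Type _)⟯) (x₀ : M) :
    ContDiffOn ℝ ∞ (fun z ↦ connectionForm cov e S W ((extChartAt 𝓘(ℝ, E) x₀).symm z))
      ((extChartAt 𝓘(ℝ, E) x₀).target ∩ (extChartAt 𝓘(ℝ, E) x₀).symm ⁻¹' e.baseSet) := by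
  rw [contDiffOn_clm_apply]
  intro w
  rw [contDiffOn_clm_apply]
  intro u
  rw [← contMDiffOn_iff_contDiffOn]
  have h1 : ContMDiffOn 𝓘(ℝ, E) 𝓘(ℝ, F) ∞
      (fun y ↦ (e ⟨y, covSection cov (W w) (S u) y⟩).2) e.baseSet :=
    (e.contMDiffOn_section_baseSet_iff).1 (covSection cov (W w) (S u)).contMDiff.contMDiffOn
  have h2 := (h1.comp ((contMDiffOn_extChartAt_symm (I := 𝓘(ℝ, E)) (n := ∞) x₀).mono
    inter_subset_left) (fun z hz ↦ hz.2) : ContMDiffOn _ _ _ _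
      ((extChartAt 𝓘(ℝ, E) x₀).target ∩ (extChartAt 𝓘(ℝ, E) x₀).symm ⁻¹' e.baseSet))
  refine h2.congr fun z hz ↦ ?_
  rw [connectionForm_apply, Trivialization.continuousLinearMapAt_apply,
    Trivialization.linearMapAt_apply, if_pos (mem_preimage.1 hz.2)]
  rfl

/-- The Leibniz rule in coordinates. -/
theorem cov_coordinates (S : F →ₗ[ℝ] Cₛ^∞⟮𝓘(ℝ, E); F, V⟯)
    {x₀ y : M} (hy : y ∈ (extChartAt 𝓘(ℝ, E) x₀).source) {w : E} {w' : TangentSpace 𝓘(ℝ, E) y}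
    (hw : mfderiv 𝓘(ℝ, E) 𝓘(ℝ, E) (extChartAt 𝓘(ℝ, E) x₀) y w' = w) {s : E → F}
    (hs : DifferentiableAt ℝ s (extChartAt 𝓘(ℝ, E) x₀ y)) {T : ∀ x, V x}
    (hT : MDifferentiableAt 𝓘(ℝ, E) (𝓘(ℝ, E).prod 𝓘(ℝ, F)) (fun y ↦ TotalSpace.mk' F y (T y)) y)
    (h : ∀ᶠ z in 𝓝 y, T z = S (s (extChartAt 𝓘(ℝ, E) x₀ z)) z) :
    cov T y w' = cov (S (s (extChartAt 𝓘(ℝ, E) x₀ y))) y w' +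
      S (fderiv ℝ s (extChartAt 𝓘(ℝ, E) x₀ y) w) y := by
  have hφ : MDifferentiableAt 𝓘(ℝ, E) 𝓘(ℝ, E) (extChartAt 𝓘(ℝ, E) x₀) y :=
    mdifferentiableAt_extChartAt (by simpa using hy)
  have h1 := hs.hasFDerivAt.hasMFDerivAt.comp y hφ.hasMFDerivAt
  have h2 := cov_linear_family cov S (a := fun z ↦ s (extChartAt 𝓘(ℝ, E) x₀ z))
    h1.mdifferentiableAt hT h w'
  rw [h2]
  congr 2
  change S (mfderiv 𝓘(ℝ, E) 𝓘(ℝ, F) (s ∘ (extChartAt 𝓘(ℝ, E) x₀)) y w') = _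
  rw [h1.mfderiv]
  subst hw
  rfl

/-- In a chart and a trivialization the connection is `d + Γ`, and flatness says `dΓ + Γ ∧ Γ = 0`.
Solving `df = -Γ f` in `End F` with `f = 1` at the base point gives an `f` that is invertible
nearby. The sections with trivialized value `f u` are parallel, and `f⁻¹` composed with the
trivialization gives the coordinates. -/
theorem exists_flatFrame [T2Space M] (hflat : IsFlat cov) (x₀ : M) :
    ∃ B : FlatFrame cov, x₀ ∈ B.dom := by
  have : CompleteSpace F := FiniteDimensional.complete ℝ F
  let e := trivializationAt F V x₀
  let φ := extChartAt 𝓘(ℝ, E) x₀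
  let L : ∀ y, V y →L[ℝ] F := fun y ↦ e.continuousLinearMapAt ℝ y
  have hsymm : ∀ (s : M → F) (y : M), y ∈ e.baseSet → ContMDiffAt 𝓘(ℝ, E) 𝓘(ℝ, F) ∞ s y →
      ContMDiffAt 𝓘(ℝ, E) (𝓘(ℝ, E).prod 𝓘(ℝ, F)) ∞
        (fun y ↦ TotalSpace.mk' F y (e.symmₗ ℝ y (s y))) y := by
    intro s y hy hs
    rw [e.contMDiffAt_section_iff hy]
    refine hs.congr_of_eventuallyEq ?_
    filter_upwards [e.open_baseSet.mem_nhds hy] with z hz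
    rw [Trivialization.symmₗ_apply _ hz, e.apply_mk_symm hz]
  -- Near `x₀`, `S u` is the section that is constantly `u` in the trivialization.
  obtain ⟨S, hS⟩ := exists_linear_sections (fun y ↦ e.symmₗ ℝ y) (x₀ := x₀) (fun u ↦ by
    filter_upwards [e.open_baseSet.mem_nhds (mem_baseSet_trivializationAt F V x₀)] with y hy
    exact hsymm (fun _ ↦ u) y hy contMDiffAt_const)
  obtain ⟨W, hW⟩ := exists_coordinate_fields (E := E) x₀
  have hsrc : ∀ᶠ y in 𝓝 x₀, y ∈ φ.source := extChartAt_source_mem_nhds (I := 𝓘(ℝ, E)) x₀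
  have hbase : ∀ᶠ y in 𝓝 x₀, y ∈ e.baseSet :=
    e.open_baseSet.mem_nhds (mem_baseSet_trivializationAt F V x₀)
  obtain ⟨U, hU, hUo, hx₀⟩ := eventually_nhds_iff.1 (hsrc.and (hbase.and (hS.and hW)))
  have hLS : ∀ y ∈ U, ∀ u, L y (S u y) = u := by
    intro y hy u
    rw [(hU y hy).2.2.1 u]
    exact Trivialization.linearMapAt_symmₗ e (hU y hy).2.1 u
  have hSL : ∀ y ∈ U, ∀ v, S (L y v) y = v := by
    intro y hy v
    rw [(hU y hy).2.2.1]
    exact Trivialization.symmₗ_linearMapAt e (hU y hy).2.1 v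
  let Γ : E → E →L[ℝ] F →L[ℝ] F := fun z ↦ connectionForm cov e S W (φ.symm z)
  have hΓdef : ∀ y ∈ U, ∀ w u, cov (S u) y (W w y) = S (Γ (φ y) w u) y := by
    intro y hy w u
    simp only [Γ]
    rw [φ.left_inv (hU y hy).1, connectionForm_apply]
    exact (hSL y hy _).symm
  have hD₀ : IsOpen (φ.target ∩ φ.symm ⁻¹' U) :=
    (continuousOn_extChartAt_symm x₀).isOpen_inter_preimage (isOpen_extChartAt_target x₀) hUo
  have hΓ : ContDiffOn ℝ ∞ Γ (φ.target ∩ φ.symm ⁻¹' U) :=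
    (contDiffOn_connectionForm cov e S W x₀).mono
      (inter_subset_inter_right _ (preimage_mono fun y hy ↦ (hU y hy).2.1))
  have hz₀ : φ x₀ ∈ φ.target ∩ φ.symm ⁻¹' U :=
    ⟨φ.map_source (hU x₀ hx₀).1, by
      rw [mem_preimage, φ.left_inv (hU x₀ hx₀).1]; exact hx₀⟩
  obtain ⟨r, hr, hf⟩ := exists_parallel_of_flat (R := F →L[ℝ] F) (Γ := Γ) (z₀ := φ x₀)
    ((hΓ.contDiffAt (hD₀.mem_nhds hz₀)).of_le ENat.LEInfty.out) (by
    filter_upwards [hD₀.mem_nhds hz₀] with z hz w w'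
    obtain ⟨y, hy, rfl⟩ : ∃ y ∈ U, φ y = z := ⟨φ.symm z, hz.2, φ.right_inv hz.1⟩
    have hyU : ∀ᶠ y' in 𝓝 y, y' ∈ U := hUo.mem_nhds hy
    have hdiff : DifferentiableAt ℝ Γ (φ y) :=
      (hΓ.contDiffAt (hD₀.mem_nhds hz)).differentiableAt (by simp)
    -- The second covariant derivative in coordinates. Antisymmetrized over commuting fields, which
    -- have no bracket term, it becomes the curvature of `Γ`.
    have key : ∀ w w' u, cov (covSection cov (W w') (S u)) y (W w y) =
        S (Γ (φ y) w (Γ (φ y) w' u) + (fderiv ℝ (fun z ↦ Γ z w') (φ y) w) u) y := by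
      intro w w' u
      have hd : HasFDerivAt (fun z ↦ Γ z w' u)
          (((fderiv ℝ (fun z ↦ Γ z w') (φ y)).flip u)) (φ y) :=
        (hdiff.clm_apply (differentiableAt_const w')).hasFDerivAt.clm_apply
          (hasFDerivAt_const u (φ y)) |>.congr_fderiv (by ext; simp)
      rw [cov_coordinates cov S (hU y hy).1 ((hU y hy).2.2.2.1 w) hd.differentiableAt
        (covSection cov (W w') (S u)).mdifferentiableAt (by
          filter_upwards [hyU] with y' hy'
          exact hΓdef y' hy' w' u), hΓdef y hy, hd.fderiv]
      simp only [map_add]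
      rfl
    ext u
    have h := hflat (W w) (W w') (S u) y
    rw [(hU y hy).2.2.2.2.2 w w', map_zero, sub_zero, key, key] at h
    have h' := congrArg (L y) h
    rw [map_sub, map_zero, hLS y hy, hLS y hy] at h'
    rw [zero_apply, ← h']
    simp only [add_apply, sub_apply]
    abel)
  obtain ⟨f, hf₀, hf⟩ := hf 1
  have hfU : ∀ᶠ z in 𝓝 (φ x₀), IsUnit (f z) :=
    (hf _ (Metric.mem_ball_self hr)).continuousAt.eventually
      (Units.isOpen.mem_nhds (by rw [hf₀]; exact isUnit_one))
  have hfs : ContDiffOn ℝ ∞ f (Metric.ball (φ x₀) r ∩ (φ.target ∩ φ.symm ⁻¹' U)) :=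
    contDiffOn_of_parallel (Metric.isOpen_ball.inter hD₀) (hΓ.mono inter_subset_right)
      fun z hz ↦ hf z hz.1
  have hfs' : ∀ y ∈ U, φ y ∈ Metric.ball (φ x₀) r → ContMDiffAt 𝓘(ℝ, E) 𝓘(ℝ, F →L[ℝ] F) ∞
      (fun y ↦ f (φ y)) y := by
    intro y hy hyr
    have hz : φ y ∈ φ.target ∩ φ.symm ⁻¹' U :=
      ⟨φ.map_source (hU y hy).1, by rw [mem_preimage, φ.left_inv (hU y hy).1]; exact hy⟩
    exact (hfs.contDiffAt ((Metric.isOpen_ball.inter hD₀).mem_nhds ⟨hyr, hz⟩)).contMDiffAt.comp y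
      (contMDiffAt_extChartAt' (I := 𝓘(ℝ, E)) (x := x₀) (by simpa [φ] using (hU y hy).1))
  have hφc : Tendsto φ (𝓝 x₀) (𝓝 (φ x₀)) := continuousAt_extChartAt x₀
  have hball : ∀ᶠ y in 𝓝 x₀, φ y ∈ Metric.ball (φ x₀) r :=
    hφc.eventually (Metric.ball_mem_nhds _ hr)
  obtain ⟨S', hS'⟩ := exists_linear_sections
    (fun y ↦ e.symmₗ ℝ y ∘ₗ (f (φ y) : F →ₗ[ℝ] F)) (x₀ := x₀) (fun u ↦ by
      filter_upwards [hUo.mem_nhds hx₀, hball] with y hy hyr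
      exact hsymm (fun y ↦ f (φ y) u) y (hU y hy).2.1
        ((hfs' y hy hyr).clm_apply contMDiffAt_const))
  obtain ⟨U', hU', hU'o, hx₀'⟩ := eventually_nhds_iff.1
    ((hUo.eventually_mem hx₀).and (hball.and ((hφc.eventually hfU).and hS')))
  have hS'S : ∀ y ∈ U', ∀ u, S' u y = S (f (φ y) u) y := by
    intro y hy u
    rw [(hU' y hy).2.2.2, (hU y (hU' y hy).1).2.2.1]
    rfl
  have hL : ∀ v : TotalSpace F V, v.proj ∈ U' → L v.proj v.2 = (e v).2 := by
    intro v hv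
    change e.continuousLinearMapAt ℝ v.proj v.2 = _
    rw [Trivialization.continuousLinearMapAt_apply, Trivialization.linearMapAt_apply,
      if_pos (hU _ (hU' _ hv).1).2.1]
  -- `U'` lies in the set where `f` is invertible, so over it `Ring.inverse` is the true inverse and
  -- is smooth.
  refine ⟨⟨U', hU'o, S', fun v ↦ Ring.inverse (f (φ v.proj)) ((e v).2), fun v hv ↦ ?_,
    fun y hy u ↦ ?_, fun y hy u ↦ ?_, fun v hv ↦ ?_⟩, hx₀'⟩
  · refine ContMDiffAt.clm_apply ?_ ?_
    · obtain ⟨c, hc⟩ := (hU' _ hv).2.2.1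
      have h1 : ContMDiffAt 𝓘(ℝ, F →L[ℝ] F) 𝓘(ℝ, F →L[ℝ] F) ∞ Ring.inverse (f (φ v.proj)) := by
        rw [← hc]
        exact (contDiffAt_ringInverse ℝ c).contMDiffAt
      have h2 : ContMDiffAt (𝓘(ℝ, E).prod 𝓘(ℝ, F)) 𝓘(ℝ, F →L[ℝ] F) ∞
          (fun v : TotalSpace F V ↦ f (φ v.proj)) v :=
        (hfs' _ (hU' _ hv).1 (hU' _ hv).2.1).comp v (contMDiffAt_proj V)
      exact h1.comp v h2
    · exact ((e.contMDiffAt_iff (f := id) (e.mem_source.2 (hU _ (hU' _ hv).1).2.1)).1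
        contMDiffAt_id).2
  · ext w
    obtain ⟨w, rfl⟩ := (hU y (hU' y hy).1).2.2.2.2.1 w
    have hd := hf _ (hU' y hy).2.1
    have hd' : HasFDerivAt (fun z ↦ f z u)
        ((-((ContinuousLinearMap.mul ℝ (F →L[ℝ] F)).flip (f (φ y)) ∘L Γ (φ y))).flip u) (φ y) :=
      (hd.clm_apply (hasFDerivAt_const u (φ y))).congr_fderiv (by ext; simp)
    rw [cov_coordinates cov S (hU y (hU' y hy).1).1 ((hU y (hU' y hy).1).2.2.2.1 w)
      hd'.differentiableAt (S' u).mdifferentiableAt (by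
        filter_upwards [hU'o.mem_nhds hy] with z hz
        exact hS'S z hz u), hΓdef y (hU' y hy).1, hd'.fderiv]
    change evalSection y (S _) + evalSection y (S _) = 0
    rw [← map_add, ← map_add]
    -- The connection term `Γ f u` cancels against `df u = -Γ f u`.
    exact (congrArg (fun v ↦ evalSection y (S v))
      (add_neg_cancel (Γ (φ y) w (f (φ y) u)))).trans (by simp)
  · have hu := (hU' y hy).2.2.1
    change Ring.inverse (f (φ y)) (e ⟨y, S' u y⟩).2 = u
    rw [← hL ⟨y, S' u y⟩ hy]
    change Ring.inverse (f (φ y)) (L y (S' u y)) = u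
    rw [hS'S y hy, hLS y (hU' y hy).1]
    exact congr($(Ring.inverse_mul_cancel _ hu) u)
  · have hu := (hU' _ hv).2.2.1
    change S' (Ring.inverse (f (φ v.proj)) (e v).2) v.proj = v.2
    rw [hS'S _ hv]
    have : f (φ v.proj) (Ring.inverse (f (φ v.proj)) (e v).2) = (e v).2 :=
      congr($(Ring.mul_inverse_cancel _ hu) (e v).2)
    rw [this, ← hL v hv, hSL _ (hU' _ hv).1]


end FlatFrame

/-! ### Rigidity of parallel sections -/

section ParallelSections

variable {E : Type*} [NormedAddCommGroup E] [NormedSpace ℝ E] [FiniteDimensional ℝ E]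
  {M : Type*} [TopologicalSpace M] [ChartedSpace E M] [IsManifold 𝓘(ℝ, E) ∞ M]
  {F : Type*} [NormedAddCommGroup F] [NormedSpace ℝ F]
  {V : M → Type*} [TopologicalSpace (TotalSpace F V)]
  [∀ x, AddCommGroup (V x)] [∀ x, Module ℝ (V x)] [∀ x, TopologicalSpace (V x)]
  [∀ x, IsTopologicalAddGroup (V x)] [∀ x, ContinuousSMul ℝ (V x)]
  [FiberBundle F V] [VectorBundle ℝ F V] [ContMDiffVectorBundle ∞ F V 𝓘(ℝ, E)]

/-- A function whose derivative vanishes near a point is constant near that point. -/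
theorem eventually_const_of_mvfderiv_eq_zero {G : Type*} [NormedAddCommGroup G] [NormedSpace ℝ G]
    {a : M → G} {x : M} (ha : ∀ᶠ y in 𝓝 x, MDifferentiableAt 𝓘(ℝ, E) 𝓘(ℝ, G) a y ∧
      mvfderiv 𝓘(ℝ, E) a y = 0) : ∀ᶠ y in 𝓝 x, a y = a x := by
  let φ := extChartAt 𝓘(ℝ, E) x
  have hx : x ∈ φ.source := mem_extChartAt_source x
  have hc : Tendsto φ.symm (𝓝 (φ x)) (𝓝 x) := by
    have h := continuousAt_extChartAt_symm (I := 𝓘(ℝ, E)) x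
    rwa [ContinuousAt, extChartAt_to_inv x] at h
  have htgt : ∀ᶠ z in 𝓝 (φ x), z ∈ φ.target := extChartAt_target_mem_nhds x
  have hev : ∀ᶠ z in 𝓝 (φ x), z ∈ φ.target ∧ MDifferentiableAt 𝓘(ℝ, E) 𝓘(ℝ, G) a (φ.symm z) ∧
      mvfderiv 𝓘(ℝ, E) a (φ.symm z) = 0 :=
    htgt.and (hc.eventually ha)
  obtain ⟨r, hr, hball⟩ := Metric.eventually_nhds_iff_ball.1 hev
  have hd : ∀ z ∈ Metric.ball (φ x) r, HasFDerivAt (a ∘ φ.symm) (0 : E →L[ℝ] G) z := by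
    intro z hz
    obtain ⟨h1, h2, h3⟩ := hball z hz
    have hs : MDifferentiableAt 𝓘(ℝ, E) 𝓘(ℝ, E) φ.symm z :=
      ((contMDiffOn_extChartAt_symm (I := 𝓘(ℝ, E)) (n := ∞) x).contMDiffAt
        ((isOpen_extChartAt_target x).mem_nhds h1)).mdifferentiableAt (by simp)
    have h4 := h2.hasMFDerivAt.comp z hs.hasMFDerivAt
    have h5 : mfderiv 𝓘(ℝ, E) 𝓘(ℝ, G) a (φ.symm z) = 0 := h3
    rw [h5] at h4
    refine h4.hasFDerivAt.congr_fderiv ?_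
    exact ContinuousLinearMap.zero_comp _
  filter_upwards [(continuousAt_extChartAt (I := 𝓘(ℝ, E)) x).eventually
    (Metric.ball_mem_nhds _ hr), extChartAt_source_mem_nhds (I := 𝓘(ℝ, E)) x] with y hy hys
  have h := Metric.isOpen_ball.is_const_of_fderiv_eq_zero (𝕜 := ℝ)
    (convex_ball (φ x) r).isPreconnected
    (fun z hz ↦ (hd z hz).differentiableAt.differentiableWithinAt)
    (fun z hz ↦ (hd z hz).fderiv) (hy : φ y ∈ _) (Metric.mem_ball_self hr)
  simp only [Function.comp_apply] at h
  rwa [φ.left_inv hys, φ.left_inv hx] at h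

variable {cov : CovariantDerivative 𝓘(ℝ, E) F V}

namespace FlatFrame

variable (B : FlatFrame cov)

theorem eq_zero_of_sec_eq_zero {y : M} (hy : y ∈ B.dom) {u : F} (h : B.sec u y = 0) : u = 0 := by
  have h0 : B.sec 0 y = 0 := by rw [map_zero]; rfl
  rw [← B.coord_sec y hy u, h, ← h0, B.coord_sec y hy]

theorem eq_of_sec_eq_sec {y : M} (hy : y ∈ B.dom) {u v : F} (h : B.sec u y = B.sec v y) :
    u = v := by
  rw [← B.coord_sec y hy u, h, B.coord_sec y hy]

theorem eventually_cov_sec {y : M} (hy : y ∈ B.dom) (u : F) :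
    ∀ᶠ z in 𝓝 y, cov (B.sec u) z = 0 := by
  filter_upwards [B.isOpen_dom.mem_nhds hy] with z hz
  exact B.cov_sec z hz u

variable [FiniteDimensional ℝ F]

/-- A section that is parallel near a point has constant coordinates in a parallel frame. -/
theorem eventually_eq_sec {T : Cₛ^∞⟮𝓘(ℝ, E); F, V⟯} {x : M} (hx : x ∈ B.dom)
    (hT : ∀ᶠ y in 𝓝 x, cov T y = 0) : ∀ᶠ y in 𝓝 x, T y = B.sec (B.coord ⟨x, T x⟩) y := by
  have hdom : ∀ᶠ y in 𝓝 x, y ∈ B.dom := B.isOpen_dom.mem_nhds hx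
  have h : ∀ᶠ y in 𝓝 x, B.coord ⟨y, T y⟩ = B.coord ⟨x, T x⟩ := by
    refine eventually_const_of_mvfderiv_eq_zero (E := E) (a := fun y ↦ B.coord ⟨y, T y⟩) ?_
    filter_upwards [hdom.eventually_nhds, hT] with y hy hTy
    have hd : MDifferentiableAt 𝓘(ℝ, E) 𝓘(ℝ, F) (fun y ↦ B.coord ⟨y, T y⟩) y :=
      ((B.contMDiffAt_coord ⟨y, T y⟩ hy.self_of_nhds).comp y
        T.contMDiff.contMDiffAt).mdifferentiableAt (by simp)
    refine ⟨hd, ?_⟩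
    ext w
    have h1 := cov_linear_family cov B.sec hd T.mdifferentiableAt (by
      filter_upwards [hy] with z hz
      exact (B.sec_coord ⟨z, T z⟩ hz).symm) w
    rw [hTy, B.cov_sec y hy.self_of_nhds, zero_apply, zero_add] at h1
    exact B.eq_zero_of_sec_eq_zero hy.self_of_nhds h1.symm
  filter_upwards [h, hdom] with y hy hyd
  rw [← hy]
  exact (B.sec_coord ⟨y, T y⟩ hyd).symm

end FlatFrame

/-- Sections that are parallel near a point are determined near that point by their value. -/
theorem eventuallyEq_of_parallel [T2Space M] [FiniteDimensional ℝ F]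
    [CovariantDerivative.ContMDiffCovariantDerivative cov ∞] (hflat : IsFlat cov)
    {S T : Cₛ^∞⟮𝓘(ℝ, E); F, V⟯} {x : M} (hS : ∀ᶠ y in 𝓝 x, cov S y = 0)
    (hT : ∀ᶠ y in 𝓝 x, cov T y = 0) (h : S x = T x) : ∀ᶠ y in 𝓝 x, S y = T y := by
  obtain ⟨B, hB⟩ := exists_flatFrame cov hflat x
  filter_upwards [B.eventually_eq_sec hB hS, B.eventually_eq_sec hB hT] with y h1 h2
  rw [h1, h2, h]

end ParallelSections

/-! ### Integral curves of vector fields in charts -/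

section ChartField

variable {E : Type*} [NormedAddCommGroup E] [NormedSpace ℝ E] [FiniteDimensional ℝ E]
  {M : Type*} [TopologicalSpace M] [ChartedSpace E M] [IsManifold 𝓘(ℝ, E) ∞ M]

/-- A vector field in the chart at a point. -/
def chartField (x₀ : M) :
    Cₛ^∞⟮𝓘(ℝ, E); E, (TangentSpace 𝓘(ℝ, E) : M → Type _)⟯ →ₗ[ℝ] E → E where
  toFun Y z := (trivializationAt E (TangentSpace 𝓘(ℝ, E)) x₀).continuousLinearMapAt ℝ
    ((extChartAt 𝓘(ℝ, E) x₀).symm z) (Y ((extChartAt 𝓘(ℝ, E) x₀).symm z))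
  map_add' Y Z := by
    funext z
    exact map_add ((trivializationAt E (TangentSpace 𝓘(ℝ, E)) x₀).continuousLinearMapAt ℝ
      ((extChartAt 𝓘(ℝ, E) x₀).symm z)) _ _
  map_smul' c Y := by
    funext z
    exact map_smul ((trivializationAt E (TangentSpace 𝓘(ℝ, E)) x₀).continuousLinearMapAt ℝ
      ((extChartAt 𝓘(ℝ, E) x₀).symm z)) _ _

variable (Y : Cₛ^∞⟮𝓘(ℝ, E); E, (TangentSpace 𝓘(ℝ, E) : M → Type _)⟯)

theorem contDiffOn_chartField (x₀ : M) :
    ContDiffOn ℝ ∞ (chartField x₀ Y) (extChartAt 𝓘(ℝ, E) x₀).target := by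
  have hbase : ∀ z ∈ (extChartAt 𝓘(ℝ, E) x₀).target, (extChartAt 𝓘(ℝ, E) x₀).symm z ∈
      (trivializationAt E (TangentSpace 𝓘(ℝ, E)) x₀).baseSet := fun z hz ↦ by
    have := (extChartAt 𝓘(ℝ, E) x₀).map_target hz
    simpa using this
  rw [← contMDiffOn_iff_contDiffOn]
  have h1 : ContMDiffOn 𝓘(ℝ, E) 𝓘(ℝ, E) ∞
      (fun y ↦ (trivializationAt E (TangentSpace 𝓘(ℝ, E)) x₀ ⟨y, Y y⟩).2)
      (trivializationAt E (TangentSpace 𝓘(ℝ, E) : M → Type _) x₀).baseSet :=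
    ((trivializationAt E (TangentSpace 𝓘(ℝ, E) : M → Type _)
      x₀).contMDiffOn_section_baseSet_iff).1 Y.contMDiff.contMDiffOn
  refine (h1.comp (contMDiffOn_extChartAt_symm (I := 𝓘(ℝ, E)) (n := ∞) x₀) hbase).congr
    fun z hz ↦ ?_
  simp only [chartField, LinearMap.coe_mk, AddHom.coe_mk]
  rw [Trivialization.continuousLinearMapAt_apply, Trivialization.linearMapAt_apply,
    if_pos (hbase z hz)]
  rfl

theorem chartField_apply (x₀ : M) {y : M} (hy : y ∈ (extChartAt 𝓘(ℝ, E) x₀).source) :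
    chartField x₀ Y (extChartAt 𝓘(ℝ, E) x₀ y) =
      mfderiv 𝓘(ℝ, E) 𝓘(ℝ, E) (extChartAt 𝓘(ℝ, E) x₀) y (Y y) := by
  simp only [chartField, LinearMap.coe_mk, AddHom.coe_mk]
  rw [(extChartAt 𝓘(ℝ, E) x₀).left_inv hy,
    ← TangentBundle.continuousLinearMapAt_trivializationAt (by simpa using hy)]
  rfl

/-- An integral curve satisfies the differential equation given by the vector field in a chart. -/
theorem hasDerivAt_chart_of_hasMFDerivAt {m : ℝ → M} {t : ℝ} {x₀ : M}
    (hm : HasMFDerivAt 𝓘(ℝ, ℝ) 𝓘(ℝ, E) m t ((1 : ℝ →L[ℝ] ℝ).smulRight (Y (m t))))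
    (ht : m t ∈ (extChartAt 𝓘(ℝ, E) x₀).source) :
    HasDerivAt (fun s ↦ extChartAt 𝓘(ℝ, E) x₀ (m s))
      (chartField x₀ Y (extChartAt 𝓘(ℝ, E) x₀ (m t))) t := by
  have h := (mdifferentiableAt_extChartAt (I := 𝓘(ℝ, E)) (x := x₀)
    (by simpa using ht)).hasMFDerivAt.comp t hm
  rw [hasDerivAt_iff_hasFDerivAt]
  refine h.hasFDerivAt.congr_fderiv ?_
  rw [chartField_apply Y x₀ ht]
  ext
  refine Eq.trans ?_ (one_smul ℝ _).symm
  exact congrArg (mfderiv 𝓘(ℝ, E) 𝓘(ℝ, E) (extChartAt 𝓘(ℝ, E) x₀) (m t))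
    (one_smul ℝ (Y (m t)))

/-- A solution of the differential equation given by a vector field in a chart is an integral
curve. -/
theorem hasMFDerivAt_of_hasDerivAt_chart {γ : ℝ → E} {t : ℝ} {x₀ : M}
    (hγ : HasDerivAt γ (chartField x₀ Y (γ t)) t)
    (ht : γ t ∈ (extChartAt 𝓘(ℝ, E) x₀).target) :
    HasMFDerivAt 𝓘(ℝ, ℝ) 𝓘(ℝ, E) (fun s ↦ (extChartAt 𝓘(ℝ, E) x₀).symm (γ s)) t
      ((1 : ℝ →L[ℝ] ℝ).smulRight (Y ((extChartAt 𝓘(ℝ, E) x₀).symm (γ t)))) := by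
  have hs : MDifferentiableAt 𝓘(ℝ, E) 𝓘(ℝ, E) (extChartAt 𝓘(ℝ, E) x₀).symm (γ t) :=
    ((contMDiffOn_extChartAt_symm (I := 𝓘(ℝ, E)) (n := ∞) x₀).contMDiffAt
      ((isOpen_extChartAt_target x₀).mem_nhds ht)).mdifferentiableAt (by simp)
  have h := hs.hasMFDerivAt.comp t hγ.hasFDerivAt.hasMFDerivAt
  refine h.congr_mfderiv ?_
  have hy := (extChartAt 𝓘(ℝ, E) x₀).map_target ht
  have hcf := chartField_apply Y x₀ hy
  rw [(extChartAt 𝓘(ℝ, E) x₀).right_inv ht] at hcf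
  have hinv := mfderivWithin_extChartAt_symm_comp_mfderiv_extChartAt' (I := 𝓘(ℝ, E)) hy
  rw [(extChartAt 𝓘(ℝ, E) x₀).right_inv ht, ModelWithCorners.range_eq_univ,
    mfderivWithin_univ] at hinv
  ext
  change mfderiv 𝓘(ℝ, E) 𝓘(ℝ, E) (extChartAt 𝓘(ℝ, E) x₀).symm (γ t)
    ((1 : ℝ) • chartField x₀ Y (γ t)) = (1 : ℝ) • Y _
  rw [one_smul, one_smul, hcf]
  exact congr($hinv (Y _))

/-- Integral curves of smooth vector fields are smooth. -/
theorem contMDiffAt_of_isMIntegralCurveAt {m : ℝ → M} {t : ℝ}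
    (hm : IsMIntegralCurveAt m (fun y ↦ Y y) t) : ContMDiffAt 𝓘(ℝ, ℝ) 𝓘(ℝ, E) ∞ m t := by
  have hsrc : ∀ᶠ s in 𝓝 t, m s ∈ (extChartAt 𝓘(ℝ, E) (m t)).source :=
    hm.continuousAt.eventually (extChartAt_source_mem_nhds (I := 𝓘(ℝ, E)) (m t))
  have h := contDiffAt_of_ode (isOpen_extChartAt_target (I := 𝓘(ℝ, E)) (m t))
    (γ := fun s ↦ extChartAt 𝓘(ℝ, E) (m t) (m s)) (t₀ := t) (mem_extChartAt_target (m t))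
    (contDiffOn_chartField Y (m t)) (by
      filter_upwards [hsrc, hm] with s hs hms
      exact hasDerivAt_chart_of_hasMFDerivAt Y hms hs)
  have h2 := ((contMDiffOn_extChartAt_symm (I := 𝓘(ℝ, E)) (n := ∞) (m t)).contMDiffAt
    ((isOpen_extChartAt_target (m t)).mem_nhds (mem_extChartAt_target (m t)))).comp t
      (f := fun s ↦ extChartAt 𝓘(ℝ, E) (m t) (m s)) h.contMDiffAt
  refine h2.congr_of_eventuallyEq ?_
  filter_upwards [hsrc] with s hs
  exact ((extChartAt 𝓘(ℝ, E) (m t)).left_inv hs).symm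

end ChartField

/-! ### The covariant derivative along a path -/

section Geodesics

variable {E : Type*} [NormedAddCommGroup E] [NormedSpace ℝ E] [FiniteDimensional ℝ E]
  {M : Type*} [TopologicalSpace M] [ChartedSpace E M] [IsManifold 𝓘(ℝ, E) ∞ M]
  {F : Type*} [NormedAddCommGroup F] [NormedSpace ℝ F]
  {V : M → Type*} [TopologicalSpace (TotalSpace F V)]
  [∀ x, AddCommGroup (V x)] [∀ x, Module ℝ (V x)] [∀ x, TopologicalSpace (V x)]
  [∀ x, IsTopologicalAddGroup (V x)] [∀ x, ContinuousSMul ℝ (V x)]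
  [FiberBundle F V] [VectorBundle ℝ F V] [ContMDiffVectorBundle ∞ F V 𝓘(ℝ, E)]

/-- The vector field `# S` of a section `S`. -/
def anchorField (A : LieAlgebroid E F V) :
    Cₛ^∞⟮𝓘(ℝ, E); F, V⟯ →ₗ[ℝ] Cₛ^∞⟮𝓘(ℝ, E); E, (TangentSpace 𝓘(ℝ, E) : M → Type _)⟯ where
  toFun S := ⟨fun y ↦ A.anchor y (S y), ContMDiff.clm_bundle_apply A.contMDiff_anchor S.contMDiff⟩
  map_add' _ _ := ContMDiffSection.ext fun y ↦ map_add (A.anchor y) _ _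
  map_smul' _ _ := ContMDiffSection.ext fun y ↦ map_smul (A.anchor y) _ _

@[simp]
theorem anchorField_apply (A : LieAlgebroid E F V) (S : Cₛ^∞⟮𝓘(ℝ, E); F, V⟯) (y : M) :
    anchorField A S y = A.anchor y (S y) := rfl

variable {A : LieAlgebroid E F V} {cov : CovariantDerivative 𝓘(ℝ, E) F V}

variable (cov) in
-- `FiberBundle.extend` is constant in the trivialization near `x`, so this is the Leibniz rule. The
-- right-hand side has the shape of `covDerivAlongWithin`, which lets derivatives of paths be
-- compared with derivatives of sections.
theorem cov_eq_trivialization [T2Space M] [FiniteDimensional ℝ F] (S : Cₛ^∞⟮𝓘(ℝ, E); F, V⟯)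
    (x : M) (w : TangentSpace 𝓘(ℝ, E) x) :
    cov S x w = (trivializationAt F V x).symm x
      (mvfderiv 𝓘(ℝ, E) (fun y ↦ (trivializationAt F V x ⟨y, S y⟩).2) x w) +
      cov (FiberBundle.extend F (S x)) x w := by
  let e := trivializationAt F V x
  have hx : x ∈ e.baseSet := mem_baseSet_trivializationAt F V x
  have hbase : ∀ᶠ y in 𝓝 x, y ∈ e.baseSet := e.open_baseSet.mem_nhds hx
  obtain ⟨S₀, hS₀⟩ := exists_linear_sections (E := E) (fun y ↦ e.symmₗ ℝ y) (x₀ := x) (fun u ↦ by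
    filter_upwards [hbase] with y hy
    rw [e.contMDiffAt_section_iff hy]
    refine (contMDiffAt_const (c := u)).congr_of_eventuallyEq ?_
    filter_upwards [e.open_baseSet.mem_nhds hy] with z hz
    rw [Trivialization.symmₗ_apply _ hz, e.apply_mk_symm hz])
  have hd : MDifferentiableAt 𝓘(ℝ, E) 𝓘(ℝ, F) (fun y ↦ (e ⟨y, S y⟩).2) x :=
    ((e.contMDiffAt_section_iff hx).1 S.contMDiff.contMDiffAt).mdifferentiableAt (by simp)
  have h1 := cov_linear_family cov S₀ hd S.mdifferentiableAt (by
    filter_upwards [hbase, hS₀] with y hy hy'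
    rw [hy', Trivialization.symmₗ_apply _ hy]
    exact (e.symm_apply_apply_mk hy (S y)).symm) w
  have h2 : cov (FiberBundle.extend F (S x)) x = cov (S₀ (e ⟨x, S x⟩).2) x := by
    refine cov_congr cov (FiberBundle.mdifferentiableAt_extend ..) (S₀ _).mdifferentiableAt ?_
    filter_upwards [hbase, hS₀] with y hy hy'
    rw [hy', Trivialization.symmₗ_apply _ hy]
    rfl
  rw [h1, h2, add_comm, hS₀.self_of_nhds, Trivialization.symmₗ_apply _ hx]

variable [T2Space M] [FiniteDimensional ℝ F]

/-- The covariant derivative along a path, in a parallel frame. -/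
theorem FlatFrame.covDerivAlongWithin_eq (B : FlatFrame cov) {J : Set ℝ} {X : ℝ → TotalSpace F V}
    {t : ℝ} (hJ : J ∈ 𝓝 t) (hX : ContMDiffAt 𝓘(ℝ, ℝ) (𝓘(ℝ, E).prod 𝓘(ℝ, F)) ∞ X t)
    (ht : (X t).proj ∈ B.dom) :
    covDerivAlongWithin cov J X t =
      B.sec (deriv (fun s ↦ B.coord (X s)) t) (X t).proj := by
  let e := trivializationAt F V (X t).proj
  let m : ℝ → M := fun s ↦ (X s).proj
  let a : ℝ → F := fun s ↦ B.coord (X s)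
  let b := Module.finBasis ℝ F
  let c : Fin (Module.finrank ℝ F) → F →L[ℝ] ℝ := fun i ↦ (b.coord i).toContinuousLinearMap
  have hsum : ∀ (u : F), u = ∑ i, c i u • b i := fun u ↦ (b.sum_repr u).symm
  have hx : m t ∈ e.baseSet := mem_baseSet_trivializationAt F V (X t).proj
  have hm : ContMDiffAt 𝓘(ℝ, ℝ) 𝓘(ℝ, E) ∞ m t := (contMDiffAt_proj V).comp t hX
  have hmd : MDifferentiableAt 𝓘(ℝ, ℝ) 𝓘(ℝ, E) m t := hm.mdifferentiableAt (by simp)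
  have ha : DifferentiableAt ℝ a t :=
    (((B.contMDiffAt_coord (X t) ht).comp t hX).contDiffAt).differentiableAt (by simp)
  have hg : ∀ u, MDifferentiableAt 𝓘(ℝ, E) 𝓘(ℝ, F) (fun y ↦ (e ⟨y, B.sec u y⟩).2) (m t) :=
    fun u ↦ ((e.contMDiffAt_section_iff hx).1
      (B.sec u).contMDiff.contMDiffAt).mdifferentiableAt (by simp)
  have hgm : ∀ u, HasDerivAt (fun s ↦ (e ⟨m s, B.sec u (m s)⟩).2)
      (mvfderiv 𝓘(ℝ, E) (fun y ↦ (e ⟨y, B.sec u y⟩).2) (m t)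
        (mfderiv 𝓘(ℝ, ℝ) 𝓘(ℝ, E) m t (1 : ℝ))) t := by
    intro u
    rw [hasDerivAt_iff_hasFDerivAt]
    have h := (hg u).hasMFDerivAt.comp t hmd.hasMFDerivAt
    refine h.hasFDerivAt.congr_fderiv ?_
    ext
    exact (one_smul ℝ _).symm
  -- Write `X s` as the frame section with frozen coordinates `a t` plus the one with coordinates `a
  -- s - a t`. The latter vanish at `t`, so only their derivative contributes, not that of the
  -- frame.
  have hu : HasDerivAt (fun s ↦ (e (X s)).2)
      (mvfderiv 𝓘(ℝ, E) (fun y ↦ (e ⟨y, B.sec (a t) y⟩).2) (m t)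
        (mfderiv 𝓘(ℝ, ℝ) 𝓘(ℝ, E) m t (1 : ℝ)) + (e ⟨m t, B.sec (deriv a t) (m t)⟩).2) t := by
    have h2 : HasDerivAt (fun s ↦ ∑ i, (c i (a s - a t)) • (e ⟨m s, B.sec (b i) (m s)⟩).2)
        (e ⟨m t, B.sec (deriv a t) (m t)⟩).2 t := by
      have hc : ∀ i, HasDerivAt (fun s ↦ c i (a s - a t)) (c i (deriv a t)) t := fun i ↦
        (c i).hasFDerivAt.comp_hasDerivAt t (ha.hasDerivAt.sub_const (a t))
      refine (HasDerivAt.fun_sum fun i _ ↦ (hc i).smul (hgm (b i))).congr_deriv ?_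
      have hL : ∀ v, (e ⟨m t, v⟩).2 = e.continuousLinearMapAt ℝ (m t) v := fun v ↦ by
        rw [Trivialization.continuousLinearMapAt_apply, Trivialization.linearMapAt_apply, if_pos hx]
      conv_rhs => rw [hL, hsum (deriv a t)]
      simp only [sub_self, map_zero, zero_smul, zero_add, hL]
      have : B.sec (∑ i, c i (deriv a t) • b i) (m t) =
          ∑ i, c i (deriv a t) • B.sec (b i) (m t) := by
        change evalSection (m t) (B.sec _) = _
        simp
      rw [this, map_sum]
      simp
    refine ((hgm (a t)).add h2).congr_of_eventuallyEq ?_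
    filter_upwards [hm.continuousAt.eventually (e.open_baseSet.mem_nhds hx),
      hm.continuousAt.eventually (B.isOpen_dom.mem_nhds ht)] with s hs hs'
    have hL : ∀ v, (e ⟨m s, v⟩).2 = e.continuousLinearMapAt ℝ (m s) v := fun v ↦ by
      rw [Trivialization.continuousLinearMapAt_apply, Trivialization.linearMapAt_apply,
        if_pos (show m s ∈ e.baseSet from hs)]
    have hXs : (e (X s)).2 = e.continuousLinearMapAt ℝ (m s) (B.sec (a s) (m s)) := by
      rw [← hL, B.sec_coord (X s) hs']
    simp only [Pi.add_apply]
    rw [hXs]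
    simp only [hL, ← map_smul, ← map_sum, ← map_add]
    congr 1
    change evalSection (m s) (B.sec (a s)) = evalSection (m s) (B.sec (a t)) +
      ∑ i, c i (a s - a t) • evalSection (m s) (B.sec (b i))
    simp only [← map_smul, ← map_sum, ← map_add, ← hsum]
    rw [add_sub_cancel]
  have hval : B.sec (a t) (m t) = (X t).2 := B.sec_coord (X t) ht
  -- The section with frozen coordinates is parallel, so its contribution cancels against the
  -- connection term.
  have key := cov_eq_trivialization cov (B.sec (a t)) (m t)
    (mfderiv 𝓘(ℝ, ℝ) 𝓘(ℝ, E) m t (1 : ℝ))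
  rw [B.cov_sec (m t) ht, hval] at key
  rw [covDerivAlongWithin, velocityWithin, mfderivWithin_of_mem_nhds hJ, derivWithin_of_mem_nhds hJ,
    hu.deriv]
  have hadd : ∀ u v, e.symm (m t) (u + v) = e.symm (m t) u + e.symm (m t) v := fun u v ↦ by
    simp only [← Trivialization.symmₗ_apply (R := ℝ) e hx, map_add]
  refine (congrArg₂ (· + ·) ((hadd _ _).trans (congrArg₂ (· + ·) rfl
    (e.symm_apply_apply_mk hx _))) rfl).trans ?_
  rw [add_right_comm]
  refine (congrArg₂ (· + ·) key.symm rfl).trans ?_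
  rw [zero_apply, zero_add]

end Geodesics

/-! ### Local existence and uniqueness of geodesics -/

section LocalGeodesics

variable {E : Type*} [NormedAddCommGroup E] [NormedSpace ℝ E] [FiniteDimensional ℝ E]
  {M : Type*} [TopologicalSpace M] [ChartedSpace E M] [IsManifold 𝓘(ℝ, E) ∞ M]
  {F : Type*} [NormedAddCommGroup F] [NormedSpace ℝ F]
  {V : M → Type*} [TopologicalSpace (TotalSpace F V)]
  [∀ x, AddCommGroup (V x)] [∀ x, Module ℝ (V x)] [∀ x, TopologicalSpace (V x)]
  [∀ x, IsTopologicalAddGroup (V x)] [∀ x, ContinuousSMul ℝ (V x)]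
  [FiberBundle F V] [VectorBundle ℝ F V] [ContMDiffVectorBundle ∞ F V 𝓘(ℝ, E)]
  [T2Space M]

/-- Two vectors that cannot be separated have the same footprint, since the base is Hausdorff. They
then lie in one trivialization, which is injective and continuous with Hausdorff target. -/
theorem t2Space_totalSpace {B F : Type*} {V : B → Type*} [TopologicalSpace B] [T2Space B]
    [TopologicalSpace F] [T2Space F] [TopologicalSpace (TotalSpace F V)]
    [∀ x, TopologicalSpace (V x)] [FiberBundle F V] : T2Space (TotalSpace F V) := by
  rw [t2_iff_nhds]
  intro v w h
  have hp : v.proj = w.proj := by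
    refine tendsto_nhds_unique (l := 𝓝 v ⊓ 𝓝 w) (f := TotalSpace.proj) ?_ ?_
    · exact ((FiberBundle.continuous_proj F V).tendsto v).mono_left inf_le_left
    · exact ((FiberBundle.continuous_proj F V).tendsto w).mono_left inf_le_right
  let e := trivializationAt F V v.proj
  have hv : v ∈ e.source := e.mem_source.2 (mem_baseSet_trivializationAt F V v.proj)
  have hw : w ∈ e.source := e.mem_source.2 (hp ▸ mem_baseSet_trivializationAt F V v.proj)
  refine e.injOn hv hw (tendsto_nhds_unique (l := 𝓝 v ⊓ 𝓝 w) (f := e) ?_ ?_)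
  · exact (e.continuousAt hv).tendsto.mono_left inf_le_left
  · exact (e.continuousAt hw).tendsto.mono_left inf_le_right

/-- A path is a geodesic near a time if it is the restriction of a parallel section `S` to an
integral curve of `# S` near that time. -/
def IsGeodesicAt (A : LieAlgebroid E F V) (cov : CovariantDerivative 𝓘(ℝ, E) F V)
    (X : ℝ → TotalSpace F V) (t : ℝ) : Prop :=
  ∃ S : Cₛ^∞⟮𝓘(ℝ, E); F, V⟯, (∀ᶠ y in 𝓝 (X t).proj, cov S y = 0) ∧
    (∀ᶠ s in 𝓝 t, X s = ⟨(X s).proj, S (X s).proj⟩) ∧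
    IsMIntegralCurveAt (fun s ↦ (X s).proj) (fun y ↦ anchorField A S y) t

variable {A : LieAlgebroid E F V} {cov : CovariantDerivative 𝓘(ℝ, E) F V} {X Y : ℝ → TotalSpace F V}
  {t : ℝ}

namespace IsGeodesicAt

theorem congr (h : IsGeodesicAt A cov X t) (hXY : ∀ᶠ s in 𝓝 t, X s = Y s) :
    IsGeodesicAt A cov Y t := by
  obtain ⟨S, h1, h2, h3⟩ := h
  have ht := hXY.self_of_nhds
  refine ⟨S, by rwa [← ht], ?_, ?_⟩
  · filter_upwards [h2, hXY] with s a b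
    rwa [← b]
  · filter_upwards [h3, hXY.eventually_nhds] with s a b
    rw [← b.self_of_nhds]
    exact a.congr_of_eventuallyEq (by
      filter_upwards [b] with r hr
      rw [hr])

theorem comp_add (c : ℝ) (h : IsGeodesicAt A cov X (t + c)) :
    IsGeodesicAt A cov (fun s ↦ X (s + c)) t := by
  obtain ⟨S, h1, h2, h3⟩ := h
  refine ⟨S, h1, ?_, ?_⟩
  · exact ((continuous_add_const c).tendsto t).eventually h2
  · have := h3.comp_add c
    rwa [add_sub_cancel_right] at this

theorem contMDiffAt (h : IsGeodesicAt A cov X t) :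
    ContMDiffAt 𝓘(ℝ, ℝ) (𝓘(ℝ, E).prod 𝓘(ℝ, F)) ∞ X t := by
  obtain ⟨S, h1, h2, h3⟩ := h
  have hm := contMDiffAt_of_isMIntegralCurveAt (anchorField A S) h3
  exact ((S.contMDiff.contMDiffAt).comp t hm).congr_of_eventuallyEq h2

theorem continuousAt (h : IsGeodesicAt A cov X t) : ContinuousAt X t :=
  h.contMDiffAt.continuousAt

variable [FiniteDimensional ℝ F]

/-- Geodesics are locally determined by their value at one time. -/
theorem eventuallyEq [CovariantDerivative.ContMDiffCovariantDerivative cov ∞] (hflat : IsFlat cov)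
    (hX : IsGeodesicAt A cov X t) (hY : IsGeodesicAt A cov Y t) (h : X t = Y t) :
    ∀ᶠ s in 𝓝 t, X s = Y s := by
  obtain ⟨S, h1, h2, h3⟩ := hX
  obtain ⟨T, k1, k2, k3⟩ := hY
  have hp : (X t).proj = (Y t).proj := by rw [h]
  -- Equal values force equal germs of parallel sections; then both footprints are integral curves
  -- of one vector field.
  have hST : ∀ᶠ y in 𝓝 (X t).proj, S y = T y := by
    refine eventuallyEq_of_parallel hflat h1 (by rwa [hp]) ?_
    have e1 := h2.self_of_nhds
    have e2 := k2.self_of_nhds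
    rw [← h] at e2
    have e3 := e1.symm.trans e2
    simpa using e3
  have k3' : IsMIntegralCurveAt (fun s ↦ (Y s).proj) (fun y ↦ anchorField A S y) t := by
    filter_upwards [k3, k3.continuousAt.eventually (hp ▸ hST)] with s a b
    have : anchorField A S (Y s).proj = anchorField A T (Y s).proj := by
      rw [anchorField_apply, anchorField_apply, b]
    rwa [this]
  have : IsManifold 𝓘(ℝ, E) 1 M := IsManifold.of_le (n := ∞) ENat.LEInfty.out
  have : CompleteSpace E := FiniteDimensional.complete ℝ E
  have hm := isMIntegralCurveAt_eventuallyEq_of_contMDiffAt_boundaryless (I := 𝓘(ℝ, E))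
    (((anchorField A S).contMDiff.contMDiffAt).of_le ENat.LEInfty.out) h3 k3' hp
  filter_upwards [hm, h2, k2, h3.continuousAt.eventually hST] with s a b c d
  have a' : (X s).proj = (Y s).proj := a
  rw [b, c, ← a', d]

end IsGeodesicAt

/-- Geodesics on a connected open set of times are determined by their value at one time. -/
theorem eqOn_of_isGeodesicAt [FiniteDimensional ℝ F]
    [CovariantDerivative.ContMDiffCovariantDerivative cov ∞] (hflat : IsFlat cov) {J : Set ℝ}
    (hJ : IsOpen J) (hJc : IsPreconnected J) (hX : ∀ t ∈ J, IsGeodesicAt A cov X t)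
    (hY : ∀ t ∈ J, IsGeodesicAt A cov Y t) (ht : t ∈ J) (h : X t = Y t) : EqOn X Y J := by
  have := t2Space_totalSpace (F := F) (V := V)
  let u : Set ℝ := {s | s ∈ J ∧ X s = Y s}
  have hu : IsOpen u := by
    rw [isOpen_iff_mem_nhds]
    rintro s ⟨hs, hs'⟩
    filter_upwards [hJ.mem_nhds hs, (hX s hs).eventuallyEq hflat (hY s hs) hs'] with r a b
    exact ⟨a, b⟩
  -- The agreement set is open by local uniqueness and relatively closed in `J` by continuity.
  have hsub : J ⊆ u := by
    refine hJc.subset_of_closure_inter_subset hu ⟨t, ht, ht, h⟩ ?_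
    rintro s ⟨hs, hsJ⟩
    refine ⟨hsJ, ?_⟩
    have : NeBot (nhdsWithin s u) := mem_closure_iff_nhdsWithin_neBot.1 hs
    refine tendsto_nhds_unique_of_eventuallyEq (l := nhdsWithin s u)
      ((hX s hsJ).continuousAt.tendsto.mono_left nhdsWithin_le_nhds)
      ((hY s hsJ).continuousAt.tendsto.mono_left nhdsWithin_le_nhds) ?_
    filter_upwards [self_mem_nhdsWithin] with r hr
    exact hr.2
  exact fun s hs ↦ (hsub hs).2

/-- At interior times, geodesics are restrictions of parallel sections. -/
theorem IsGeodesicOn.isGeodesicAt [FiniteDimensional ℝ F]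
    [CovariantDerivative.ContMDiffCovariantDerivative cov ∞] (hflat : IsFlat cov) {J : Set ℝ}
    (hX : IsGeodesicOn A cov J X) (ht : J ∈ 𝓝 t) : IsGeodesicAt A cov X t := by
  obtain ⟨B, hB⟩ := exists_flatFrame cov hflat (X t).proj
  have hsm : ∀ s, J ∈ 𝓝 s → ContMDiffAt 𝓘(ℝ, ℝ) (𝓘(ℝ, E).prod 𝓘(ℝ, F)) ∞ X s :=
    fun s hs ↦ (hX.contMDiffOn s (mem_of_mem_nhds hs)).contMDiffAt hs
  have hm : ∀ s, J ∈ 𝓝 s → ContMDiffAt 𝓘(ℝ, ℝ) 𝓘(ℝ, E) ∞ (fun s ↦ (X s).proj) s :=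
    fun s hs ↦ (contMDiffAt_proj V).comp s (hsm s hs)
  have hdom : ∀ᶠ s in 𝓝 t, J ∈ 𝓝 s ∧ (X s).proj ∈ B.dom :=
    (eventually_eventually_nhds.2 ht).and
      ((hm t ht).continuousAt.eventually (B.isOpen_dom.mem_nhds hB))
  have hconst : ∀ᶠ s in 𝓝 t, B.coord (X s) = B.coord (X t) := by
    refine eventually_const_of_mvfderiv_eq_zero (E := ℝ) (a := fun s ↦ B.coord (X s)) ?_
    filter_upwards [hdom] with s hs
    have hd : ContMDiffAt 𝓘(ℝ, ℝ) 𝓘(ℝ, F) ∞ (fun s ↦ B.coord (X s)) s :=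
      (B.contMDiffAt_coord (X s) hs.2).comp s (hsm s hs.1)
    refine ⟨hd.mdifferentiableAt (by simp), ?_⟩
    have h1 := B.covDerivAlongWithin_eq hs.1 (hsm s hs.1) hs.2
    rw [hX.parallel s (mem_of_mem_nhds hs.1)] at h1
    have h2 := B.eq_zero_of_sec_eq_zero hs.2 h1.symm
    have h3 : HasFDerivAt (fun s ↦ B.coord (X s)) (0 : ℝ →L[ℝ] F) s := by
      have := (hd.contDiffAt.differentiableAt (by simp)).hasDerivAt
      rw [h2] at this
      simpa using this.hasFDerivAt
    exact h3.hasMFDerivAt.mfderiv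
  have hval : ∀ᶠ s in 𝓝 t, X s = ⟨(X s).proj, B.sec (B.coord (X t)) (X s).proj⟩ := by
    filter_upwards [hdom, hconst] with s hs hs'
    rw [← hs', B.sec_coord _ hs.2]
  refine ⟨B.sec (B.coord (X t)), B.eventually_cov_sec hB _, hval, ?_⟩
  filter_upwards [hdom, hconst] with s hs hs'
  have h1 := hX.anchor_eq s (mem_of_mem_nhds hs.1)
  rw [velocityWithin, mfderivWithin_of_mem_nhds hs.1] at h1
  refine ((hm s hs.1).mdifferentiableAt (by simp)).hasMFDerivAt.congr_mfderiv ?_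
  ext
  refine h1.symm.trans (Eq.trans ?_ (one_smul ℝ _).symm)
  rw [anchorField_apply, ← hs', B.sec_coord _ hs.2]

/-- A path that is everywhere a local geodesic is a geodesic. -/
theorem isGeodesicOn_univ [FiniteDimensional ℝ F]
    [CovariantDerivative.ContMDiffCovariantDerivative cov ∞] (hflat : IsFlat cov)
    (hX : ∀ t, IsGeodesicAt A cov X t) : IsGeodesicOn A cov univ X := by
  refine ⟨fun t _ ↦ (hX t).contMDiffAt.contMDiffWithinAt, fun t _ ↦ ?_, fun t _ ↦ ?_⟩
  · obtain ⟨S, h1, h2, h3⟩ := hX t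
    rw [velocityWithin, mfderivWithin_univ, h3.hasMFDerivAt.mfderiv]
    refine Eq.trans ?_ (one_smul ℝ _).symm
    rw [anchorField_apply]
    congr 1
    have h : ∀ v : TotalSpace F V, v = ⟨v.proj, S v.proj⟩ → v.2 = S v.proj := by
      rintro ⟨x, u⟩ hv
      simpa using hv
    exact h _ h2.self_of_nhds
  · obtain ⟨B, hB⟩ := exists_flatFrame cov hflat (X t).proj
    rw [B.covDerivAlongWithin_eq univ_mem (hX t).contMDiffAt hB]
    obtain ⟨S, h1, h2, h3⟩ := hX t
    have : ∀ᶠ s in 𝓝 t, B.coord (X s) = B.coord ⟨(X t).proj, S (X t).proj⟩ := by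
      filter_upwards [h2, h3.continuousAt.eventually (B.eventually_eq_sec hB h1),
        h3.continuousAt.eventually (B.isOpen_dom.mem_nhds hB)] with s a b c
      rw [a, b, B.coord_sec _ c]
    rw [Filter.EventuallyEq.deriv_eq this, deriv_const, map_zero]
    rfl

/-- Existence of geodesics, with a time of existence that is locally uniform in the initial
value. -/
theorem exists_isGeodesicAt [FiniteDimensional ℝ F]
    [CovariantDerivative.ContMDiffCovariantDerivative cov ∞] (A : LieAlgebroid E F V)
    (hflat : IsFlat cov) (v₀ : TotalSpace F V) :
    ∃ ε > 0, ∀ᶠ v in 𝓝 v₀, ∃ X : ℝ → TotalSpace F V, X 0 = v ∧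
      ∀ t ∈ Ioo (-ε) ε, IsGeodesicAt A cov X t := by
  have : CompleteSpace E := FiniteDimensional.complete ℝ E
  obtain ⟨B, hB⟩ := exists_flatFrame cov hflat v₀.proj
  let x₀ := v₀.proj
  let φ := extChartAt 𝓘(ℝ, E) x₀
  let b := Module.finBasis ℝ F
  let c : Fin (Module.finrank ℝ F) → F →L[ℝ] ℝ := fun i ↦ (b.coord i).toContinuousLinearMap
  have hsum : ∀ (u : F), u = ∑ i, c i u • b i := fun u ↦ (b.sum_repr u).symm
  -- The vector field `#` of a frame section depends linearly on the frame coordinates, so it is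
  -- smooth jointly in coordinates and position. The coordinates of the initial vector can therefore
  -- serve as the parameter of the flow.
  let w : F → E → E := fun a ↦ chartField x₀ (anchorField A (B.sec a))
  have hw : ContDiffAt ℝ 1 (fun p : F × E ↦ w p.1 p.2) (B.coord v₀, φ x₀) := by
    have e : (fun p : F × E ↦ w p.1 p.2) =
        fun p ↦ ∑ i, c i p.1 • w (b i) p.2 := by
      funext p
      have : w p.1 = ∑ i, c i p.1 • w (b i) := by
        simp only [w, ← map_smul, ← map_sum, ← hsum]
      rw [this]
      simp
    rw [e]
    refine ContDiffAt.sum fun i _ ↦ ContDiffAt.smul ?_ ?_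
    · exact (c i).contDiff.contDiffAt.comp _ contDiffAt_fst
    · have h := ((contDiffOn_chartField (anchorField A (B.sec (b i))) x₀).contDiffAt
        (extChartAt_target_mem_nhds (I := 𝓘(ℝ, E)) x₀)).of_le (m := 1) ENat.LEInfty.out
      exact ContDiffAt.comp (B.coord v₀, φ x₀) h contDiffAt_snd
  have hc : Tendsto φ.symm (𝓝 (φ x₀)) (𝓝 x₀) := by
    have h := continuousAt_extChartAt_symm (I := 𝓘(ℝ, E)) x₀
    rwa [ContinuousAt, extChartAt_to_inv x₀] at h
  have hS : φ.target ∩ φ.symm ⁻¹' B.dom ∈ 𝓝 (φ x₀) :=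
    inter_mem (extChartAt_target_mem_nhds x₀) (hc.eventually (B.isOpen_dom.mem_nhds hB))
  obtain ⟨ε, hε, hflow⟩ := exists_uniform_flow_param hw hS
  have hpc : Tendsto (fun v : TotalSpace F V ↦ v.proj) (𝓝 v₀) (𝓝 x₀) :=
    (FiberBundle.continuous_proj F V).tendsto v₀
  have hlim : Tendsto (fun v ↦ (B.coord v, φ v.proj)) (𝓝 v₀) (𝓝 (B.coord v₀, φ x₀)) :=
    (B.contMDiffAt_coord v₀ hB).continuousAt.prodMk_nhds
      ((continuousAt_extChartAt (I := 𝓘(ℝ, E)) x₀).tendsto.comp hpc)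
  refine ⟨ε, hε, ?_⟩
  filter_upwards [hlim.eventually hflow, hpc.eventually (B.isOpen_dom.mem_nhds hB),
    hpc.eventually (extChartAt_source_mem_nhds (I := 𝓘(ℝ, E)) x₀)] with v hv hvB hvs
  obtain ⟨γ, hγ₀, hγ⟩ := hv
  refine ⟨fun s ↦ ⟨φ.symm (γ s), B.sec (B.coord v) (φ.symm (γ s))⟩, ?_, fun t ht ↦ ?_⟩
  · beta_reduce
    rw [hγ₀]
    rw [φ.left_inv hvs, B.sec_coord v hvB]
  · refine ⟨B.sec (B.coord v), B.eventually_cov_sec (hγ t ht).2.2 _,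
      Eventually.of_forall fun s ↦ rfl, ?_⟩
    filter_upwards [isOpen_Ioo.mem_nhds ht] with s hs
    exact hasMFDerivAt_of_hasDerivAt_chart (anchorField A (B.sec (B.coord v))) (hγ s hs).1
      (hγ s hs).2.1

end LocalGeodesics

/-! ### Continuation of geodesics -/

section Extension

variable {E : Type*} [NormedAddCommGroup E] [NormedSpace ℝ E] [FiniteDimensional ℝ E]
  {M : Type*} [TopologicalSpace M] [ChartedSpace E M] [IsManifold 𝓘(ℝ, E) ∞ M]
  {F : Type*} [NormedAddCommGroup F] [NormedSpace ℝ F]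
  {V : M → Type*} [TopologicalSpace (TotalSpace F V)]
  [∀ x, AddCommGroup (V x)] [∀ x, Module ℝ (V x)] [∀ x, TopologicalSpace (V x)]
  [∀ x, IsTopologicalAddGroup (V x)] [∀ x, ContinuousSMul ℝ (V x)]
  [FiberBundle F V] [VectorBundle ℝ F V] [ContMDiffVectorBundle ∞ F V 𝓘(ℝ, E)]
  [T2Space M] [FiniteDimensional ℝ F]
  {A : LieAlgebroid E F V} {cov : CovariantDerivative 𝓘(ℝ, E) F V}
  [CovariantDerivative.ContMDiffCovariantDerivative cov ∞]

/-- Two geodesics that agree at a time can be glued at this time. -/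
theorem IsGeodesicAt.glue (hflat : IsFlat cov) {X Y : ℝ → TotalSpace F V} {a b c d t₁ : ℝ}
    (hX : ∀ t ∈ Ioo a b, IsGeodesicAt A cov X t) (hY : ∀ t ∈ Ioo c d, IsGeodesicAt A cov Y t)
    (h₁ : t₁ ∈ Ioo a b) (h₂ : t₁ ∈ Ioo c d) (h : X t₁ = Y t₁) :
    ∀ t ∈ Ioo a d, IsGeodesicAt A cov (fun t ↦ if t ≤ t₁ then X t else Y t) t := by
  intro t ht
  rcases lt_trichotomy t t₁ with hlt | rfl | hgt
  · refine (hX t ⟨ht.1, hlt.trans h₁.2⟩).congr ?_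
    filter_upwards [Iio_mem_nhds hlt] with s hs
    rw [if_pos (le_of_lt hs)]
  · refine (hX t h₁).congr ?_
    filter_upwards [(hX t h₁).eventuallyEq hflat (hY t h₂) h] with s hs
    split_ifs
    · rfl
    · exact hs
  · refine (hY t ⟨h₂.1.trans hgt, ht.2⟩).congr ?_
    filter_upwards [Ioi_mem_nhds hgt] with s hs
    rw [if_neg (not_le.2 hs)]

/-- Geodesics with the same initial value combine to a single one. -/
theorem exists_isGeodesicAt_of_forall (hflat : IsFlat cov) (v : TotalSpace F V) :
    ∃ Y : ℝ → TotalSpace F V, ∀ t, (∃ a, |t| < a ∧ ∃ Z : ℝ → TotalSpace F V, Z 0 = v ∧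
      ∀ s ∈ Ioo (-a) a, IsGeodesicAt A cov Z s) → IsGeodesicAt A cov Y t ∧ (t = 0 → Y t = v) := by
  classical
  let D : ℝ → Prop := fun t ↦ ∃ a, |t| < a ∧ ∃ Z : ℝ → TotalSpace F V, Z 0 = v ∧
    ∀ s ∈ Ioo (-a) a, IsGeodesicAt A cov Z s
  let Y : ℝ → TotalSpace F V := fun t ↦ if h : D t then h.choose_spec.2.choose t else v
  refine ⟨Y, fun t ht ↦ ?_⟩
  obtain ⟨a, hta, Z, hZ0, hZ⟩ := ht
  have hYZ : ∀ s ∈ Ioo (-a) a, Z s = Y s := by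
    intro s hs
    have hD : D s := ⟨a, abs_lt.2 hs, Z, hZ0, hZ⟩
    change Z s = dite (D s) _ _
    rw [dif_pos hD]
    obtain ⟨h1, h2⟩ := hD.choose_spec.2.choose_spec
    have hsb := hD.choose_spec.1
    set b := hD.choose
    set Z' := hD.choose_spec.2.choose
    have ha : 0 < a := (abs_nonneg t).trans_lt hta
    have hb : 0 < b := (abs_nonneg s).trans_lt hsb
    refine eqOn_of_isGeodesicAt hflat (J := Ioo (-a) a ∩ Ioo (-b) b) (t := 0)
      (isOpen_Ioo.inter isOpen_Ioo) (ordConnected_Ioo.inter ordConnected_Ioo).isPreconnected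
      (fun r hr ↦ hZ r hr.1) (fun r hr ↦ h2 r hr.2) ⟨⟨by linarith, ha⟩, ⟨by linarith, hb⟩⟩
      (hZ0.trans h1.symm) ⟨hs, abs_lt.1 hsb⟩
  refine ⟨(hZ t (abs_lt.1 hta)).congr ?_, ?_⟩
  · filter_upwards [isOpen_Ioo.mem_nhds (abs_lt.1 hta)] with s hs
    exact hYZ s hs
  · rintro rfl
    rw [← hYZ 0 (abs_lt.1 hta), hZ0]

/-- A geodesic on an open interval that has a cluster point at the right end extends beyond it. -/
theorem IsGeodesicAt.exists_extend_right (hflat : IsFlat cov) {X : ℝ → TotalSpace F V} {a b t₀ : ℝ}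
    (hX : ∀ t ∈ Ioo a b, IsGeodesicAt A cov X t) (ht₀ : t₀ ∈ Ioo a b)
    (hv : ∃ v, MapClusterPt v (𝓝[<] b) X) :
    ∃ δ > 0, ∃ Z : ℝ → TotalSpace F V, Z t₀ = X t₀ ∧
      ∀ t ∈ Ioo a (b + δ), IsGeodesicAt A cov Z t := by
  obtain ⟨v, hv⟩ := hv
  obtain ⟨ε, hε, hex⟩ := exists_isGeodesicAt A hflat v
  have hnear : ∀ᶠ s in 𝓝[<] b, s ∈ Ioo (max t₀ (b - ε / 2)) b :=
    Ioo_mem_nhdsLT (max_lt ht₀.2 (by linarith))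
  -- The existence time `ε` is uniform near the cluster point. Restarting at some `t₁ > b - ε / 2`
  -- with value near `v` carries the geodesic beyond `b + ε / 2`.
  obtain ⟨t₁, ⟨Z, hZ0, hZ⟩, h1, h2⟩ := ((hv.frequently hex).and_eventually hnear).exists
  have h3 := (le_max_left t₀ (b - ε / 2)).trans_lt h1
  have h4 := (le_max_right t₀ (b - ε / 2)).trans_lt h1
  have hZ' : ∀ t ∈ Ioo (t₁ - ε) (t₁ + ε), IsGeodesicAt A cov (fun s ↦ Z (s + (-t₁))) t := by
    intro t ht
    refine (hZ (t + (-t₁)) ⟨?_, ?_⟩).comp_add (-t₁)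
    · linarith [ht.1]
    · linarith [ht.2]
  have hg := IsGeodesicAt.glue hflat hX hZ' (t₁ := t₁) ⟨ht₀.1.trans h3, h2⟩
    ⟨by linarith, by linarith⟩ (by rw [add_neg_cancel, hZ0])
  refine ⟨ε / 2, by linarith, _, ?_, fun t ht ↦ hg t ⟨ht.1, by linarith [ht.2]⟩⟩
  rw [if_pos h3.le]

/-- A geodesic on an open interval that has a cluster point at the left end extends beyond it. -/
theorem IsGeodesicAt.exists_extend_left (hflat : IsFlat cov) {X : ℝ → TotalSpace F V} {a b t₀ : ℝ}
    (hX : ∀ t ∈ Ioo a b, IsGeodesicAt A cov X t) (ht₀ : t₀ ∈ Ioo a b)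
    (hv : ∃ v, MapClusterPt v (𝓝[>] a) X) :
    ∃ δ > 0, ∃ Z : ℝ → TotalSpace F V, Z t₀ = X t₀ ∧
      ∀ t ∈ Ioo (a - δ) b, IsGeodesicAt A cov Z t := by
  obtain ⟨v, hv⟩ := hv
  obtain ⟨ε, hε, hex⟩ := exists_isGeodesicAt A hflat v
  have hnear : ∀ᶠ s in 𝓝[>] a, s ∈ Ioo a (min t₀ (a + ε / 2)) :=
    Ioo_mem_nhdsGT (lt_min ht₀.1 (by linarith))
  obtain ⟨t₁, ⟨Z, hZ0, hZ⟩, h1, h2⟩ := ((hv.frequently hex).and_eventually hnear).exists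
  have h3 := h2.trans_le (min_le_left t₀ (a + ε / 2))
  have h4 := h2.trans_le (min_le_right t₀ (a + ε / 2))
  have hZ' : ∀ t ∈ Ioo (t₁ - ε) (t₁ + ε), IsGeodesicAt A cov (fun s ↦ Z (s + (-t₁))) t := by
    intro t ht
    refine (hZ (t + (-t₁)) ⟨?_, ?_⟩).comp_add (-t₁)
    · linarith [ht.1]
    · linarith [ht.2]
  -- At the left end the restarted geodesic is the earlier piece.
  have hg := IsGeodesicAt.glue hflat hZ' hX (t₁ := t₁) ⟨by linarith, by linarith⟩
    ⟨h1, h3.trans ht₀.2⟩ (by rw [add_neg_cancel, hZ0])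
  refine ⟨ε / 2, by linarith, _, ?_, fun t ht ↦ hg t ⟨by linarith [ht.1], ht.2⟩⟩
  rw [if_neg (not_le.2 h3)]

/-- If every geodesic on a bounded open interval has cluster points at both ends of the interval,
the connection is complete. -/
theorem isGeodesicallyComplete_of_mapClusterPt (hflat : IsFlat cov)
    (h : ∀ (a b : ℝ) (X : ℝ → TotalSpace F V), a < b → (∀ t ∈ Ioo a b, IsGeodesicAt A cov X t) →
      (∃ v, MapClusterPt v (𝓝[<] b) X) ∧ ∃ v, MapClusterPt v (𝓝[>] a) X) :
    IsGeodesicallyComplete A cov := by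
  have := t2Space_totalSpace (F := F) (V := V)
  have hall : ∀ v : TotalSpace F V, ∃ Y : ℝ → TotalSpace F V, Y 0 = v ∧
      ∀ t, IsGeodesicAt A cov Y t := by
    intro v
    let P : ℝ → Prop := fun a ↦ ∃ Z : ℝ → TotalSpace F V, Z 0 = v ∧
      ∀ s ∈ Ioo (-a) a, IsGeodesicAt A cov Z s
    obtain ⟨Y, hY⟩ := exists_isGeodesicAt_of_forall (A := A) hflat v
    obtain ⟨ε, hε, hex⟩ := exists_isGeodesicAt A hflat v
    have hPε : P ε := hex.self_of_nhds
    have hY0 : Y 0 = v := (hY 0 ⟨ε, by simpa using hε, hPε⟩).2 rfl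
    have hmono : ∀ a b, a ≤ b → P b → P a := fun a b hab ⟨Z, hZ0, hZ⟩ ↦
      ⟨Z, hZ0, fun s hs ↦ hZ s ⟨by linarith [hs.1], by linarith [hs.2]⟩⟩
    by_cases hP : ∀ a, P a
    · exact ⟨Y, hY0, fun t ↦ (hY t ⟨|t| + 1, by linarith, hP _⟩).1⟩
    exfalso
    push Not at hP
    obtain ⟨b, hb⟩ := hP
    let s : Set ℝ := {a | P a}
    have hbdd : BddAbove s := ⟨b, fun a ha ↦ by
      by_contra hab
      exact hb (hmono b a (le_of_not_ge hab) ha)⟩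
    have ha₀ : 0 < sSup s := hε.trans_le (le_csSup hbdd hPε)
    have hYs : ∀ t ∈ Ioo (-sSup s) (sSup s), IsGeodesicAt A cov Y t := by
      intro t ht
      obtain ⟨a, ha, hta⟩ := exists_lt_of_lt_csSup ⟨ε, hPε⟩ (abs_lt.2 ht)
      exact (hY t ⟨a, hta, ha⟩).1
    -- Extending the geodesic on the largest symmetric interval first to the right and then to the
    -- left contradicts maximality.
    obtain ⟨δ, hδ, Z, hZ0, hZ⟩ := IsGeodesicAt.exists_extend_right hflat hYs (t₀ := 0)
      ⟨by linarith, ha₀⟩ (h _ _ Y (by linarith) hYs).1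
    obtain ⟨δ', hδ', Z', hZ0', hZ'⟩ := IsGeodesicAt.exists_extend_left hflat hZ (t₀ := 0)
      ⟨by linarith, by linarith⟩ (h _ _ Z (by linarith) hZ).2
    have hlt : sSup s < sSup s + min δ δ' := by
      have := lt_min hδ hδ'
      linarith
    refine absurd (le_csSup hbdd (a := sSup s + min δ δ') ?_) (not_le.2 hlt)
    refine ⟨Z', hZ0'.trans (hZ0.trans hY0), fun t ht ↦ hZ' t ⟨?_, ?_⟩⟩
    · linarith [ht.1, min_le_right δ δ']
    · linarith [ht.2, min_le_left δ δ']
  intro J X hJ hJn hX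
  obtain ⟨p, hp, q, hq, hpq⟩ := hJn.exists_lt
  have hIcc : Icc p q ⊆ J := hJ.out hp hq
  let t₀ := (p + q) / 2
  have ht₀ : t₀ ∈ interior J := by
    refine mem_interior_iff_mem_nhds.2 (mem_of_superset (Icc_mem_nhds ?_ ?_) hIcc)
    · simp only [t₀]; linarith
    · simp only [t₀]; linarith
  obtain ⟨Y, hY0, hY⟩ := hall (X t₀)
  have hY' : ∀ t, IsGeodesicAt A cov (fun s ↦ Y (s + (-t₀))) t := fun t ↦
    (hY (t + (-t₀))).comp_add (-t₀)
  refine ⟨fun s ↦ Y (s + (-t₀)), isGeodesicOn_univ hflat hY', ?_⟩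
  have heq : EqOn (fun s ↦ Y (s + (-t₀))) X (interior J) :=
    eqOn_of_isGeodesicAt (A := A) hflat isOpen_interior hJ.interior.isPreconnected
      (fun t _ ↦ hY' t) (fun t ht ↦ hX.isGeodesicAt hflat (mem_interior_iff_mem_nhds.1 ht)) ht₀
      (by simp [hY0])
  -- An endpoint belonging to `J` is reached by continuity from the interior, which is dense in `J`.
  intro t ht
  have hcl : t ∈ closure (interior J) := by
    have := (hJ.convex (𝕜 := ℝ)).closure_interior_eq_closure_of_nonempty_interior ⟨t₀, ht₀⟩
    rw [this]
    exact subset_closure ht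
  have : NeBot (nhdsWithin t (interior J)) := mem_closure_iff_nhdsWithin_neBot.1 hcl
  refine tendsto_nhds_unique_of_eventuallyEq (l := nhdsWithin t (interior J))
    ((hY' t).continuousAt.tendsto.mono_left nhdsWithin_le_nhds)
    ((hX.contMDiffOn t ht).continuousWithinAt.tendsto.mono_left
      (nhdsWithin_mono t interior_subset)) ?_
  filter_upwards [self_mem_nhdsWithin] with r hr
  exact heq hr

end Extension

/-! ### Completeness from an invariant metric -/

section InvariantMetric

variable {E : Type*} [NormedAddCommGroup E] [NormedSpace ℝ E] [FiniteDimensional ℝ E]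
  {M : Type*} [TopologicalSpace M] [ChartedSpace E M] [IsManifold 𝓘(ℝ, E) ∞ M]
  {F : Type*} [NormedAddCommGroup F] [NormedSpace ℝ F]
  {V : M → Type*} [TopologicalSpace (TotalSpace F V)]
  [∀ x, AddCommGroup (V x)] [∀ x, Module ℝ (V x)] [∀ x, TopologicalSpace (V x)]
  [∀ x, IsTopologicalAddGroup (V x)] [∀ x, ContinuousSMul ℝ (V x)]
  [FiberBundle F V] [VectorBundle ℝ F V] [ContMDiffVectorBundle ∞ F V 𝓘(ℝ, E)]
  [T2Space M]
  {A : LieAlgebroid E F V} {cov : CovariantDerivative 𝓘(ℝ, E) F V}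
  {σ : ContMDiffRiemannianMetric 𝓘(ℝ, E) ∞ E (TangentSpace 𝓘(ℝ, E) : M → Type _)}
  {X : ℝ → TotalSpace F V} {a b : ℝ}

theorem IsGeodesicAt.hasMFDerivAt_proj {t : ℝ} (h : IsGeodesicAt A cov X t) :
    HasMFDerivAt 𝓘(ℝ, ℝ) 𝓘(ℝ, E) (fun s ↦ (X s).proj) t
      ((1 : ℝ →L[ℝ] ℝ).smulRight (A.anchor (X t).proj (X t).2)) := by
  obtain ⟨S, h1, h2, h3⟩ := h
  have h : ∀ v : TotalSpace F V, v = ⟨v.proj, S v.proj⟩ → v.2 = S v.proj := by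
    rintro ⟨x, u⟩ hv
    simpa using hv
  rw [h _ h2.self_of_nhds]
  exact h3.hasMFDerivAt

theorem contMDiff_inner (W : Cₛ^∞⟮𝓘(ℝ, E); E, (TangentSpace 𝓘(ℝ, E) : M → Type _)⟯) :
    ContMDiff 𝓘(ℝ, E) 𝓘(ℝ, ℝ) ∞ (fun y ↦ σ.inner y (W y) (W y)) := by
  intro x
  have : ContMDiffAt 𝓘(ℝ, E) (𝓘(ℝ, E).prod 𝓘(ℝ, ℝ)) ∞
      (fun y ↦ TotalSpace.mk' ℝ (E := Bundle.Trivial M ℝ) y (σ.inner y (W y) (W y))) x :=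
    ContMDiffAt.clm_bundle_apply₂ (F₁ := E) (F₂ := E) σ.contMDiff.contMDiffAt
      W.contMDiff.contMDiffAt W.contMDiff.contMDiffAt
  simp only [contMDiffAt_totalSpace] at this
  exact this.2

/-- Geodesics have constant speed for an invariant metric. -/
theorem IsInvariantMetric.hasFDerivAt_speed (hσ : IsInvariantMetric A cov σ) {t : ℝ}
    (h : IsGeodesicAt A cov X t) :
    HasFDerivAt (fun s ↦ σ.inner (X s).proj (A.anchor _ (X s).2) (A.anchor _ (X s).2))
      (0 : ℝ →L[ℝ] ℝ) t := by
  obtain ⟨S, h1, h2, h3⟩ := h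
  have hS := hσ S (anchorField A S) (anchorField A S) (X t).proj
  -- `∇̄_S (# S)` vanishes: `S` is parallel, and `# S` commutes with itself.
  have hzero : A.assocConn cov S (anchorField A S) (X t).proj = 0 := by
    rw [LieAlgebroid.assocConn, h1.self_of_nhds, zero_apply, map_zero, zero_add]
    simp only [anchorField_apply]
    rw [VectorField.mlieBracket_self]
    rfl
  rw [hzero, map_zero, zero_apply, map_zero, sub_zero, sub_zero] at hS
  have hg := ((contMDiff_inner (σ := σ) (anchorField A S)).contMDiffAt (x := (X t).proj)
    ).mdifferentiableAt (by simp)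
  have hcomp := hg.hasMFDerivAt.comp t h3.hasMFDerivAt
  have hd : HasFDerivAt (fun s ↦ σ.inner (X s).proj (anchorField A S (X s).proj)
      (anchorField A S (X s).proj)) (0 : ℝ →L[ℝ] ℝ) t := by
    refine hcomp.hasFDerivAt.congr_fderiv (ContinuousLinearMap.ext_ring ?_)
    refine Eq.trans ?_ hS
    exact congrArg (mvfderiv 𝓘(ℝ, E) (F := ℝ)
      (fun y ↦ σ.inner y (anchorField A S y) (anchorField A S y)) (X t).proj) (one_smul ℝ _)
  refine hd.congr_of_eventuallyEq ?_
  filter_upwards [h2] with s hs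
  have h : ∀ v : TotalSpace F V, v = ⟨v.proj, S v.proj⟩ → v.2 = S v.proj := by
    rintro ⟨x, u⟩ hv
    simpa using hv
  rw [h _ hs]
  rfl

theorem IsInvariantMetric.speed_eq (hσ : IsInvariantMetric A cov σ)
    (hX : ∀ t ∈ Ioo a b, IsGeodesicAt A cov X t) {s t : ℝ} (hs : s ∈ Ioo a b) (ht : t ∈ Ioo a b) :
    σ.inner (X s).proj (A.anchor _ (X s).2) (A.anchor _ (X s).2) =
      σ.inner (X t).proj (A.anchor _ (X t).2) (A.anchor _ (X t).2) :=
  isOpen_Ioo.is_const_of_fderiv_eq_zero (𝕜 := ℝ) isPreconnected_Ioo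
    (fun r hr ↦ (hσ.hasFDerivAt_speed (hX r hr)).differentiableAt.differentiableWithinAt)
    (fun r hr ↦ (hσ.hasFDerivAt_speed (hX r hr)).fderiv) hs ht

theorem isCompleteMetric_of_compactSpace [CompactSpace M]
    (σ : ContMDiffRiemannianMetric 𝓘(ℝ, E) ∞ E (TangentSpace 𝓘(ℝ, E) : M → Type _)) :
    IsCompleteMetric σ := by
  have : LocallyCompactSpace M := Manifold.locallyCompact_of_finiteDimensional 𝓘(ℝ, E)
  let _ : RiemannianBundle (fun x : M ↦ TangentSpace 𝓘(ℝ, E) x) :=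
    ⟨σ.toContinuousRiemannianMetric.toRiemannianMetric⟩
  let _ : EMetricSpace M := EMetricSpace.ofRiemannianMetric 𝓘(ℝ, E) M
  exact complete_of_compact

/-- Constant speed `K` gives the footprint length `K (t - s)` on `[s, t]`, so it is `K`-Lipschitz
for the Riemannian distance and maps Cauchy filters of times to Cauchy filters in the complete space
`M`. -/
theorem IsInvariantMetric.exists_tendsto (hσ : IsInvariantMetric A cov σ)
    (hc : IsCompleteMetric σ) (hX : ∀ t ∈ Ioo a b, IsGeodesicAt A cov X t) {l : Filter ℝ}
    (hl : Cauchy l) (hle : l ≤ 𝓟 (Ioo a b)) :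
    ∃ x, Tendsto (fun s ↦ (X s).proj) l (𝓝 x) := by
  have : LocallyCompactSpace M := Manifold.locallyCompact_of_finiteDimensional 𝓘(ℝ, E)
  let _ : RiemannianBundle (fun x : M ↦ TangentSpace 𝓘(ℝ, E) x) :=
    ⟨σ.toContinuousRiemannianMetric.toRiemannianMetric⟩
  let _ : EMetricSpace M := EMetricSpace.ofRiemannianMetric 𝓘(ℝ, E) M
  have hcomp : CompleteSpace M := hc
  obtain ⟨t₀, ht₀⟩ : (Ioo a b).Nonempty := by
    have := hl.1
    exact Filter.nonempty_of_mem (le_principal_iff.1 hle)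
  let K : NNReal := ‖A.anchor (X t₀).proj (X t₀).2‖₊
  have hnorm : ∀ s ∈ Ioo a b, ‖A.anchor (X s).proj (X s).2‖ₑ = K := by
    intro s hs
    have e : ∀ (x : M) (v : TangentSpace 𝓘(ℝ, E) x), ‖v‖ = √(σ.inner x v v) :=
      fun x v ↦ norm_eq_sqrt_real_inner v
    have h : ‖A.anchor (X s).proj (X s).2‖ = ‖A.anchor (X t₀).proj (X t₀).2‖ := by
      rw [e, e, hσ.speed_eq hX hs ht₀]
    exact congrArg ENNReal.ofNNReal (NNReal.eq h)
  have hlip : LipschitzOnWith K (fun s ↦ (X s).proj) (Ioo a b) := by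
    have hle : ∀ s ∈ Ioo a b, ∀ t ∈ Ioo a b, s ≤ t →
        edist (X s).proj (X t).proj ≤ K * edist s t := by
      intro s hs t ht hst
      have hsub : Icc s t ⊆ Ioo a b := fun r hr ↦ ⟨hs.1.trans_le hr.1, hr.2.trans_lt ht.2⟩
      have h1 := Manifold.riemannianEDist_le_pathELength (I := 𝓘(ℝ, E))
        (γ := fun s ↦ (X s).proj) (a := s) (b := t)
        (fun r hr ↦ (((contMDiffAt_proj V).comp r (hX r (hsub hr)).contMDiffAt).of_le
          ENat.LEInfty.out).contMDiffWithinAt) rfl rfl hst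
      refine h1.trans (le_of_eq ?_)
      rw [Manifold.pathELength_eq_lintegral_mfderiv_Icc]
      have h2 : ∀ r ∈ Icc s t, ‖mfderiv 𝓘(ℝ, ℝ) 𝓘(ℝ, E) (fun s ↦ (X s).proj) r (1 : ℝ)‖ₑ =
          (K : ENNReal) := by
        intro r hr
        rw [← hnorm r (hsub hr), (hX r (hsub hr)).hasMFDerivAt_proj.mfderiv]
        exact congrArg enorm (one_smul ℝ (A.anchor (X r).proj (X r).2))
      refine (MeasureTheory.setLIntegral_congr_fun measurableSet_Icc h2).trans ?_
      rw [MeasureTheory.lintegral_const, MeasureTheory.Measure.restrict_apply_univ,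
        Real.volume_Icc, edist_comm, edist_dist, Real.dist_eq, abs_of_nonneg (sub_nonneg.2 hst)]
    intro s hs t ht
    rcases le_total s t with h | h
    · exact hle s hs t ht h
    · rw [edist_comm, edist_comm s]
      exact hle t ht s hs h
  have hcauchy := hl.map_of_le hlip.uniformContinuousOn hle
  obtain ⟨x, hx⟩ := CompleteSpace.complete hcauchy
  exact ⟨x, hx⟩

variable [FiniteDimensional ℝ F] [CovariantDerivative.ContMDiffCovariantDerivative cov ∞]

/-- A geodesic whose footprint converges has a cluster point. -/
theorem exists_mapClusterPt_of_tendsto (hflat : IsFlat cov)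
    (hX : ∀ t ∈ Ioo a b, IsGeodesicAt A cov X t) {l : Filter ℝ} [NeBot l] {x : M}
    (hx : Tendsto (fun s ↦ (X s).proj) l (𝓝 x))
    (hl : ∀ s ∈ l, ∃ c d, Ioo c d ∈ l ∧ Ioo c d ⊆ s ∩ Ioo a b) :
    ∃ v, MapClusterPt v l X := by
  obtain ⟨B, hB⟩ := exists_flatFrame cov hflat x
  -- The frame coordinates are locally constant; they are constant on a set of the filter because
  -- that set can be taken to be an interval.
  obtain ⟨c, d, hcd, hsub⟩ := hl _ (hx.eventually (B.isOpen_dom.mem_nhds hB))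
  obtain ⟨t₀, ht₀⟩ := Filter.nonempty_of_mem hcd
  have hd : ∀ t ∈ Ioo c d, HasFDerivAt (fun s ↦ B.coord (X s)) (0 : ℝ →L[ℝ] F) t := by
    intro t ht
    obtain ⟨S, h1, h2, h3⟩ := hX t (hsub ht).2
    have hdom : (X t).proj ∈ B.dom := (hsub ht).1
    refine (hasFDerivAt_const (B.coord ⟨(X t).proj, S (X t).proj⟩) t).congr_of_eventuallyEq ?_
    filter_upwards [h2, h3.continuousAt.eventually (B.eventually_eq_sec hdom h1),
      h3.continuousAt.eventually (B.isOpen_dom.mem_nhds hdom)] with s a b c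
    rw [a, b, B.coord_sec _ c]
  have hconst : ∀ t ∈ Ioo c d, X t = ⟨(X t).proj, B.sec (B.coord (X t₀)) (X t).proj⟩ := by
    intro t ht
    have h := isOpen_Ioo.is_const_of_fderiv_eq_zero (𝕜 := ℝ) isPreconnected_Ioo
      (fun r hr ↦ (hd r hr).differentiableAt.differentiableWithinAt)
      (fun r hr ↦ (hd r hr).fderiv) ht ht₀
    rw [← h, B.sec_coord _ (hsub ht).1]
  refine ⟨⟨x, B.sec (B.coord (X t₀)) x⟩, Tendsto.mapClusterPt ?_⟩
  refine (((B.sec (B.coord (X t₀))).contMDiff.continuous.tendsto x).comp hx).congr' ?_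
  filter_upwards [hcd] with t ht
  exact (hconst t ht).symm

/-- A flat connection that admits an invariant complete Riemannian metric is complete. -/
theorem IsInvariantMetric.isGeodesicallyComplete (hflat : IsFlat cov)
    (hσ : IsInvariantMetric A cov σ) (hc : IsCompleteMetric σ) :
    IsGeodesicallyComplete A cov := by
  refine isGeodesicallyComplete_of_mapClusterPt hflat fun a b X hab hX ↦ ⟨?_, ?_⟩
  · obtain ⟨x, hx⟩ := hσ.exists_tendsto hc hX (l := 𝓝[<] b) (cauchy_nhds.mono inf_le_left)
      (le_principal_iff.2 (Ioo_mem_nhdsLT hab))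
    refine exists_mapClusterPt_of_tendsto hflat hX hx fun s hs ↦ ?_
    obtain ⟨c, hc, hcs⟩ := (mem_nhdsLT_iff_exists_Ioo_subset).1
      (inter_mem hs (Ioo_mem_nhdsLT hab))
    exact ⟨c, b, Ioo_mem_nhdsLT hc, hcs⟩
  · obtain ⟨x, hx⟩ := hσ.exists_tendsto hc hX (l := 𝓝[>] a) (cauchy_nhds.mono inf_le_left)
      (le_principal_iff.2 (Ioo_mem_nhdsGT hab))
    refine exists_mapClusterPt_of_tendsto hflat hX hx fun s hs ↦ ?_
    obtain ⟨c, hc, hcs⟩ := (mem_nhdsGT_iff_exists_Ioo_subset).1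
      (inter_mem hs (Ioo_mem_nhdsGT hab))
    exact ⟨a, c, Ioo_mem_nhdsGT hc, hcs⟩

end InvariantMetric

/-! ### Global parallel sections over a covering -/

section ParallelExtension

variable {E : Type*} [NormedAddCommGroup E] [NormedSpace ℝ E] [FiniteDimensional ℝ E]
  {M : Type*} [TopologicalSpace M] [ChartedSpace E M] [IsManifold 𝓘(ℝ, E) ∞ M]
  {F : Type*} [NormedAddCommGroup F] [NormedSpace ℝ F] [FiniteDimensional ℝ F]
  {V : M → Type*} [TopologicalSpace (TotalSpace F V)]
  [∀ x, AddCommGroup (V x)] [∀ x, Module ℝ (V x)] [∀ x, TopologicalSpace (V x)]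
  [∀ x, IsTopologicalAddGroup (V x)] [∀ x, ContinuousSMul ℝ (V x)]
  [FiberBundle F V] [VectorBundle ℝ F V] [ContMDiffVectorBundle ∞ F V 𝓘(ℝ, E)]
  [T2Space M] {cov : CovariantDerivative 𝓘(ℝ, E) F V}
  {M' : Type*} [TopologicalSpace M'] {p : M' → M}

/-- A type synonym of the model fibre, endowed with the discrete topology. -/
def DiscreteModel (F : Type*) : Type _ := F

instance (F : Type*) : TopologicalSpace (DiscreteModel F) := ⊥

instance (F : Type*) : DiscreteTopology (DiscreteModel F) := ⟨rfl⟩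

namespace FlatFrame

theorem eventually_coord_eq (B : FlatFrame cov) {T : Cₛ^∞⟮𝓘(ℝ, E); F, V⟯} {x : M}
    (hx : x ∈ B.dom) (hT : ∀ᶠ y in 𝓝 x, cov T y = 0) :
    ∀ᶠ y in 𝓝 x, B.coord ⟨y, T y⟩ = B.coord ⟨x, T x⟩ := by
  filter_upwards [B.eventually_eq_sec hx hT, B.isOpen_dom.mem_nhds hx] with y hy hyB
  rw [hy, B.coord_sec y hyB]

theorem eventually_coord_sec_eq (B C : FlatFrame cov) {x : M} (hB : x ∈ B.dom) (hC : x ∈ C.dom)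
    (u : F) : ∀ᶠ y in 𝓝 x, C.coord ⟨y, B.sec u y⟩ = C.coord ⟨x, B.sec u x⟩ :=
  C.eventually_coord_eq hC (B.eventually_cov_sec hB u)

/-- The bundle of germs of parallel sections, a fibre bundle with discrete fibres. -/
def leafBundle (B : M → FlatFrame cov) (hB : ∀ x, x ∈ (B x).dom) :
    FiberBundleCore M M (DiscreteModel F) where
  baseSet i := (B i).dom
  isOpen_baseSet i := (B i).isOpen_dom
  indexAt := id
  mem_baseSet_at := hB
  coordChange i j x u := (B j).coord ⟨x, (B i).sec (show F from u) x⟩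
  coordChange_self i x hx u := (B i).coord_sec x hx u
  continuousOn_coordChange i j := by
    rintro ⟨x, u⟩ ⟨⟨hi, hj⟩, -⟩
    let f : M × DiscreteModel F → DiscreteModel F :=
      fun q ↦ (B j).coord ⟨q.1, (B i).sec (show F from q.2) q.1⟩
    have hc : ContinuousAt (fun _ : M × DiscreteModel F ↦ f (x, u)) (x, u) := continuousAt_const
    -- A parallel section of one frame has locally constant coordinates in another, so the
    -- transition maps are continuous for the discrete topology on fibres.
    refine (hc.congr (g := f) ?_).continuousWithinAt
    have h := (B i).eventually_coord_sec_eq (B j) hi hj u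
    rw [nhds_prod_eq, nhds_discrete (DiscreteModel F), prod_pure, EventuallyEq, eventually_map]
    exact h.mono fun _ hy ↦ hy.symm
  coordChange_comp i j k x hx u := by
    have h := (B j).sec_coord ⟨x, (B i).sec (show F from u) x⟩ hx.1.2
    exact congrArg (fun v ↦ (B k).coord ⟨x, v⟩) h

end FlatFrame

/-- Over a simply connected space, there are parallel sections with arbitrary initial values. -/
theorem exists_parallel_section [CovariantDerivative.ContMDiffCovariantDerivative cov ∞] (hflat : IsFlat cov)
    [SimplyConnectedSpace M'] [LocallyPathConnectedSpace M'] (hp : Continuous p) (c : M')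
    (v : V (p c)) : ∃ ξ ∈ parallelSections cov p, ξ c = v := by
  choose B hB using fun x ↦ exists_flatFrame cov hflat x
  let Z := FlatFrame.leafBundle B hB
  -- With discrete fibres the bundle of germs is a covering of `M`. Over the simply connected `M'`
  -- the map `p` lifts to it with any prescribed initial germ, and the lift is the required section.
  have hcov : IsCoveringMap (π (DiscreteModel F) Z.Fiber) := FiberBundle.isCoveringMap
  obtain ⟨G, ⟨hG0, hG⟩, -⟩ := hcov.existsUnique_continuousMap_lifts ⟨p, hp⟩ c
    ⟨p c, ((B (p c)).coord ⟨p c, v⟩ : F)⟩ rfl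
  have hproj : ∀ y, (G y).proj = p y := fun y ↦ congrFun hG y
  let g : M' → F := fun y ↦ (G y).2
  -- Continuity of the lift into a discrete fibre means that its coordinates in a fixed frame are
  -- locally constant.
  have hloc : ∀ x, ∀ᶠ y in 𝓝 x, (B (p x)).coord ⟨p y, (B (p y)).sec (g y) (p y)⟩ = g x := by
    intro x
    have h1 : ContinuousAt (Z.localTriv (p x)) (G x) := by
      refine (Z.localTriv (p x)).continuousAt ?_
      rw [Z.mem_localTriv_source]
      change (G x).proj ∈ (B (p x)).dom
      rw [hproj]
      exact hB _
    have h2 : ContinuousAt (fun y ↦ ((Z.localTriv (p x)) (G y)).2) x :=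
      continuousAt_snd.comp (h1.comp G.continuous.continuousAt)
    have h3 : ∀ y, ((Z.localTriv (p x)) (G y)).2 =
        (B (p x)).coord ⟨p y, (B (p y)).sec (g y) (p y)⟩ := by
      intro y
      rw [← hproj y]
      rfl
    rw [ContinuousAt, nhds_discrete (DiscreteModel F), tendsto_pure] at h2
    filter_upwards [h2] with y hy
    rw [h3, h3, (B (p x)).coord_sec _ (hB _)] at hy
    exact hy
  refine ⟨fun y ↦ (B (p y)).sec (g y) (p y), fun x ↦ ⟨(B (p x)).sec (g x), ?_⟩, ?_⟩
  · filter_upwards [hloc x, hp.continuousAt.eventually ((B (p x)).isOpen_dom.mem_nhds (hB _))]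
      with y hy hyB
    refine ⟨?_, (B (p x)).cov_sec _ hyB _⟩
    rw [← hy]
    exact ((B (p x)).sec_coord ⟨p y, _⟩ hyB).symm
  · have : g c = (B (p c)).coord ⟨p c, v⟩ := by
      change (show F from (G c).2) = _
      rw [hG0]
    change (B (p c)).sec (g c) (p c) = v
    rw [this]
    exact (B (p c)).sec_coord ⟨p c, v⟩ (hB _)

/-- Near a point, a parallel section of the pullback is constant in a flat frame. -/
theorem FlatFrame.eventually_parallel_eq (hp : IsCoveringMap p) (B : FlatFrame cov)
    {ξ : ∀ x : M', V (p x)} (hξ : ξ ∈ parallelSections cov p) {x : M'} (hx : p x ∈ B.dom) :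
    ∀ᶠ y in 𝓝 x, B.coord ⟨p y, ξ y⟩ = B.coord ⟨p x, ξ x⟩ := by
  obtain ⟨S, hS⟩ := hξ x
  have h : ∀ᶠ y in 𝓝 (p x), cov S y = 0 := by
    rw [← hp.isLocalHomeomorph.map_nhds_eq x]
    exact hS.mono fun _ h ↦ h.2
  filter_upwards [hS, hp.continuous.continuousAt.eventually (B.eventually_coord_eq hx h)]
    with y h1 h2
  rw [h1.1, hS.self_of_nhds.1, h2]

/-- The frame coordinates of `ξ` are locally constant on `W`, hence constant since `W` is
preconnected. -/
theorem FlatFrame.parallel_eq_sec (hp : IsCoveringMap p) (B : FlatFrame cov)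
    {ξ : ∀ x : M', V (p x)} (hξ : ξ ∈ parallelSections cov p) {W : Set M'}
    (hW : IsPreconnected W) (hWB : MapsTo p W B.dom) {c x : M'} (hc : c ∈ W) (hx : x ∈ W) :
    ξ x = B.sec (B.coord ⟨p c, ξ c⟩) (p x) := by
  have h : B.coord ⟨p x, ξ x⟩ = B.coord ⟨p c, ξ c⟩ := by
    let f : M' → DiscreteModel F := fun y ↦ B.coord ⟨p y, ξ y⟩
    have hf : ContinuousOn f W := by
      intro y hy
      have hc : ContinuousAt f y := by
        rw [ContinuousAt, nhds_discrete (DiscreteModel F), tendsto_pure]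
        exact B.eventually_parallel_eq hp hξ (hWB hy)
      exact hc.continuousWithinAt
    exact hW.constant_of_mapsTo (T := univ) IsDiscrete.univ hf (mapsTo_univ _ _) hx hc
  rw [← h]
  exact (B.sec_coord ⟨p x, ξ x⟩ (hWB hx)).symm

/-- Expanding in a basis of `F` gives joint continuity. Bounded coordinates over a compact set
thereby yield a compact set of vectors. -/
theorem FlatFrame.continuous_sec (B : FlatFrame cov) :
    Continuous (fun z : F × M ↦ (⟨z.2, B.sec z.1 z.2⟩ : TotalSpace F V)) := by
  rw [continuous_iff_continuousAt]
  rintro ⟨u₀, x₀⟩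
  rw [FiberBundle.continuousAt_totalSpace]
  refine ⟨continuousAt_snd, ?_⟩
  let b := Module.finBasis ℝ F
  let e := trivializationAt F V x₀
  have hbase : ∀ᶠ z : F × M in 𝓝 (u₀, x₀), z.2 ∈ e.baseSet :=
    continuousAt_snd.eventually (e.open_baseSet.mem_nhds (mem_baseSet_trivializationAt F V x₀))
  refine ContinuousAt.congr (f := fun z : F × M ↦ ∑ i, b.repr z.1 i • (e ⟨z.2, B.sec (b i) z.2⟩).2)
    ?_ ?_
  · refine tendsto_finsetSum _ fun i _ ↦ ContinuousAt.smul ?_ ?_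
    · exact ((b.coord i).continuous_of_finiteDimensional.comp continuous_fst).continuousAt
    · have h := (B.sec (b i)).contMDiff.continuous.continuousAt (x := x₀)
      have h2 := ((FiberBundle.continuousAt_totalSpace F _).1 h).2
      exact ContinuousAt.comp (f := Prod.snd) (x := (u₀, x₀)) h2 continuousAt_snd
  · filter_upwards [hbase] with z hz
    have hsum : B.sec z.1 = ∑ i, b.repr z.1 i • B.sec (b i) := by
      conv_lhs => rw [← b.sum_repr z.1]
      rw [map_sum]
      simp only [map_smul]
    have h : ∀ S : Cₛ^∞⟮𝓘(ℝ, E); F, V⟯, (e ⟨z.2, S z.2⟩).2 = e.linearMapAt ℝ z.2 (S z.2) := by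
      intro S
      rw [e.linearMapAt_apply, if_pos hz]
    simp only [h]
    refine Eq.trans ?_ (h _).symm
    have hev : B.sec z.1 z.2 = ∑ i, b.repr z.1 i • B.sec (b i) z.2 := by
      rw [hsum]
      exact map_sum (evalSection (E := E) (F := F) (V := V) z.2) _ _
    rw [hev, map_sum]
    simp only [map_smul]

end ParallelExtension

/-! ### Simply connected coverings and their covering transformations -/

section Covering

variable {B B' : Type*} [TopologicalSpace B] [TopologicalSpace B'] {p : B' → B}

theorem _root_.IsCoveringMap.surjective_of_pathConnectedSpace [PathConnectedSpace B] [Nonempty B']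
    (hp : IsCoveringMap p) : Function.Surjective p := by
  intro x
  obtain ⟨c⟩ := ‹Nonempty B'›
  let γ := PathConnectedSpace.somePath (p c) x
  obtain ⟨Γ, hΓ, -⟩ := hp.exists_path_lifts γ c γ.source
  exact ⟨Γ 1, (congrFun hΓ 1).trans γ.target⟩

theorem _root_.IsCoveringMap.locallyPathConnectedSpace [LocallyPathConnectedSpace B]
    (hp : IsCoveringMap p) (hs : Function.Surjective p) : LocallyPathConnectedSpace B' := by
  refine ⟨fun c ↦ ⟨fun s ↦ ⟨fun hsc ↦ ?_, fun ⟨t, ⟨ht, _⟩, hts⟩ ↦ mem_of_superset ht hts⟩⟩⟩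
  obtain ⟨e, hce, rfl⟩ := hp.isLocalHomeomorph c
  have h : e.target ∩ e.symm ⁻¹' s ∈ 𝓝 (e c) := by
    refine inter_mem (e.open_target.mem_nhds (e.map_source hce)) ?_
    have := e.continuousAt_symm (e.map_source hce)
    rw [ContinuousAt, e.left_inv hce] at this
    exact this hsc
  obtain ⟨U, ⟨hU, hUc⟩, hUs⟩ := (path_connected_basis (e c)).mem_iff.1 h
  refine ⟨e.symm '' U, ⟨?_, hUc.image' (e.continuousOn_symm.mono fun y hy ↦ (hUs hy).1)⟩, ?_⟩
  · have := e.symm.image_mem_nhds (e.map_source hce) hU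
    rwa [e.left_inv hce] at this
  · rintro _ ⟨y, hy, rfl⟩
    exact (hUs hy).2

/-- Lift `p` through itself, once sending `c` to `x` and once sending `x` to `c`. Both composites of
the two lifts are lifts of `p` with a fixed point, hence the identity. -/
theorem exists_mem_deckGroup [SimplyConnectedSpace B'] [LocallyPathConnectedSpace B']
    (hp : IsCoveringMap p) {c x : B'} (h : p c = p x) : ∃ φ : deckGroup p, φ.1 c = x := by
  obtain ⟨f, ⟨hf, hpf⟩, -⟩ := hp.existsUnique_continuousMap_lifts ⟨p, hp.continuous⟩ c x h.symm
  obtain ⟨g, ⟨hg, hpg⟩, -⟩ := hp.existsUnique_continuousMap_lifts ⟨p, hp.continuous⟩ x c h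
  have h1 : ∀ y, p (f y) = p y := fun y ↦ congrFun hpf y
  have h2 : ∀ y, p (g y) = p y := fun y ↦ congrFun hpg y
  have hgf : g ∘ f = id := hp.eq_of_comp_eq (g.continuous.comp f.continuous) continuous_id
    (funext fun y ↦ (h2 _).trans (h1 y)) c (by rw [Function.comp_apply, hf, hg]; rfl)
  have hfg : f ∘ g = id := hp.eq_of_comp_eq (f.continuous.comp g.continuous) continuous_id
    (funext fun y ↦ (h1 _).trans (h2 y)) x (by rw [Function.comp_apply, hg, hf]; rfl)
  exact ⟨⟨⟨⟨f, g, congrFun hgf, congrFun hfg⟩, f.continuous, g.continuous⟩, h1⟩, hf⟩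

end Covering

/-! ### Completeness from compact monodromy -/

section CompactMonodromy

variable {E : Type*} [NormedAddCommGroup E] [NormedSpace ℝ E] [FiniteDimensional ℝ E]
  {M : Type*} [TopologicalSpace M] [ChartedSpace E M] [IsManifold 𝓘(ℝ, E) ∞ M]
  {F : Type*} [NormedAddCommGroup F] [NormedSpace ℝ F] [FiniteDimensional ℝ F]
  {V : M → Type*} [TopologicalSpace (TotalSpace F V)]
  [∀ x, AddCommGroup (V x)] [∀ x, Module ℝ (V x)] [∀ x, TopologicalSpace (V x)]
  [∀ x, IsTopologicalAddGroup (V x)] [∀ x, ContinuousSMul ℝ (V x)]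
  [FiberBundle F V] [VectorBundle ℝ F V] [ContMDiffVectorBundle ∞ F V 𝓘(ℝ, E)]
  [T2Space M] {A : LieAlgebroid E F V} {cov : CovariantDerivative 𝓘(ℝ, E) F V}
  [CovariantDerivative.ContMDiffCovariantDerivative cov ∞]
  {M' : Type*} [TopologicalSpace M'] {p : M' → M}

/-- The coordinates of vectors in a flat frame, as a linear map on a fibre. -/
def FlatFrame.coordLinear (B : FlatFrame cov) {x : M} (hx : x ∈ B.dom) : V x →ₗ[ℝ] F where
  toFun v := B.coord ⟨x, v⟩
  map_add' v w := by
    refine B.eq_of_sec_eq_sec hx ?_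
    rw [B.sec_coord ⟨x, v + w⟩ hx, map_add]
    exact (congrArg₂ (· + ·) (B.sec_coord ⟨x, v⟩ hx) (B.sec_coord ⟨x, w⟩ hx)).symm
  map_smul' r v := by
    refine B.eq_of_sec_eq_sec hx ?_
    rw [B.sec_coord ⟨x, r • v⟩ hx, RingHom.id_apply, map_smul]
    exact (congrArg (r • ·) (B.sec_coord ⟨x, v⟩ hx)).symm

theorem mk_fibreCast {x y : M} (h : x = y) (v : V x) :
    (⟨y, fibreCast V h v⟩ : TotalSpace F V) = ⟨x, v⟩ := by
  subst h
  rfl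

/-- Every linear map out of a module topology into `F` is continuous, so the compact closure of the
monodromy has compact image under `Λ`. -/
theorem HasCompactMonodromyClosure.exists_isCompact_apply {hC : A.IsCartan cov}
    {hp : IsCoveringMap p} (h : HasCompactMonodromyClosure hC hp)
    (Λ : Module.End ℝ (ParallelAlgebra hC hp) →ₗ[ℝ] F) :
    ∃ Q : Set F, IsCompact Q ∧
      ∀ φ, Λ ((monodromy hC hp φ).1 : Module.End ℝ (ParallelAlgebra hC hp)) ∈ Q := by
  let L := ParallelAlgebra hC hp
  let _ : TopologicalSpace (Module.End ℝ L) := moduleTopology ℝ (Module.End ℝ L)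
  have : IsModuleTopology ℝ (Module.End ℝ L) := ⟨rfl⟩
  let _ : TopologicalSpace (lieAut L) := lieAutTopology L
  have h' : IsCompact (closure (range (monodromy hC hp))) := h
  have hΛ : Continuous Λ := IsModuleTopology.continuous_of_linearMap Λ
  have hc : Continuous fun a : lieAut L ↦ Λ (a.1 : Module.End ℝ L) :=
    hΛ.comp continuous_induced_dom
  exact ⟨_, h'.image hc, fun φ ↦ ⟨_, subset_closure (mem_range_self φ), rfl⟩⟩

variable [SimplyConnectedSpace M'] [LocallyPathConnectedSpace M']

/-- A point `x` above `N` is `φ w` with `w` in one connected neighbourhood `W` of `c`, so the value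
of `ξ` at `x` is that of `μ_{φ⁻¹} ξ` at `w`. On `W` this translate is determined by its frame
coordinates at `c`, and these range over a compact set. -/
theorem HasCompactMonodromyClosure.exists_isCompact_nhds (hflat : IsFlat cov)
    {hC : A.IsCartan cov} {hp : IsCoveringMap p} (h : HasCompactMonodromyClosure hC hp)
    (ξ : ParallelAlgebra hC hp) (c : M') :
    ∃ N ∈ 𝓝 (p c), ∃ K : Set (TotalSpace F V), IsCompact K ∧
      ∀ x, p x ∈ N → (⟨p x, ξ.1 x⟩ : TotalSpace F V) ∈ K := by
  have := Manifold.locallyCompact_of_finiteDimensional (M := M) 𝓘(ℝ, E)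
  obtain ⟨B, hB⟩ := exists_flatFrame cov hflat (p c)
  obtain ⟨W, ⟨hWc, hW⟩, hWB⟩ := (path_connected_basis c).mem_iff.1
    (hp.continuous.continuousAt.preimage_mem_nhds (B.isOpen_dom.mem_nhds hB))
  obtain ⟨N, hN, hNW, hNc⟩ := local_compact_nhds (hp.isOpenMap.image_mem_nhds hWc)
  -- `Λ a` gives the frame coordinates at `c` of the section `a ξ`.
  let Λ : Module.End ℝ (ParallelAlgebra hC hp) →ₗ[ℝ] F :=
    { toFun a := B.coordLinear hB ((a ξ).1 c)
      map_add' a b := map_add (B.coordLinear hB) ((a ξ).1 c) ((b ξ).1 c)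
      map_smul' r a := map_smul (B.coordLinear hB) r ((a ξ).1 c) }
  obtain ⟨Q, hQ, hΛQ⟩ := h.exists_isCompact_apply Λ
  refine ⟨N, hN, _, (hQ.prod hNc).image B.continuous_sec, fun x hx ↦ ?_⟩
  obtain ⟨w, hw, hwx⟩ := hNW hx
  obtain ⟨φ, hφ⟩ := exists_mem_deckGroup hp hwx
  let η := monodromyLinear hC hp φ⁻¹ ξ
  refine ⟨(B.coord ⟨p c, η.1 c⟩, p w), ⟨hΛQ φ⁻¹, by rwa [hwx]⟩, ?_⟩
  have hη := B.parallel_eq_sec hp η.2 hW.isConnected.isPreconnected hWB (mem_of_mem_nhds hWc) hw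
  have hηx : (⟨p w, η.1 w⟩ : TotalSpace F V) = ⟨p (φ.1 w), ξ.1 (φ.1 w)⟩ := mk_fibreCast _ _
  rw [hφ] at hηx
  rw [← hηx, hη]

theorem HasCompactMonodromyClosure.exists_isCompact [CompactSpace M] (hflat : IsFlat cov)
    {hC : A.IsCartan cov} {hp : IsCoveringMap p} (hs : Function.Surjective p)
    (h : HasCompactMonodromyClosure hC hp) (ξ : ParallelAlgebra hC hp) :
    ∃ K : Set (TotalSpace F V), IsCompact K ∧ ∀ x, (⟨p x, ξ.1 x⟩ : TotalSpace F V) ∈ K := by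
  have hloc : ∀ y : M, ∃ N ∈ 𝓝 y, ∃ K : Set (TotalSpace F V), IsCompact K ∧
      ∀ x, p x ∈ N → (⟨p x, ξ.1 x⟩ : TotalSpace F V) ∈ K := by
    intro y
    obtain ⟨c, rfl⟩ := hs y
    exact h.exists_isCompact_nhds hflat ξ c
  choose N hN K hK hNK using hloc
  obtain ⟨t, -, ht⟩ := isCompact_univ.elim_nhds_subcover N fun y _ ↦ hN y
  refine ⟨⋃ y ∈ t, K y, t.isCompact_biUnion fun y _ ↦ hK y, fun x ↦ ?_⟩
  obtain ⟨y, hy, hxy⟩ := mem_iUnion₂.1 (ht (mem_univ (p x)))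
  exact mem_iUnion₂.2 ⟨y, hy, hNK y x hxy⟩

/-- A geodesic is the restriction of a parallel section to a lift of its footprint. -/
theorem IsGeodesicAt.exists_parallel_section (hflat : IsFlat cov) (hC : A.IsCartan cov)
    (hp : IsCoveringMap p) (hs : Function.Surjective p) {X : ℝ → TotalSpace F V} {a b : ℝ}
    (hab : a < b) (hX : ∀ t ∈ Ioo a b, IsGeodesicAt A cov X t) :
    ∃ ξ : ParallelAlgebra hC hp, ∀ t ∈ Ioo a b, ∃ x, X t = ⟨p x, ξ.1 x⟩ := by
  have := t2Space_totalSpace (F := F) (V := V)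
  have hne : (Ioo a b).Nonempty := nonempty_Ioo.2 hab
  have := (convex_Ioo a b).contractibleSpace hne
  have : LocallyPathConnectedSpace (Ioo a b) := isOpen_Ioo.locallyPathConnectedSpace
  obtain ⟨t₀⟩ : Nonempty (Ioo a b) := hne.to_subtype
  have hXc : Continuous fun t : Ioo a b ↦ X t :=
    continuous_iff_continuousAt.2 fun t ↦
      ((hX t t.2).continuousAt).comp continuous_subtype_val.continuousAt
  have hmc : Continuous fun t : Ioo a b ↦ (X t).proj :=
    (FiberBundle.continuous_proj F V).comp hXc
  obtain ⟨c, hc⟩ := hs (X t₀).proj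
  obtain ⟨m, ⟨hm₀, hm⟩, -⟩ := hp.existsUnique_continuousMap_lifts
    (⟨_, hmc⟩ : C(Ioo a b, M)) t₀ c hc
  have hpm : ∀ t : Ioo a b, p (m t) = (X t).proj := fun t ↦ congrFun hm t
  obtain ⟨v, hv⟩ : ∃ v : V (p c), X t₀ = ⟨p c, v⟩ := by
    rw [hc]
    exact ⟨(X t₀).2, rfl⟩
  obtain ⟨ξ, hξ, hξc⟩ := CartanAlgebroid.exists_parallel_section hflat hp.continuous c v
  refine ⟨⟨ξ, hξ⟩, ?_⟩
  let Y : Ioo a b → TotalSpace F V := fun t ↦ ⟨p (m t), ξ (m t)⟩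
  suffices h : {t : Ioo a b | X t = Y t} = univ from fun t ht ↦
    ⟨m ⟨t, ht⟩, (h ▸ mem_univ (⟨t, ht⟩ : Ioo a b) : (⟨t, ht⟩ : Ioo a b) ∈ {t : Ioo a b | X t = Y t})⟩
  have hgerm : ∀ t, ∃ S : Cₛ^∞⟮𝓘(ℝ, E); F, V⟯, (∀ᶠ y in 𝓝 (p (m t)), cov S y = 0) ∧
      ∀ᶠ s in 𝓝 t, Y s = ⟨p (m s), S (p (m s))⟩ := by
    intro t
    obtain ⟨S, hS⟩ := hξ (m t)
    refine ⟨S, ?_, ?_⟩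
    · rw [← hp.isLocalHomeomorph.map_nhds_eq]
      exact hS.mono fun _ h ↦ h.2
    · filter_upwards [m.continuous.continuousAt.eventually hS] with s hs
      exact congrArg (TotalSpace.mk (F := F) (p (m s))) hs.1
  have hYc : Continuous Y := continuous_iff_continuousAt.2 fun t ↦ by
    obtain ⟨S, -, hS⟩ := hgerm t
    exact ((S.contMDiff.continuous.comp (hp.continuous.comp m.continuous)).continuousAt).congr
      (hS.mono fun _ h ↦ h.symm)
  -- The geodesic and the values of `ξ` along the lift agree at `t₀`. The agreement set is closed by
  -- continuity, and open because parallel sections with equal values have equal germs.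
  refine IsClopen.eq_univ ⟨isClosed_eq hXc hYc, ?_⟩ ⟨t₀, ?_⟩
  · refine isOpen_iff_mem_nhds.2 fun t ht ↦ ?_
    obtain ⟨S, h1, h2, -⟩ := hX t t.2
    obtain ⟨T, k1, k2⟩ := hgerm t
    have hST : ∀ᶠ y in 𝓝 (p (m t)), S y = T y := by
      refine eventuallyEq_of_parallel hflat (by rwa [hpm]) k1 ?_
      have h := h2.self_of_nhds
      rw [← hpm t, show X t = Y t from ht, k2.self_of_nhds] at h
      simpa using h.symm
    have h2' : ∀ᶠ s : Ioo a b in 𝓝 t, X s = ⟨(X s).proj, S (X s).proj⟩ :=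
      continuous_subtype_val.continuousAt.eventually h2
    filter_upwards [h2', k2, (hp.continuous.comp m.continuous).continuousAt.eventually hST]
      with s e1 e2 e3
    rw [e1, e2, ← hpm s]
    exact congrArg (TotalSpace.mk (F := F) (p (m s))) e3
  · change X t₀ = ⟨p (m t₀), ξ (m t₀)⟩
    rw [hm₀, hv, hξc]

/-- A geodesic takes values of a single `ξ`, which all lie in one compact set, so it accumulates at
both ends of its interval. -/
theorem HasCompactMonodromyClosure.isGeodesicallyComplete [CompactSpace M] (hflat : IsFlat cov)
    {hC : A.IsCartan cov} {hp : IsCoveringMap p} (hs : Function.Surjective p)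
    (h : HasCompactMonodromyClosure hC hp) : IsGeodesicallyComplete A cov := by
  refine isGeodesicallyComplete_of_mapClusterPt hflat fun a b X hab hX ↦ ?_
  obtain ⟨ξ, hξ⟩ := IsGeodesicAt.exists_parallel_section hflat hC hp hs hab hX
  obtain ⟨K, hK, hξK⟩ := h.exists_isCompact hflat hs ξ
  have hXK : ∀ t ∈ Ioo a b, X t ∈ K := by
    intro t ht
    obtain ⟨x, hx⟩ := hξ t ht
    rw [hx]
    exact hξK x
  constructor
  · obtain ⟨v, -, hv⟩ := hK.exists_mapClusterPt (f := 𝓝[<] b) (u := X)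
      (le_principal_iff.2 (mem_map.2 (mem_of_superset (Ioo_mem_nhdsLT hab) hXK)))
    exact ⟨v, hv⟩
  · obtain ⟨v, -, hv⟩ := hK.exists_mapClusterPt (f := 𝓝[>] a) (u := X)
      (le_principal_iff.2 (mem_map.2 (mem_of_superset (Ioo_mem_nhdsGT hab) hXK)))
    exact ⟨v, hv⟩

end CompactMonodromy

end CartanAlgebroid

end

/-! ### The completeness theorem -/

open Bundle CartanAlgebroid
open scoped Manifold ContDiff

theorem proposition6p2
    {E : Type*} [NormedAddCommGroup E] [NormedSpace ℝ E] [FiniteDimensional ℝ E]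
    -- `M` is a smooth connected manifold
    {M : Type*} [TopologicalSpace M] [ChartedSpace E M] [IsManifold 𝓘(ℝ, E) ∞ M]
    [T2Space M] [SecondCountableTopology M] [ConnectedSpace M]
    -- `V` is a smooth vector bundle of finite rank over `M`
    {F : Type*} [NormedAddCommGroup F] [NormedSpace ℝ F] [FiniteDimensional ℝ F]
    {V : M → Type*} [TopologicalSpace (TotalSpace F V)]
    [∀ x, AddCommGroup (V x)] [∀ x, Module ℝ (V x)] [∀ x, TopologicalSpace (V x)]
    [∀ x, IsTopologicalAddGroup (V x)] [∀ x, ContinuousSMul ℝ (V x)]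
    [FiberBundle F V] [VectorBundle ℝ F V] [ContMDiffVectorBundle ∞ F V 𝓘(ℝ, E)]
    -- `A` is a Lie algebroid structure on `V`, and `cov` a flat Cartan connection
    (A : LieAlgebroid E F V) (cov : CovariantDerivative 𝓘(ℝ, E) F V)
    [CovariantDerivative.ContMDiffCovariantDerivative cov ∞]
    (hC : A.IsCartan cov) (_hflat : IsFlat cov) :
    -- (1), for any model `p : M' → M` of the universal covering of `M`
    (∀ (M' : Type*) [TopologicalSpace M'] [SimplyConnectedSpace M'] (p : M' → M)
      (hp : IsCoveringMap p),
      CompactSpace M → HasCompactMonodromyClosure hC hp → IsGeodesicallyComplete A cov) ∧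
    -- (2)
    (∀ σ : ContMDiffRiemannianMetric 𝓘(ℝ, E) ∞ E (TangentSpace 𝓘(ℝ, E) : M → Type _),
      IsInvariantMetric A cov σ → IsCompleteMetric σ → IsGeodesicallyComplete A cov) ∧
    -- the completeness of the metric in (2) is automatic for compact `M`
    (CompactSpace M →
      ∀ σ : ContMDiffRiemannianMetric 𝓘(ℝ, E) ∞ E (TangentSpace 𝓘(ℝ, E) : M → Type _),
        IsCompleteMetric σ) := by
  refine ⟨fun M' _ _ p hp _ h ↦ ?_, fun σ hσ hc ↦ hσ.isGeodesicallyComplete _hflat hc,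
    fun _ σ ↦ isCompleteMetric_of_compactSpace σ⟩
  -- Local path connectedness passes from `M` to `M'`, where the lifting criterion for coverings
  -- requires it.
  have := ChartedSpace.locallyPathConnectedSpace E M
  have : PathConnectedSpace M := .of_locallyPathConnectedSpace
  have hs := hp.surjective_of_pathConnectedSpace
  have := hp.locallyPathConnectedSpace hs
  exact h.isGeodesicallyComplete _hflat hs
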